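/- **Theorem (lifting a state cycle under quasipositive modification).** Work with rational Khovanov homology $Kh$, computed from the cube of resolutions with $V=\mathbb{Q}\langle v_+,v_-\rangle$. An *enhanced state* is a choice of a $0$- or $1$-smoothing at each crossing of a diagram together with a marking of each resulting loop by $v_+$ or $v_-$; it is a *state cycle* if the corresponding generator $\alpha$ of the chain complex satisfies $d\alpha=0$, and it is *nontrivial* if moreover $[\alpha]\ne 0$ in $Kh$. Let $D$ be an oriented link diagram in the plane and $\alpha$ a nontrivial state cycle of $D$. Suppose that $n$ arcs of $D$ are *braid-parallel* with respect to $\alpha$: they lie on pairwise distinct loops of $\alpha$, these loops are marked by $v_-$, and there is a line transverse to the arcs which touches nothing else of the diagram and crosses all of them in the same direction. (Up to planar isotopy $D$ is in Morse position and the line is horizontal, so that the arcs are $n$ consecutive vertical strands at one level.) Let $B=\prod_k \omega_k\,\tau_{i_k}\,\omega_k^{-1}$ be a quasipositive braid word on $n$ strands, with arbitrary braid words $\omega_k$ and positive generators $\tau_{i_k}$ (the *central* crossings), and let $D'$ be the oriented diagram obtained from $D$ by replacing the $n$ arcs by $B$; crossings of $B$ have the same sign in $D'$ as in $B$. Then: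 1. There is exactly one enhanced state $\widetilde\alpha$ of $D'$ in which all crossings of $D$ are smoothed as in $\alpha$, all positive crossings of $B$ are $0$-smoothed, all negative crossings of $B$ are $1$-smoothed, and every loop is marked as in $\alpha$. Here the loops of $\widetilde\alpha$ are identified with those of $\alpha$: the part of the state inside $B$ consists of $n$ parallel arcs. 2. $\widetilde\alpha$ is a state cycle of $D'$. 3. $D'$ is turned into $D$ by a sequence of steps, each of which either $0$-resolves a central crossing (a saddle move followed by a Reidemeister I move that removes a positive kink) or cancels two adjacent mutually inverse non-central crossings of the braid by a Reidemeister II move. For every such sequence, the composition $\Psi$ of the associated elementary Jacobsson maps is a chain map, hence induces $\Psi\colon Kh(D')\to Kh(D)$, and $\Psi(\widetilde\alpha)=\pm\alpha$, both in the chain complex and in homology. 4. Consequently $\widetilde\alpha$ is nontrivial. -/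

import Mathlib

namespace KhovanovQP

/-! ## Link diagrams

A planar diagram is drawn in Morse position and read from bottom to top, as a list of horizontal
slices.  At each level between two slices the diagram consists of finitely many strands, numbered
`0, 1, 2, …` from left to right; the `k`-th slice lies between level `k` and level `k + 1`.
Every link diagram in the plane is of this form up to planar isotopy. -/

/-- One slice of a diagram.
* `cup i`: a local minimum, creating the strands `i` and `i + 1` of the upper level.
* `cap i`: a local maximum, joining the strands `i` and `i + 1` of the lower level.
* `cross i e`: the strands `i` and `i + 1` cross.  For `e = true` the over-strand runs from lower
  left to upper right, so that the crossing is positive if both strands point upwards;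
  for `e = false` the over-strand runs from lower right to upper left. -/
inductive Slice
  | cup (i : ℕ)
  | cap (i : ℕ)
  | cross (i : ℕ) (e : Bool)

namespace Slice

/-- The horizontal position of the slice. -/
def pos : Slice → ℕ
  | cup i => i
  | cap i => i
  | cross i _ => i

def isCross : Slice → Bool
  | cross _ _ => true
  | _ => false

/-- The type of a crossing (only meaningful for crossings). -/
def type : Slice → Bool
  | cross _ e => e
  | _ => false

/-- The slice can be put on top of `w` strands. -/
def Fits : Slice → ℕ → Prop
  | cup i, w => i ≤ w
  | cap i, w => i + 2 ≤ w
  | cross i _, w => i + 2 ≤ w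

/-- The number of strands above the slice if there are `w` strands below. -/
def out : Slice → ℕ → ℕ
  | cup _, w => w + 2
  | cap _, w => w - 2
  | cross _ _, w => w

/-- `Pass k σ P Q`: in the (unsmoothed) slice `σ` between the levels `k` and `k + 1`, a strand of
the link runs from the point `P = (k, p)` to the point `Q = (k + 1, q)`. -/
inductive Pass (k : ℕ) : Slice → ℕ × ℕ → ℕ × ℕ → Prop
  | cup_left {i p : ℕ} : p < i → Pass k (cup i) (k, p) (k + 1, p)
  | cup_right {i p : ℕ} : i ≤ p → Pass k (cup i) (k, p) (k + 1, p + 2)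
  | cap_left {i p : ℕ} : p < i → Pass k (cap i) (k, p) (k + 1, p)
  | cap_right {i p : ℕ} : i ≤ p → Pass k (cap i) (k, p + 2) (k + 1, p)
  | away {i p : ℕ} {e : Bool} : p ≠ i → p ≠ i + 1 → Pass k (cross i e) (k, p) (k + 1, p)
  | rightwards {i : ℕ} {e : Bool} : Pass k (cross i e) (k, i) (k + 1, i + 1)
  | leftwards {i : ℕ} {e : Bool} : Pass k (cross i e) (k, i + 1) (k + 1, i)

/-- `Turn k σ P Q`: the points `P` and `Q` are the two ends of the cup or cap `σ`. -/
inductive Turn (k : ℕ) : Slice → ℕ × ℕ → ℕ × ℕ → Prop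
  | cup {i : ℕ} : Turn k (cup i) (k + 1, i) (k + 1, i + 1)
  | cap {i : ℕ} : Turn k (cap i) (k, i) (k, i + 1)

/-- `Arc k σ b P Q`: the points `P` and `Q` are joined by an arc of the slice `σ` between the levels
`k` and `k + 1`, where a crossing has been replaced by its `0`-smoothing (`b = false`) or its
`1`-smoothing (`b = true`).  The `0`-smoothing of `cross i true` and the `1`-smoothing of
`cross i false` consist of two vertical arcs (for strands that point in the same direction this is
the oriented smoothing); the other two smoothings consist of a cap below and a cup above. -/
inductive Arc (k : ℕ) : Slice → Bool → ℕ × ℕ → ℕ × ℕ → Prop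
  | cup_left {i p : ℕ} {b : Bool} : p < i → Arc k (cup i) b (k, p) (k + 1, p)
  | cup_right {i p : ℕ} {b : Bool} : i ≤ p → Arc k (cup i) b (k, p) (k + 1, p + 2)
  | cup_turn {i : ℕ} {b : Bool} : Arc k (cup i) b (k + 1, i) (k + 1, i + 1)
  | cap_left {i p : ℕ} {b : Bool} : p < i → Arc k (cap i) b (k, p) (k + 1, p)
  | cap_right {i p : ℕ} {b : Bool} : i ≤ p → Arc k (cap i) b (k, p + 2) (k + 1, p)
  | cap_turn {i : ℕ} {b : Bool} : Arc k (cap i) b (k, i) (k, i + 1)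
  | away {i p : ℕ} {e b : Bool} : p ≠ i → p ≠ i + 1 → Arc k (cross i e) b (k, p) (k + 1, p)
  | vert_left {i : ℕ} {e b : Bool} : e ≠ b → Arc k (cross i e) b (k, i) (k + 1, i)
  | vert_right {i : ℕ} {e b : Bool} : e ≠ b → Arc k (cross i e) b (k, i + 1) (k + 1, i + 1)
  | hor_bottom {i : ℕ} {e b : Bool} : e = b → Arc k (cross i e) b (k, i) (k, i + 1)
  | hor_top {i : ℕ} {e b : Bool} : e = b → Arc k (cross i e) b (k + 1, i) (k + 1, i + 1)

end Slice

/-- The number of strands at level `ℓ`, starting with no strand at level `0`. -/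
def width (L : List Slice) (ℓ : ℕ) : ℕ :=
  (L.take ℓ).foldl (fun w σ => σ.out w) 0

/-- A link diagram: every slice fits on the strands below it, and no strand is left at the top. -/
def IsLinkDiagram (L : List Slice) : Prop :=
  (∀ k : Fin L.length, (L[k]).Fits (width L k)) ∧ width L L.length = 0

/-- The points in which the diagram meets the levels. -/
abbrev Point (L : List Slice) : Type :=
  Σ ℓ : Fin (L.length + 1), Fin (width L ℓ)

/-- The level of a point, and its number among the strands at this level. -/
def Point.coord {L : List Slice} (P : Point L) : ℕ × ℕ := (P.1, P.2)

/-- The crossings of a diagram, ordered from bottom to top. -/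
abbrev Crossing (L : List Slice) : Type :=
  {k : Fin L.length // (L[k]).isCross = true}

/-- The index of the slice that contains the crossing. -/
def Crossing.idx {L : List Slice} (c : Crossing L) : ℕ := c.1

/-- An orientation of the link diagram: a direction (`true` is upwards) at each point, constant
along the strands and reversed at cups and caps. -/
def IsOrientation (L : List Slice) (dir : Point L → Bool) : Prop :=
  ∀ (k : Fin L.length) (P Q : Point L),
    ((L[k]).Pass k P.coord Q.coord → dir P = dir Q) ∧
    ((L[k]).Turn k P.coord Q.coord → dir P ≠ dir Q)

/-- The crossing `c` of the oriented diagram is positive. -/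
def IsPositive {L : List Slice} (dir : Point L → Bool) (c : Crossing L) : Prop :=
  ∃ P Q : Point L, P.coord = (c.idx, (L[c.1]).pos) ∧ Q.coord = (c.idx, (L[c.1]).pos + 1) ∧
    (dir P = dir Q ↔ (L[c.1]).type = true)

/-! ## States and enhanced states -/

/-- A state: a choice of the `0`-smoothing (`false`) or the `1`-smoothing (`true`) at each
crossing. -/
abbrev State (L : List Slice) : Type := Crossing L → Bool

/-- The smoothing chosen in the `k`-th slice (irrelevant if the slice is not a crossing). -/
def smoothingAt {L : List Slice} (s : State L) (k : Fin L.length) : Bool :=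
  if h : (L[k]).isCross = true then s ⟨k, h⟩ else false

/-- Two points are the ends of an arc of a smoothed slice. -/
def Adjacent {L : List Slice} (s : State L) (P Q : Point L) : Prop :=
  ∃ k : Fin L.length, (L[k]).Arc k (smoothingAt s k) P.coord Q.coord

/-- Two points lie on the same loop of the state. -/
def SameLoop {L : List Slice} (s : State L) : Point L → Point L → Prop :=
  Relation.EqvGen (Adjacent s)

/-- The basis `v₊`, `v₋` of `V`. -/
inductive Mark
  | plus
  | minus
  deriving DecidableEq

instance : Fintype Mark :=
  ⟨{.plus, .minus}, fun m => by cases m <;> decide⟩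

/-- An enhanced state: a state together with a marking of each of its loops by `v₊` or `v₋`, given
as a marking of the points that is constant along the arcs of the state. -/
@[ext]
structure EState (L : List Slice) where
  smoothing : State L
  mark : Point L → Mark
  compat : ∀ P Q : Point L, Adjacent smoothing P Q → mark P = mark Q

noncomputable instance (L : List Slice) : Fintype (EState L) :=
  Fintype.ofInjective (fun x : EState L => (x.smoothing, x.mark)) (by
    intro x y h
    simp only [Prod.mk.injEq] at h
    exact EState.ext h.1 h.2)

/-! ## The Khovanov complex over `ℚ` -/

/-- `r` occurs in the product of `p` and `q` in `V`; all coefficients are `1`. -/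
def Merge : Mark → Mark → Mark → Prop
  | .plus, .plus, r => r = .plus
  | .plus, .minus, r => r = .minus
  | .minus, .plus, r => r = .minus
  | .minus, .minus, _ => False

/-- `q ⊗ r` occurs in the coproduct of `p`; all coefficients are `1`. -/
def Split : Mark → Mark → Mark → Prop
  | .plus, q, r => q ≠ r
  | .minus, q, r => q = .minus ∧ r = .minus

/-- The rule for a saddle.  The saddle joins the arc of the first state through the point `a` with
the arc through `b`, and `R` is the relation of lying on the same loop of the first state; `a'` and
`b'` are points on the two arcs that the saddle produces in the second state.  `same p p'` says that
`p'` is the point `p`, seen in the second diagram.  The rule says that the marking `m'` of the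
second state occurs in the image of the marking `m` of the first one: loops away from the
saddle keep their mark, and if the arcs lie on two loops, these are merged, otherwise their loop
splits. -/
def SaddleRule {P P' : Type} (R : P → P → Prop) (same : P → P' → Prop)
    (m : P → Mark) (m' : P' → Mark) (a b : P) (a' b' : P') : Prop :=
  (∀ p p', same p p' → ¬ R p a → ¬ R p b → m' p' = m p) ∧
  ((R a b ∧ Split (m a) (m' a') (m' b')) ∨
    (¬ R a b ∧ Merge (m a) (m b) (m' a') ∧ m' b' = m' a'))

/-- The chain group of a diagram: the `ℚ`-vector space with the enhanced states as basis. -/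
abbrev Chain (L : List Slice) : Type := EState L → ℚ

open Classical in
/-- The generator of the chain group that belongs to an enhanced state. -/
noncomputable def gen {L : List Slice} (x : EState L) : Chain L := Pi.single x 1

/-- The linear map that sends the generator `x` to `∑ y, c x y • y`. -/
noncomputable def ofCoeff {L L' : List Slice} (c : EState L → EState L' → ℚ) :
    Chain L →ₗ[ℚ] Chain L' :=
  Matrix.mulVecLin (Matrix.of fun y x => c x y)

/-- `y` occurs in the image of `x` under the edge differential at the crossing `c`.  The lower left
corner and the upper right corner of a crossing lie on the two different arcs of the crossing,
whichever smoothing is chosen. -/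
def EdgeRel {L : List Slice} (c : Crossing L) (x y : EState L) : Prop :=
  x.smoothing c = false ∧ y.smoothing = Function.update x.smoothing c true ∧
  ∃ a b : Point L, a.coord = (c.idx, (L[c.1]).pos) ∧
    b.coord = (c.idx + 1, (L[c.1]).pos + 1) ∧
    SaddleRule (SameLoop x.smoothing) Eq x.mark y.mark a b a b

/-- The sign `(-1)^|e|`, with `|e|` the number of `1`-smoothings before the crossing `c`. -/
def edgeSign {L : List Slice} (c : Crossing L) (x : EState L) : ℚ :=
  (-1) ^ (Finset.univ.filter fun c' : Crossing L => c' < c ∧ x.smoothing c' = true).card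

open Classical in
/-- The Khovanov differential. -/
noncomputable def differential (L : List Slice) : Chain L →ₗ[ℚ] Chain L :=
  ofCoeff fun x y => ∑ c : Crossing L, if EdgeRel c x y then edgeSign c x else 0

/-- Khovanov homology, cycles modulo boundaries (the direct sum over all bidegrees). -/
abbrev Kh (L : List Slice) : Type :=
  LinearMap.ker (differential L) ⧸
    (LinearMap.range (differential L)).comap (LinearMap.ker (differential L)).subtype

/-- The homology class of a cycle. -/
noncomputable def Kh.cls {L : List Slice} (z : Chain L) (hz : differential L z = 0) : Kh L :=
  Submodule.Quotient.mk ⟨z, LinearMap.mem_ker.mpr hz⟩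

def IsChainMap {L L' : List Slice} (f : Chain L →ₗ[ℚ] Chain L') : Prop :=
  ∀ z, f (differential L z) = differential L' (f z)

/-- The map induced by a chain map on Khovanov homology. -/
noncomputable def Kh.map {L L' : List Slice} (f : Chain L →ₗ[ℚ] Chain L') (hf : IsChainMap f) :
    Kh L →ₗ[ℚ] Kh L' :=
  Submodule.mapQ _ _
    (f.restrict (p := LinearMap.ker (differential L)) (q := LinearMap.ker (differential L'))
      (fun z hz => by
        rw [LinearMap.mem_ker] at hz ⊢
        rw [← hf z, hz, map_zero]))
    (by
      rintro ⟨z, hz⟩ ⟨y, hy⟩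
      exact ⟨f y, by rw [← hf y, hy]; rfl⟩)

/-- The enhanced state is a state cycle. -/
def IsStateCycle {L : List Slice} (x : EState L) : Prop :=
  differential L (gen x) = 0

/-- The enhanced state is a state cycle with nonzero homology class. -/
def IsNontrivialStateCycle {L : List Slice} (x : EState L) : Prop :=
  ∃ h : IsStateCycle x, Kh.cls (gen x) h ≠ 0

/-! ## Local changes of a diagram

In all that follows, `r` slices of a diagram `L`, beginning at level `k`, are replaced by `t` slices,
which gives a diagram `L'`. -/

/-- The point `P` of `L` outside the changed part is the point `P'` of `L'`. -/
def SamePoint {L L' : List Slice} (k r t : ℕ) (P : Point L) (P' : Point L') : Prop :=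
  P'.coord.2 = P.coord.2 ∧
  ((P.coord.1 ≤ k ∧ P'.coord.1 = P.coord.1) ∨
    (k + r ≤ P.coord.1 ∧ P'.coord.1 + r = P.coord.1 + t))

/-- The crossing `c` of `L` outside the changed part is the crossing `c'` of `L'`. -/
def SameCrossing {L L' : List Slice} (k r t : ℕ) (c : Crossing L) (c' : Crossing L') : Prop :=
  (c.idx < k ∧ c'.idx = c.idx) ∨ (k + r ≤ c.idx ∧ c'.idx + r = c.idx + t)

/-- The two states agree at the crossings outside the changed part. -/
def SameSmoothing {L L' : List Slice} (k r t : ℕ) (s : State L) (s' : State L') : Prop :=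
  ∀ c c', SameCrossing k r t c c' → s' c' = s c

/-- The two markings agree at the points outside the changed part. -/
def SameMark {L L' : List Slice} (k r t : ℕ) (m : Point L → Mark) (m' : Point L' → Mark) : Prop :=
  ∀ P P', SamePoint k r t P P' → m' P' = m P

/-! ## The elementary Jacobsson maps -/

/-- The saddle next to the crossing `cross i true` in the `k`-th slice of `L`.  The band joins the
two right arms of the crossing.  In `L'` the crossing has become a kink in the left strand, and the
right strand passes by: the slice is replaced by `cup (i + 1), cross i true, cap (i + 1)`. -/
def SaddleRel (L L' : List Slice) (k i : ℕ) (x : EState L) (y : EState L') : Prop :=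
  SameSmoothing k 1 3 x.smoothing y.smoothing ∧
  (∀ (c : Crossing L) (c' : Crossing L'), c.idx = k → c'.idx = k + 1 →
    y.smoothing c' = x.smoothing c) ∧
  ∃ (a b : Point L) (a' b' : Point L'), a.coord = (k, i + 1) ∧ b.coord = (k + 1, i + 1) ∧
    a'.coord = (k, i + 1) ∧ b'.coord = (k + 1, i + 2) ∧
    SaddleRule (SameLoop x.smoothing) (SamePoint k 1 3) x.mark y.mark a b a' b'

open Classical in
/-- The map of the saddle Morse move described at `SaddleRel`. -/
noncomputable def saddleMap (L L' : List Slice) (k i : ℕ) : Chain L →ₗ[ℚ] Chain L' :=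
  ofCoeff fun x y => if SaddleRel L L' k i x y then 1 else 0

/-- Removal of the positive kink `cup (i + 1), cross i true, cap (i + 1)` at level `k`: if
the crossing is `0`-smoothed and the small loop, which contains the point `(k + 1, i + 2)`, is
marked by `v₋`, then the loop is erased. -/
def RIRel (L L' : List Slice) (k i : ℕ) (x : EState L) (y : EState L') : Prop :=
  SameSmoothing k 3 0 x.smoothing y.smoothing ∧
  (∀ c : Crossing L, c.idx = k + 1 → x.smoothing c = false) ∧
  (∀ P : Point L, P.coord = (k + 1, i + 2) → x.mark P = .minus) ∧
  SameMark k 3 0 x.mark y.mark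

open Classical in
/-- The map of the first Reidemeister move that removes a positive kink.  All enhanced states that
are not of the form described at `RIRel` are sent to `0`. -/
noncomputable def rIMap (L L' : List Slice) (k i : ℕ) : Chain L →ₗ[ℚ] Chain L' :=
  ofCoeff fun x y => if RIRel L L' k i x y then 1 else 0

/-- Removal of `cross i e, cross i (!e)` at level `k`, first case: both crossings are smoothed
vertically, and the markings are kept. -/
def RIIRelVert (L L' : List Slice) (k : ℕ) (e : Bool) (x : EState L) (y : EState L') : Prop :=
  SameSmoothing k 2 0 x.smoothing y.smoothing ∧
  (∀ c : Crossing L, c.idx = k → x.smoothing c = !e) ∧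
  (∀ c : Crossing L, c.idx = k + 1 → x.smoothing c = e) ∧
  SameMark k 2 0 x.mark y.mark

/-- Removal of `cross i e, cross i (!e)` at level `k`, second case: both crossings are smoothed
horizontally, the small loop between them, which contains the point `(k + 1, i)`, is marked by `v₋`
and is erased, and the lower and the upper arc undergo a saddle. -/
def RIIRelHor (L L' : List Slice) (k i : ℕ) (e : Bool) (x : EState L) (y : EState L') : Prop :=
  SameSmoothing k 2 0 x.smoothing y.smoothing ∧
  (∀ c : Crossing L, c.idx = k → x.smoothing c = e) ∧
  (∀ c : Crossing L, c.idx = k + 1 → x.smoothing c = !e) ∧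
  (∀ P : Point L, P.coord = (k + 1, i) → x.mark P = .minus) ∧
  ∃ (a b : Point L) (a' b' : Point L'), a.coord = (k, i) ∧ b.coord = (k + 2, i) ∧
    a'.coord = (k, i) ∧ b'.coord = (k, i + 1) ∧
    SaddleRule (SameLoop x.smoothing) (SamePoint k 2 0) x.mark y.mark a b a' b'

/-- The sign `(-1)^q`, with `q` the number of `1`-smoothings above the slice `k + 1`.  It makes the
map of the second Reidemeister move commute with the differentials: one `1`-smoothed crossing is
removed, which changes the signs of the edges that belong to the crossings above. -/
def rIISign {L : List Slice} (k : ℕ) (x : EState L) : ℚ :=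
  (-1) ^ (Finset.univ.filter fun c : Crossing L => k + 1 < c.idx ∧ x.smoothing c = true).card

open Classical in
/-- The map of the second Reidemeister move that removes the two crossings
`cross i e, cross i (!e)` at level `k`.  All enhanced states that are not of one of the two forms
above are sent to `0`. -/
noncomputable def rIIMap (L L' : List Slice) (k i : ℕ) (e : Bool) : Chain L →ₗ[ℚ] Chain L' :=
  ofCoeff fun x y => rIISign k x *
    ((if RIIRelVert L L' k e x y then 1 else 0) - (if RIIRelHor L L' k i e x y then 1 else 0))

/-! ## Quasipositive braid words -/

/-- A letter `τ_g` (`pos = true`) or `τ_g⁻¹` (`pos = false`) of a braid word on `n` strands,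
with a label that tells whether it is a central positive crossing. -/
structure Letter (n : ℕ) where
  g : Fin (n - 1)
  pos : Bool
  central : Bool

/-- A factor `ω τ_g ω⁻¹`; the braid word `ω` is given as a list of generators and signs. -/
structure QPFactor (n : ℕ) where
  ω : List (Fin (n - 1) × Bool)
  g : Fin (n - 1)

/-- The word `ω τ_g ω⁻¹`, with its middle letter marked as central. -/
def QPFactor.word {n : ℕ} (f : QPFactor n) : List (Letter n) :=
  f.ω.map (fun l => ⟨l.1, l.2, false⟩) ++ ⟨f.g, true, true⟩ ::
    f.ω.reverse.map (fun l => ⟨l.1, !l.2, false⟩)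

/-- The quasipositive braid word `∏ ω_k τ_{g_k} ω_k⁻¹`. -/
def qpWord {n : ℕ} (F : List (QPFactor n)) : List (Letter n) :=
  F.flatMap QPFactor.word

/-- The crossing of a letter, if the strands of the braid are the strands
`j, …, j + n - 1` of the diagram. -/
def Letter.slice {n : ℕ} (j : ℕ) (l : Letter n) : Slice := .cross (j + l.g) l.pos

/-- The diagram obtained from `A ++ B` by replacing the arcs through the points
`j, …, j + n - 1` at level `A.length` by a braid. -/
def glue {n : ℕ} (A : List Slice) (j : ℕ) (w : List (Letter n)) (B : List Slice) : List Slice :=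
  A ++ (w.map (Letter.slice j) ++ B)

/-- The arcs of the enhanced state `α` through the points `j, …, j + n - 1` at level `k` are
braid-parallel; the transverse line is the horizontal line at this level. -/
structure BraidParallel {L : List Slice} (dir : Point L → Bool) (α : EState L) (k j n : ℕ) :
    Prop where
  inRange : j + n ≤ width L k
  separate : ∀ P Q : Point L, P.coord.1 = k → j ≤ P.coord.2 → P.coord.2 < j + n →
    Q.coord.1 = k → j ≤ Q.coord.2 → Q.coord.2 < j + n →
    SameLoop α.smoothing P Q → P = Q
  marked : ∀ P : Point L, P.coord.1 = k → j ≤ P.coord.2 → P.coord.2 < j + n → α.mark P = .minus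
  parallel : ∀ P Q : Point L, P.coord.1 = k → j ≤ P.coord.2 → P.coord.2 < j + n →
    Q.coord.1 = k → j ≤ Q.coord.2 → Q.coord.2 < j + n → dir P = dir Q

/-- `IsLift A B j w α α'`: in the enhanced state `α'` of the glued diagram, the crossings of `A ++ B`
are smoothed as in `α`, the positive crossings of the braid are `0`-smoothed, the negative ones
`1`-smoothed, and the points outside the braid are marked as in `α`. -/
structure IsLift {n : ℕ} (A B : List Slice) (j : ℕ) (w : List (Letter n))
    (α : EState (A ++ B)) (α' : EState (glue A j w B)) : Prop where
  old : SameSmoothing A.length 0 w.length α.smoothing α'.smoothing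
  braid : ∀ (t : Fin w.length) (c : Crossing (glue A j w B)), c.idx = A.length + t →
    α'.smoothing c = !(w[t]).pos
  mark : SameMark A.length 0 w.length α.mark α'.mark

/-! ## The Jacobsson map of a quasipositive modification -/

/-- `JacobssonMovie A B j w Ψ`: the chain map `Ψ` is the composition of the elementary
Jacobsson maps along a movie from the diagram glued with the word `w` to the diagram `A ++ B`.
In each step either a central positive crossing is `0`-resolved, by a saddle followed by the first
Reidemeister move that removes the resulting positive kink, or two adjacent non-central inverse
letters are cancelled by a second Reidemeister move. -/
inductive JacobssonMovie (A B : List Slice) (j : ℕ) {n : ℕ} :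
    (w : List (Letter n)) → (Chain (glue A j w B) →ₗ[ℚ] Chain (A ++ B)) → Prop
  | done : JacobssonMovie A B j [] LinearMap.id
  | resolve (u v : List (Letter n)) (g : Fin (n - 1))
      (Ψ : Chain (glue A j (u ++ v) B) →ₗ[ℚ] Chain (A ++ B)) :
      JacobssonMovie A B j (u ++ v) Ψ →
      JacobssonMovie A B j (u ++ ⟨g, true, true⟩ :: v)
        (Ψ ∘ₗ
          rIMap
            (A ++ (u.map (Letter.slice j) ++
              (.cup (j + g + 1) :: .cross (j + g) true :: .cap (j + g + 1) ::
                (v.map (Letter.slice j) ++ B))))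
            (glue A j (u ++ v) B) (A.length + u.length) (j + g) ∘ₗ
          saddleMap
            (glue A j (u ++ ⟨g, true, true⟩ :: v) B)
            (A ++ (u.map (Letter.slice j) ++
              (.cup (j + g + 1) :: .cross (j + g) true :: .cap (j + g + 1) ::
                (v.map (Letter.slice j) ++ B))))
            (A.length + u.length) (j + g))
  | cancel (u v : List (Letter n)) (g : Fin (n - 1)) (e : Bool)
      (Ψ : Chain (glue A j (u ++ v) B) →ₗ[ℚ] Chain (A ++ B)) :
      JacobssonMovie A B j (u ++ v) Ψ →
      JacobssonMovie A B j (u ++ ⟨g, e, false⟩ :: ⟨g, !e, false⟩ :: v)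
        (Ψ ∘ₗ
          rIIMap (glue A j (u ++ ⟨g, e, false⟩ :: ⟨g, !e, false⟩ :: v) B)
            (glue A j (u ++ v) B) (A.length + u.length) (j + g) e)

end KhovanovQP

open KhovanovQP

namespace KhovanovQP

/-! With the prescribed smoothings (positive crossings `0`, negative crossings `1`) every crossing
of the braid becomes two vertical arcs. So the lifted state is `α` with n parallel strands stretched
out: its loops are those of `α`, and the marks inside the braid are forced (`exists_isLift`,
`IsLift.unique`). It is a state cycle (`IsLift.isStateCycle`): an edge of the cube at an old
crossing is a copy of an edge of `α`, and a saddle at a crossing of the braid would merge two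
different loops marked by `v₋`, where `v₋ · v₋ = 0`.

In a movie, resolving a central crossing splits a small loop off a strand, and the first
Reidemeister map keeps the term with `v₋` on this loop, which is the identity on the remaining
marks. The second Reidemeister map keeps the marks of a vertically smoothed pair, up to sign. So
each step carries the lift for a word to plus or minus the lift for the shorter word
(`JacobssonMovie.spec`). A movie exists, because `ω ω⁻¹` cancels from the inside once the central
letter is gone (`reducible_qpWord`). As the composition is a chain map that sends the class of the
lift to plus or minus the class of `α`, the lift is nontrivial.

Most of the work is the proof that the elementary maps are chain maps. It rests on two ideas.

Algebra: over a fixed state the chain group is a tensor power of `V`, generated by the enhanced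
state with all marks `v₊` under the commuting multiplications `xOp P` by `v₋` at the loop through
`P`. Edge maps and elementary maps are compatible with these multiplications
(`SaddleRule.lower_iff`), so identities have to be checked only where the outer points are marked by
`v₊` (`eq_of_intertwines`). There a merging saddle is `1` and a splitting saddle is `xOp a + xOp b`
(`saddleType_plus`). That two saddles commute (`splitFactor_square`) then follows from the list of
possible merge and split patterns in a square (`saddle_square`).

Planarity: every saddle merges two loops or splits one. Loops are oriented upwards on even strands
and downwards on odd ones, consistently in every state. They are thus cycles of a permutation of the
points, and changing a smoothing multiplies this permutation by a transposition
(`saddlePair_mul_swap`, `IsLinkDiagram.saddlePair`). The saddle next to a kink and the one in the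
second Reidemeister map are reduced to this case by `SaddlePair.of_birth` and
`SaddlePair.of_return`.

What remains are the edges at crossings that disappear: the first Reidemeister map kills their
images, and for the second one the two ways through the bigon cancel (`bigon_cancel`). -/

/-! ## Saddles and equivalence relations -/

section Relations

variable {P P' : Type}

/-- `p` and `q` become related when the classes of `a` and `b` are joined. -/
def Joined (R : P → P → Prop) (a b p q : P) : Prop :=
  R p q ∨ ((R p a ∨ R p b) ∧ (R q a ∨ R q b))

theorem Joined.equivalence {R : P → P → Prop} (hR : Equivalence R) (a b : P) :
    Equivalence (Joined R a b) := by
  have tr : ∀ {p q : P}, R p q → (R q a ∨ R q b) → (R p a ∨ R p b) := fun h h' =>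
    h'.imp (hR.trans h) (hR.trans h)
  refine ⟨fun p => .inl (hR.refl p), ?_, ?_⟩
  · rintro p q (h | ⟨h, h'⟩)
    · exact .inl (hR.symm h)
    · exact .inr ⟨h', h⟩
  · rintro p q r (h | ⟨h, h'⟩) (k | ⟨k, k'⟩)
    · exact .inl (hR.trans h k)
    · exact .inr ⟨tr h k, k'⟩
    · exact .inr ⟨h, tr (hR.symm k) h'⟩
    · exact .inr ⟨h, k'⟩

/-- Touching the joined class is the same as being joined to `a`. -/
theorem Joined.left_iff {R : P → P → Prop} (hR : Equivalence R) (a b p : P) :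
    Joined R a b p a ↔ (R p a ∨ R p b) :=
  ⟨fun h => h.elim .inl fun h => h.1, fun h => .inr ⟨h, .inl (hR.refl a)⟩⟩

/-- A saddle that either joins two classes of `R` or splits a class of `R`. -/
structure SaddlePair (R : P → P → Prop) (R' : P' → P' → Prop) (same : P → P' → Prop)
    (a b : P) (a' b' : P') : Prop where
  -- `xor` says that the saddle merges in one direction and splits in the other. `join` and `touch`
  -- say that the two partitions coincide once the classes at the saddle are glued. `cover` asks
  -- that every class of `R'` lies at the saddle or is met by a corresponding point; nothing of this
  -- kind is asked of `R`, which may have a small loop that gets erased.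
  xor : R a b ↔ ¬ R' a' b'
  join : ∀ p q p' q', same p p' → same q q' → (Joined R a b p q ↔ Joined R' a' b' p' q')
  touch : ∀ p p', same p p' → ((R p a ∨ R p b) ↔ (R' p' a' ∨ R' p' b'))
  cover : ∀ p', R' p' a' ∨ R' p' b' ∨ ∃ p q', same p q' ∧ R' q' p'

theorem SaddlePair.rel_iff {R : P → P → Prop} {R' : P' → P' → Prop} {same : P → P' → Prop}
    {a b : P} {a' b' : P'} (S : SaddlePair R R' same a b a' b') {p q : P} {p' q' : P'}
    (hp : same p p') (hq : same q q') (hn : ¬ (R p a ∨ R p b)) : R p q ↔ R' p' q' := by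
  have h := S.join p q p' q' hp hq
  have h2 := S.touch p p' hp
  unfold Joined at h
  tauto

/-- If a saddle merges, related points stay related. -/
theorem SaddlePair.mono {R : P → P → Prop} {R' : P' → P' → Prop} (hR' : Equivalence R')
    {same : P → P' → Prop}
    {a b : P} {a' b' : P'} (S : SaddlePair R R' same a b a' b') {p q : P} {p' q' : P'}
    (hp : same p p') (hq : same q q') (hn : ¬ R a b) (h : R p q) : R' p' q' := by
  have h1 : R' a' b' := by have := S.xor; tauto
  have tr : ∀ {x}, (R' x a' ∨ R' x b') → R' x a' := fun h =>
    h.elim id fun h => hR'.trans h (hR'.symm h1)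
  rcases (S.join p q p' q' hp hq).1 (.inl h) with h | ⟨h, h'⟩
  · exact h
  · exact hR'.trans (tr h) (hR'.symm (tr h'))

/-- If a saddle splits, points that are related afterwards were related before. -/
theorem SaddlePair.mono_rev {R : P → P → Prop} {R' : P' → P' → Prop} (hR : Equivalence R)
    {same : P → P' → Prop}
    {a b : P} {a' b' : P'} (S : SaddlePair R R' same a b a' b') {p q : P} {p' q' : P'}
    (hp : same p p') (hq : same q q') (hn : R a b) (h : R' p' q') : R p q := by
  have tr : ∀ {x}, (R x a ∨ R x b) → R x a := fun h =>
    h.elim id fun h => hR.trans h (hR.symm hn)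
  rcases (S.join p q p' q' hp hq).2 (.inl h) with h | ⟨h, h'⟩
  · exact h
  · exact hR.trans (tr h) (hR.symm (tr h'))

/-- Two pairs of points meet the same two classes. -/
def Matched (R : P → P → Prop) (a b c d : P) : Prop :=
  (R a c ∧ R b d) ∨ (R a d ∧ R b c)

/-- Two unrelated points that become related when the classes of `a` and `b` are glued must lie one
in each of these classes. -/
theorem matched_of_joined {R : P → P → Prop} (hR : Equivalence R) {a b c d : P}
    (h : Joined R a b c d) (hn : ¬ R c d) : Matched R a b c d := by
  rcases h with h | ⟨h | h, h' | h'⟩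
  · exact absurd h hn
  · exact absurd (hR.trans h (hR.symm h')) hn
  · exact .inl ⟨hR.symm h, hR.symm h'⟩
  · exact .inr ⟨hR.symm h', hR.symm h⟩
  · exact absurd (hR.trans h (hR.symm h')) hn

/-- The possible types of two saddles that are performed in both orders. -/
theorem saddle_square {R00 R01 : P → P → Prop} {R10 R11 : P' → P' → Prop}
    (h00 : Equivalence R00) (h01 : Equivalence R01) (h10 : Equivalence R10)
    (h11 : Equivalence R11) {same : P → P' → Prop} {a b c d : P} {a' b' c' d' : P'}
    (S1 : SaddlePair R00 R10 same a b a' b') (S1' : SaddlePair R01 R11 same a b a' b')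
    (S2 : SaddlePair R00 R01 Eq c d c d) (S2' : SaddlePair R10 R11 Eq c' d' c' d')
    (hc : same c c') (hd : same d d') :
    (¬ R00 a b → ¬ R10 c' d' → ¬ R00 c d ∧ ¬ R01 a b) ∧
    (R00 a b → R10 c' d' → R00 c d ∧ R01 a b) ∧
    (¬ R00 a b → R10 c' d' → ¬ R00 c d → R01 a b ∧ Matched R11 a' b' c' d') ∧
    (R00 a b → ¬ R10 c' d' → R00 c d → ¬ R01 a b ∧ R11 a' c' ∧ R11 b' c' ∧ R11 c' d') ∧
    (¬ R00 a b → R10 c' d' → R00 c d → ¬ R01 a b) ∧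
    (R00 a b → ¬ R10 c' d' → ¬ R00 c d → R01 a b) := by
  -- The first digit of `R00`, …, `R11` tells whether the saddle at `a, b` has been performed, the
  -- second digit refers to the saddle at `c, d`. Relations grow along a merging saddle and shrink
  -- along a splitting one; with the four alternatives `xor` this propagates the types around the
  -- square.
  have x1 := S1.xor
  have x1' := S1'.xor
  have x2 := S2.xor
  have x2' := S2'.xor
  refine ⟨fun h k => ?_, fun h k => ?_, fun h k l => ?_, fun h k l => ?_, fun h k l => ?_,
    fun h k l => ?_⟩
  · have h2 : ¬ R00 c d := fun hcd => k (S1.mono h10 hc hd h hcd)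
    refine ⟨h2, fun hab => ?_⟩
    have : R11 a' b' := S2'.mono h11 rfl rfl k (by tauto)
    tauto
  · have h2 : R00 c d := S1.mono_rev h00 hc hd h k
    refine ⟨h2, ?_⟩
    by_contra hab
    have : R10 a' b' := S2'.mono_rev h10 rfl rfl k (by tauto)
    tauto
  · have h2 : R10 a' b' := by tauto
    have hM : R01 c d := by tauto
    have hab : R01 a b := by
      by_contra hab
      have : R11 c' d' := S1'.mono h11 hc hd hab hM
      tauto
    refine ⟨hab, ?_⟩
    have hj := (S2'.join a' b' a' b' rfl rfl).1 (.inl h2)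
    have := matched_of_joined h11 hj (by tauto)
    rcases this with ⟨u, v⟩ | ⟨u, v⟩
    · exact .inl ⟨h11.symm u, h11.symm v⟩
    · exact .inr ⟨h11.symm v, h11.symm u⟩
  · have h2 : ¬ R10 a' b' := by tauto
    have hcd : R11 c' d' := by tauto
    have hj := (S1.join c d c' d' hc hd).1 (.inl l)
    have hm := matched_of_joined h10 hj k
    have up : ∀ {x y}, R10 x y → R11 x y := fun h => S2'.mono h11 rfl rfl k h
    have hab : ¬ R01 a b := by
      intro hab
      have hdc : ¬ R01 c d := by tauto
      exact hdc (S1'.mono_rev h01 hc hd hab hcd)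
    refine ⟨hab, ?_⟩
    rcases hm with ⟨u, v⟩ | ⟨u, v⟩
    · exact ⟨up u, h11.trans (up v) (h11.symm hcd), hcd⟩
    · exact ⟨h11.trans (up u) (h11.symm hcd), up v, hcd⟩
  · intro hab
    have hcd : ¬ R11 c' d' := by tauto
    have hcd' : ¬ R01 c d := by tauto
    have h2 : R10 a' b' := by tauto
    have hn : ¬ R11 a' b' := by tauto
    exact h (S2.mono_rev h00 rfl rfl l hab)
  · by_contra hab
    have hn : R11 a' b' := by tauto
    have hcd : R01 c d := by tauto
    exact hab (S2.mono h01 rfl rfl l h)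

end Relations

/-! ## Multiplying a permutation by a transposition -/

section Perm

open Equiv Equiv.Perm

variable {X : Type}

theorem sameCycle_equivalence (σ : Perm X) : Equivalence σ.SameCycle :=
  ⟨SameCycle.refl σ, SameCycle.symm, SameCycle.trans⟩

variable [Finite X] [DecidableEq X]

/-- The product sends `a` to `σ b` and then follows the `σ`-cycle of `b`, which does not contain
`a`, until it arrives at `b`. -/
theorem sameCycle_mul_swap_of_not {σ : Perm X} {a b : X} (h : ¬ σ.SameCycle a b) :
    (σ * swap a b).SameCycle a b := by
  set τ := σ * swap a b with hτ
  have key : ∀ n : ℕ, τ.SameCycle a ((σ ^ (n + 1)) b) ∨ τ.SameCycle a b := by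
    intro n
    induction n with
    | zero => exact .inl ⟨1, by simp [hτ]⟩
    | succ n ih =>
      rcases ih with ih | ih
      · by_cases hb : (σ ^ (n + 1)) b = b
        · rw [hb] at ih; exact .inr ih
        · have ha : (σ ^ (n + 1)) b ≠ a := fun e => h (SameCycle.symm ⟨((n + 1 : ℕ) : ℤ), by rw [zpow_natCast]; exact e⟩)
          refine .inl (ih.trans ⟨1, ?_⟩)
          rw [pow_succ' σ (n + 1)]
          simp [hτ, swap_apply_of_ne_of_ne ha hb]
      · exact .inr ih
  -- At the exponent `orderOf σ` the walk is back at `b`; the shift by one in `key` prevents it from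
  -- starting there.
  rcases key (orderOf σ - 1) with h' | h'
  · have : orderOf σ - 1 + 1 = orderOf σ := Nat.sub_add_cancel (orderOf_pos σ)
    rwa [this, pow_orderOf_eq_one] at h'
  · exact h'

/-- Let `m` be the least positive exponent with `(σ ^ m) a = b`. The product sends `b` to `σ a`, so
its orbit of `b` runs through `σ a, …, (σ ^ m) a = b` and closes up without meeting `a`. -/
theorem not_sameCycle_mul_swap {σ : Perm X} {a b : X} (hab : a ≠ b) (h : σ.SameCycle a b) :
    ¬ (σ * swap a b).SameCycle a b := by
  classical
  set τ := σ * swap a b with hτ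
  have hex : ∃ m : ℕ, 0 < m ∧ (σ ^ m) a = b := by
    obtain ⟨m, h0, -, h'⟩ := h.exists_pow_eq''
    exact ⟨m, h0, h'⟩
  obtain ⟨h0, hm⟩ := Nat.find_spec hex
  have hmin : ∀ i, 0 < i → i < Nat.find hex → (σ ^ i) a ≠ b := fun i hi hlt e =>
    Nat.find_min hex hlt ⟨hi, e⟩
  set m := Nat.find hex
  -- An earlier return to `a` would shift the visit at `b` to a smaller exponent.
  have hna : ∀ i, 0 < i → i ≤ m → (σ ^ i) a ≠ a := by
    intro i hi hle e
    rcases hle.lt_or_eq with hlt | rfl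
    · refine hmin (m - i) (by omega) (by omega) ?_
      rw [← hm]
      conv_rhs => rw [show m = (m - i) + i by omega, pow_add, mul_apply, e]
    · exact hab (e.symm.trans hm)
  have key : ∀ n : ℕ, ∃ i, 0 < i ∧ i ≤ m ∧ (τ ^ n) b = (σ ^ i) a := by
    intro n
    induction n with
    | zero => exact ⟨m, h0, le_rfl, by simpa using hm.symm⟩
    | succ n ih =>
      obtain ⟨i, hi, hle, e⟩ := ih
      rw [pow_succ', mul_apply, e]
      rcases hle.lt_or_eq with hlt | rfl
      · refine ⟨i + 1, by omega, by omega, ?_⟩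
        rw [hτ, mul_apply, swap_apply_of_ne_of_ne (hna i hi hle) (hmin i hi hlt), pow_succ',
          mul_apply]
      · refine ⟨1, one_pos, h0, ?_⟩
        rw [hm]
        simp [hτ]
  intro hc
  obtain ⟨n, hn⟩ := hc.symm.exists_nat_pow_eq
  obtain ⟨i, hi, hle, e⟩ := key n
  exact hna i hi hle (e.symm.trans hn)

/-- One application of the product moves a point within its `σ`-cycle, except at `a` and `b`, where
it leads to the other one of the two glued cycles. -/
theorem joined_of_sameCycle_mul_swap (σ : Perm X) (a b : X) {p q : X}
    (h : (σ * swap a b).SameCycle p q) : Joined σ.SameCycle a b p q := by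
  have hJ := Joined.equivalence (sameCycle_equivalence σ) a b
  have step : ∀ x, Joined σ.SameCycle a b x ((σ * swap a b) x) := by
    intro x
    by_cases hxa : x = a
    · subst hxa
      exact .inr ⟨.inl (SameCycle.refl _ _), .inr (by simp [sameCycle_apply_left, SameCycle.refl])⟩
    · by_cases hxb : x = b
      · subst hxb
        exact .inr ⟨.inr (SameCycle.refl _ _), .inl (by simp [sameCycle_apply_left, SameCycle.refl])⟩
      · refine .inl ?_
        rw [mul_apply, swap_apply_of_ne_of_ne hxa hxb, sameCycle_apply_right]
  obtain ⟨n, rfl⟩ := h.exists_nat_pow_eq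
  clear h
  induction n with
  | zero => exact hJ.refl _
  | succ n ih => rw [pow_succ', mul_apply]; exact hJ.trans ih (step _)

/-- A planar saddle acts on oriented loops by exchanging the successors of two points. The same
transposition undoes it, so an inclusion of partitions proved for arbitrary `σ` gives the reverse
inclusion as well. -/
theorem saddlePair_mul_swap (σ : Perm X) {a b : X} (hab : a ≠ b) :
    SaddlePair σ.SameCycle (σ * swap a b).SameCycle Eq a b a b := by
  have hback : σ * swap a b * swap a b = σ := by simp [mul_assoc]
  have hJ := Joined.equivalence (sameCycle_equivalence σ) a b
  have hJ' := Joined.equivalence (sameCycle_equivalence (σ * swap a b)) a b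
  have up : ∀ p q, σ.SameCycle p q → Joined (σ * swap a b).SameCycle a b p q := by
    intro p q h
    refine joined_of_sameCycle_mul_swap _ a b ?_
    rwa [hback]
  have t1 : ∀ p, (σ.SameCycle p a ∨ σ.SameCycle p b) →
      ((σ * swap a b).SameCycle p a ∨ (σ * swap a b).SameCycle p b) := by
    rintro p (h | h)
    · exact (Joined.left_iff (sameCycle_equivalence _) a b p).1 (up _ _ h)
    · exact (Joined.left_iff (sameCycle_equivalence _) a b p).1
        (hJ'.trans (up _ _ h) (.inr ⟨.inr (SameCycle.refl _ _), .inl (SameCycle.refl _ _)⟩))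
  have t2 : ∀ p, ((σ * swap a b).SameCycle p a ∨ (σ * swap a b).SameCycle p b) →
      (σ.SameCycle p a ∨ σ.SameCycle p b) := by
    rintro p (h | h)
    · exact (Joined.left_iff (sameCycle_equivalence _) a b p).1
        (joined_of_sameCycle_mul_swap _ a b h)
    · exact (Joined.left_iff (sameCycle_equivalence _) a b p).1
        (hJ.trans (joined_of_sameCycle_mul_swap _ a b h)
          (.inr ⟨.inr (SameCycle.refl _ _), .inl (SameCycle.refl _ _)⟩))
  refine ⟨⟨not_sameCycle_mul_swap hab, fun h => ?_⟩, ?_, ?_, fun p => ?_⟩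
  · by_contra h'
    exact h (sameCycle_mul_swap_of_not h')
  · rintro p q p' q' rfl rfl
    constructor
    · rintro (h | ⟨h, h'⟩)
      · exact up _ _ h
      · exact .inr ⟨t1 _ h, t1 _ h'⟩
    · rintro (h | ⟨h, h'⟩)
      · exact joined_of_sameCycle_mul_swap _ a b h
      · exact .inr ⟨t2 _ h, t2 _ h'⟩
  · rintro p p' rfl
    exact ⟨t1 p, t2 p⟩
  · exact .inr (.inr ⟨p, p, rfl, SameCycle.refl _ _⟩)

end Perm

/-! ## Markings -/

section Markings

variable {P P' : Type}

open Classical in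
/-- Change the mark of the class of `p`. -/
noncomputable def setMark (R : P → P → Prop) (p : P) (v : Mark) (m : P → Mark) (q : P) : Mark :=
  if R p q then v else m q

theorem setMark_of_rel {R : P → P → Prop} {p q : P} (h : R p q) (v : Mark) (m : P → Mark) :
    setMark R p v m q = v := if_pos h

theorem setMark_of_not {R : P → P → Prop} {p q : P} (h : ¬ R p q) (v : Mark) (m : P → Mark) :
    setMark R p v m q = m q := if_neg h

/-- In terms of coefficients, this is the compatibility of a saddle with multiplication by `v₋`. On
the left the loop of `p` is lowered from `v₊` to `v₋` before the saddle; on the right the loop of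
`p'` is lowered after it, so that the mark before lowering is the raised one. The underlying fact is
that product and coproduct of `V` are maps of modules over `V`. -/
theorem SaddleRule.lower_iff {R : P → P → Prop} {R' : P' → P' → Prop} {same : P → P' → Prop}
    {a b : P} {a' b' : P'} (hR : Equivalence R) (hR' : Equivalence R')
    (S : SaddlePair R R' same a b a' b') {m : P → Mark} {m' : P' → Mark}
    (hm : ∀ p q, R p q → m p = m q) (hm' : ∀ p q, R' p q → m' p = m' q) {p : P} {p' : P'}
    (hp : same p p') :
    (m p = .plus ∧ SaddleRule R same (setMark R p .minus m) m' a b a' b') ↔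
      (m' p' = .minus ∧ SaddleRule R same m (setMark R' p' .plus m') a b a' b') := by
  have x := S.xor
  -- If the loop of `p` takes part in the saddle, the marks elsewhere are unaffected and the claim
  -- is a check of the tables of `Merge` and `Split`. Otherwise the loop survives the saddle
  -- together with its mark.
  by_cases ht : R p a ∨ R p b
  · have ht' := (S.touch p p' hp).1 ht
    have e1 : ∀ q q', same q q' → ¬ R q a → ¬ R q b → setMark R p .minus m q = m q := by
      intro q q' _ h1 h2
      refine setMark_of_not (fun h => ?_) _ _
      rcases ht with h' | h'
      · exact h1 (hR.trans (hR.symm h) h')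
      · exact h2 (hR.trans (hR.symm h) h')
    have e2 : ∀ q q', same q q' → ¬ R q a → ¬ R q b → setMark R' p' .plus m' q' = m' q' := by
      intro q q' hq h1 h2
      have hn := mt (S.touch q q' hq).2 (by tauto)
      refine setMark_of_not (fun h => hn ?_) _ _
      exact ht'.imp (hR'.trans (hR'.symm h)) (hR'.trans (hR'.symm h))
    unfold SaddleRule
    have away : (∀ q q', same q q' → ¬ R q a → ¬ R q b → m' q' = setMark R p .minus m q) ↔
        (∀ q q', same q q' → ¬ R q a → ¬ R q b → setMark R' p' .plus m' q' = m q) := by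
      refine forall_congr' fun q => forall_congr' fun q' => forall_congr' fun h =>
        forall_congr' fun h1 => forall_congr' fun h2 => ?_
      rw [e1 q q' h h1 h2, e2 q q' h h1 h2]
    rw [away]
    by_cases hab : R a b
    · have hab' : ¬ R' a' b' := x.1 hab
      have hpa : R p a := ht.elim id fun h => hR.trans h (hR.symm hab)
      rw [setMark_of_rel hpa, hm p a hpa]
      rcases ht' with h' | h'
      · have hn : ¬ R' p' b' := fun h => hab' (hR'.trans (hR'.symm h') h)
        rw [setMark_of_rel h', setMark_of_not hn, hm' p' a' h']
        cases m a <;> cases m' a' <;> cases m' b' <;> simp [Split, hab]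
      · have hn : ¬ R' p' a' := fun h => hab' (hR'.trans (hR'.symm h) h')
        rw [setMark_of_rel h', setMark_of_not hn, hm' p' b' h']
        cases m a <;> cases m' a' <;> cases m' b' <;> simp [Split, hab]
    · have hab' : R' a' b' := by tauto
      have hpa' : R' p' a' := ht'.elim id fun h => hR'.trans h (hR'.symm hab')
      have hpb' : R' p' b' := hR'.trans hpa' hab'
      rw [setMark_of_rel hpa', setMark_of_rel hpb', hm' p' a' hpa', ← hm' a' b' hab']
      rcases ht with h' | h'
      · have hn : ¬ R p b := fun h => hab (hR.trans (hR.symm h') h)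
        rw [setMark_of_rel h', setMark_of_not hn, hm p a h']
        cases m a <;> cases m b <;> cases m' a' <;> simp [Merge, hab]
      · have hn : ¬ R p a := fun h => hab (hR.trans (hR.symm h) h')
        rw [setMark_of_rel h', setMark_of_not hn, hm p b h']
        cases m a <;> cases m b <;> cases m' a' <;> simp [Merge, hab]
  · have ht' := mt (S.touch p p' hp).2 ht
    have hiff : ∀ q q', same q q' → (R p q ↔ R' p' q') := fun q q' hq => S.rel_iff hp hq ht
    push Not at ht ht'
    unfold SaddleRule
    rw [setMark_of_not ht.1, setMark_of_not ht.2, setMark_of_not ht'.1, setMark_of_not ht'.2]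
    have away : (m p = .plus ∧
          ∀ q q', same q q' → ¬ R q a → ¬ R q b → m' q' = setMark R p .minus m q) ↔
        (m' p' = .minus ∧
          ∀ q q', same q q' → ¬ R q a → ¬ R q b → setMark R' p' .plus m' q' = m q) := by
      constructor
      · rintro ⟨h, k⟩
        have hp' := k p p' hp ht.1 ht.2
        rw [setMark_of_rel (hR.refl p)] at hp'
        refine ⟨hp', fun q q' hq h1 h2 => ?_⟩
        have := k q q' hq h1 h2
        by_cases hpq : R p q
        · rw [setMark_of_rel ((hiff q q' hq).1 hpq), ← hm p q hpq, h]
        · rw [setMark_of_not (mt (hiff q q' hq).2 hpq), this, setMark_of_not hpq]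
      · rintro ⟨h, k⟩
        have hp' := k p p' hp ht.1 ht.2
        rw [setMark_of_rel (hR'.refl p')] at hp'
        refine ⟨hp'.symm, fun q q' hq h1 h2 => ?_⟩
        have := k q q' hq h1 h2
        by_cases hpq : R p q
        · rw [setMark_of_rel hpq, ← hm' p' q' ((hiff q q' hq).1 hpq), h]
        · rw [setMark_of_not hpq, ← this, setMark_of_not (mt (hiff q q' hq).2 hpq)]
    tauto

/-- The rule for a merging saddle, if all marks are `v₊`. -/
theorem SaddleRule.plus_iff_of_not {R : P → P → Prop} {R' : P' → P' → Prop}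
    {same : P → P' → Prop} {a b : P} {a' b' : P'} 
    (S : SaddlePair R R' same a b a' b') {m : P → Mark} {m' : P' → Mark}
    (hm : ∀ p p', same p p' → m p = .plus) (ha : m a = .plus) (hb : m b = .plus)
    (hm' : ∀ p q, R' p q → m' p = m' q) (hab : ¬ R a b) :
    SaddleRule R same m m' a b a' b' ↔ ∀ q, m' q = .plus := by
  unfold SaddleRule
  rw [ha, hb]
  simp only [Merge, hab, false_and, not_false_eq_true, true_and, false_or]
  constructor
  · rintro ⟨h, ha', hb'⟩ q
    rw [ha'] at hb'
    rcases S.cover q with hq | hq | ⟨p, q', hs, hq⟩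
    · rw [hm' _ _ hq, ha']
    · rw [hm' _ _ hq, hb']
    · rw [← hm' _ _ hq]
      by_cases ht : R p a ∨ R p b
      · rcases (S.touch p q' hs).1 ht with k | k
        · rw [hm' _ _ k, ha']
        · rw [hm' _ _ k, hb']
      · push Not at ht
        rw [h p q' hs ht.1 ht.2, hm p q' hs]
  · intro h
    exact ⟨fun p p' hs _ _ => by rw [h, hm p p' hs], h _, by rw [h, h]⟩

/-- The rule for a splitting saddle, if all marks are `v₊`. -/
theorem SaddleRule.plus_iff {R : P → P → Prop} {R' : P' → P' → Prop}
    {same : P → P' → Prop} {a b : P} {a' b' : P'} (hR' : Equivalence R')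
    (S : SaddlePair R R' same a b a' b') {m : P → Mark} {m' : P' → Mark}
    (hm : ∀ p p', same p p' → m p = .plus) (ha : m a = .plus)
    (hm' : ∀ p q, R' p q → m' p = m' q) (hab : R a b) :
    SaddleRule R same m m' a b a' b' ↔
      ((m' a' = .minus ∧ ∀ q, ¬ R' a' q → m' q = .plus) ∨
        (m' b' = .minus ∧ ∀ q, ¬ R' b' q → m' q = .plus)) := by
  have hn : ¬ R' a' b' := S.xor.1 hab
  have away : ∀ p p', same p p' → ¬ R p a → ¬ R p b → ¬ R' a' p' ∧ ¬ R' b' p' := by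
    intro p p' hs h1 h2
    have := mt (S.touch p p' hs).2 (by tauto)
    push Not at this
    exact ⟨fun h => this.1 (hR'.symm h), fun h => this.2 (hR'.symm h)⟩
  have other : ∀ q, ¬ R' a' q → ¬ R' b' q →
      (∀ p p', same p p' → ¬ R p a → ¬ R p b → m' p' = m p) → m' q = .plus := by
    intro q h1 h2 h
    rcases S.cover q with hq | hq | ⟨p, q', hs, hq⟩
    · exact absurd (hR'.symm hq) h1
    · exact absurd (hR'.symm hq) h2
    · rw [← hm' _ _ hq]
      have ht : ¬ (R p a ∨ R p b) := by
        intro ht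
        rcases (S.touch p q' hs).1 ht with k | k
        · exact h1 (hR'.trans (hR'.symm k) hq)
        · exact h2 (hR'.trans (hR'.symm k) hq)
      push Not at ht
      rw [h p q' hs ht.1 ht.2, hm p q' hs]
  unfold SaddleRule
  rw [ha]
  simp only [hab, Split, true_and, not_true_eq_false, false_and, or_false]
  constructor
  · rintro ⟨h, hne⟩
    rcases hma : m' a' with _ | _
    · have hb : m' b' = .minus := by
        rcases hmb : m' b' with _ | _
        · exact absurd (hma.trans hmb.symm) hne
        · rfl
      refine .inr ⟨hb, fun q hq => ?_⟩
      by_cases hq' : R' a' q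
      · rw [← hm' _ _ hq', hma]
      · exact other q hq' hq h
    · have hb : m' b' = .plus := by
        rcases hmb : m' b' with _ | _
        · rfl
        · exact absurd (hma.trans hmb.symm) hne
      refine .inl ⟨rfl, fun q hq => ?_⟩
      by_cases hq' : R' b' q
      · rw [← hm' _ _ hq', hb]
      · exact other q hq hq' h
  · rintro (⟨h, k⟩ | ⟨h, k⟩)
    · refine ⟨fun p p' hs h1 h2 => ?_, ?_⟩
      · rw [k p' (away p p' hs h1 h2).1, hm p p' hs]
      · rw [h, k b' hn]; decide
    · refine ⟨fun p p' hs h1 h2 => ?_, ?_⟩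
      · rw [k p' (away p p' hs h1 h2).2, hm p p' hs]
      · rw [h, k a' fun e => hn (hR'.symm e)]; decide

end Markings

/-! ## The action of the points on the chain group -/

theorem sameLoop_equivalence {L : List Slice} (s : State L) : Equivalence (SameLoop s) :=
  Relation.EqvGen.is_equivalence _

theorem EState.mark_eq {L : List Slice} (x : EState L) {P Q : Point L}
    (h : SameLoop x.smoothing P Q) : x.mark P = x.mark Q := by
  induction h with
  | rel P Q h => exact x.compat P Q h
  | refl => rfl
  | symm _ _ _ ih => exact ih.symm
  | trans _ _ _ _ _ ih ih' => exact ih.trans ih'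

/-- Change the mark of the loop through `P`. -/
noncomputable def EState.set {L : List Slice} (x : EState L) (P : Point L) (v : Mark) :
    EState L where
  smoothing := x.smoothing
  mark := setMark (SameLoop x.smoothing) P v x.mark
  compat Q Q' h := by
    have hQ : SameLoop x.smoothing Q Q' := .rel _ _ h
    by_cases hP : SameLoop x.smoothing P Q
    · rw [setMark_of_rel hP, setMark_of_rel (.trans _ _ _ hP hQ)]
    · have hP' : ¬ SameLoop x.smoothing P Q' := fun h' => hP (.trans _ _ _ h' (.symm _ _ hQ))
      rw [setMark_of_not hP, setMark_of_not hP', x.mark_eq hQ]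

@[simp]
theorem EState.set_smoothing {L : List Slice} (x : EState L) (P : Point L) (v : Mark) :
    (x.set P v).smoothing = x.smoothing := rfl

theorem EState.set_mark_of_rel {L : List Slice} (x : EState L) {P Q : Point L}
    (h : SameLoop x.smoothing P Q) (v : Mark) : (x.set P v).mark Q = v :=
  setMark_of_rel h _ _

theorem EState.set_mark_of_not {L : List Slice} (x : EState L) {P Q : Point L}
    (h : ¬ SameLoop x.smoothing P Q) (v : Mark) : (x.set P v).mark Q = x.mark Q :=
  setMark_of_not h _ _

@[simp]
theorem EState.set_mark_self {L : List Slice} (x : EState L) (P : Point L) (v : Mark) :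
    (x.set P v).mark P = v :=
  x.set_mark_of_rel (.refl _) v

theorem EState.set_set {L : List Slice} (x : EState L) (P : Point L) (v v' : Mark) :
    (x.set P v).set P v' = x.set P v' := by
  refine EState.ext rfl (funext fun Q => ?_)
  by_cases h : SameLoop x.smoothing P Q
  · rw [x.set_mark_of_rel h, EState.set_mark_of_rel _ (by exact h)]
  · rw [x.set_mark_of_not h, EState.set_mark_of_not _ (by exact h), x.set_mark_of_not h]

theorem EState.set_of_mark {L : List Slice} (x : EState L) {P : Point L} {v : Mark}
    (hv : x.mark P = v) : x.set P v = x := by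
  refine EState.ext rfl (funext fun Q => ?_)
  by_cases h : SameLoop x.smoothing P Q
  · rw [x.set_mark_of_rel h, ← x.mark_eq h, hv]
  · rw [x.set_mark_of_not h]

theorem EState.set_congr {L : List Slice} (x : EState L) {P Q : Point L}
    (h : SameLoop x.smoothing P Q) (v : Mark) : x.set P v = x.set Q v := by
  refine EState.ext rfl (funext fun T => ?_)
  by_cases h' : SameLoop x.smoothing P T
  · rw [x.set_mark_of_rel h', x.set_mark_of_rel (.trans _ _ _ (.symm _ _ h) h')]
  · rw [x.set_mark_of_not h', x.set_mark_of_not fun k => h' (.trans _ _ _ h k)]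

theorem EState.set_comm {L : List Slice} (x : EState L) (P Q : Point L) (v : Mark) :
    (x.set P v).set Q v = (x.set Q v).set P v := by
  refine EState.ext rfl (funext fun T => ?_)
  by_cases h : SameLoop x.smoothing P T <;> by_cases h' : SameLoop x.smoothing Q T
  · rw [EState.set_mark_of_rel _ (by exact h'), EState.set_mark_of_rel _ (by exact h)]
  · rw [EState.set_mark_of_not _ (by exact h'), EState.set_mark_of_rel _ (by exact h),
      EState.set_mark_of_rel _ (by exact h)]
  · rw [EState.set_mark_of_rel _ (by exact h'), EState.set_mark_of_not _ (by exact h),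
      EState.set_mark_of_rel _ (by exact h')]
  · rw [EState.set_mark_of_not _ (by exact h'), EState.set_mark_of_not _ (by exact h),
      EState.set_mark_of_not _ (by exact h), EState.set_mark_of_not _ (by exact h')]

/-- All loops of the state `s` are marked by `v₊`. -/
def EState.plus {L : List Slice} (s : State L) : EState L where
  smoothing := s
  mark _ := .plus
  compat _ _ _ := rfl

/-- Multiplication of the loop through `P` by `v₋`. -/
noncomputable def xOp {L : List Slice} (P : Point L) : Chain L →ₗ[ℚ] Chain L where
  -- The coefficient at `y` comes from the generator with `v₊` on the loop of `P`; no generator is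
  -- sent to a `y` with `v₊` there.
  toFun φ y := if y.mark P = .minus then φ (y.set P .plus) else 0
  map_add' φ ψ := by ext y; by_cases h : y.mark P = .minus <;> simp [h]
  map_smul' r φ := by ext y; by_cases h : y.mark P = .minus <;> simp [h]

theorem xOp_apply {L : List Slice} (P : Point L) (φ : Chain L) (y : EState L) :
    xOp P φ y = if y.mark P = .minus then φ (y.set P .plus) else 0 := rfl

theorem gen_apply {L : List Slice} (x y : EState L) [Decidable (y = x)] :
    gen x y = if y = x then 1 else 0 := by
  unfold gen
  let _ : DecidableEq (EState L) := fun _ _ => Classical.propDecidable _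
  split_ifs with h
  · subst h; exact Pi.single_eq_same _ _
  · exact Pi.single_eq_of_ne h _

theorem Mark.minus_of_ne {v : Mark} (h : v ≠ .plus) : v = .minus := by
  cases v
  · exact absurd rfl h
  · rfl

theorem xOp_gen_of_plus {L : List Slice} {P : Point L} {x : EState L} (h : x.mark P = .plus) :
    xOp P (gen x) = gen (x.set P .minus) := by
  classical
  ext y
  rw [xOp_apply, gen_apply, gen_apply]
  by_cases hy : y = x.set P .minus
  · subst hy
    rw [if_pos (x.set_mark_self P _), if_pos rfl, EState.set_set, if_pos (x.set_of_mark h)]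
  · rw [if_neg hy]
    split_ifs with h1 h2
    · refine absurd ?_ hy
      rw [← h2, EState.set_set, y.set_of_mark h1]
    · rfl
    · rfl

theorem xOp_gen_of_minus {L : List Slice} {P : Point L} {x : EState L} (h : x.mark P = .minus) :
    xOp P (gen x) = 0 := by
  classical
  ext y
  rw [xOp_apply, gen_apply]
  split_ifs with h1 h2
  · rw [← h2, EState.set_mark_self] at h
    exact absurd h (by decide)
  · rfl
  · rfl

theorem xOp_gen_congr {L : List Slice} {P Q : Point L} {x : EState L}
    (h : SameLoop x.smoothing P Q) : xOp P (gen x) = xOp Q (gen x) := by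
  have hm := x.mark_eq h
  by_cases hP : x.mark P = .plus
  · rw [xOp_gen_of_plus hP, xOp_gen_of_plus (hm ▸ hP), x.set_congr h]
  · have hP := Mark.minus_of_ne hP
    rw [xOp_gen_of_minus hP, xOp_gen_of_minus (hm ▸ hP)]

theorem chain_ext {L L' : List Slice} {f g : Chain L →ₗ[ℚ] Chain L'}
    (h : ∀ x, f (gen x) = g (gen x)) : f = g := by
  classical
  refine LinearMap.pi_ext' fun x => LinearMap.ext_ring ?_
  have := h x
  unfold gen at this
  convert this using 1 <;>
  · rw [LinearMap.comp_apply, LinearMap.single_apply]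

/-- On a common loop both products vanish since `v₋ · v₋ = 0`; on different loops the marks are
changed independently. -/
theorem xOp_comm {L : List Slice} (P Q : Point L) (φ : Chain L) :
    xOp P (xOp Q φ) = xOp Q (xOp P φ) := by
  ext y
  simp only [xOp_apply]
  by_cases h : SameLoop y.smoothing P Q
  · have h' := (sameLoop_equivalence _).symm h
    rw [y.set_mark_of_rel h, y.set_mark_of_rel h']
    simp
  · have h' : ¬ SameLoop y.smoothing Q P := fun k => h ((sameLoop_equivalence _).symm k)
    rw [y.set_mark_of_not h, y.set_mark_of_not h', y.set_comm P Q]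
    by_cases h1 : y.mark P = .minus <;> by_cases h2 : y.mark Q = .minus <;> simp [h1, h2]

theorem ofCoeff_gen {L L' : List Slice} (c : EState L → EState L' → ℚ) (x : EState L) :
    ofCoeff c (gen x) = c x := by
  classical
  unfold ofCoeff gen
  rw [Matrix.mulVecLin_apply]
  exact Matrix.mulVec_single_one (Matrix.of fun y x => c x y) x

/-- `F` carries multiplication at `P` to multiplication at `P'`. -/
def Intertwines {L L' : List Slice} (F : Chain L →ₗ[ℚ] Chain L') (P : Point L) (P' : Point L') :
    Prop :=
  ∀ φ, F (xOp P φ) = xOp P' (F φ)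

theorem Intertwines.comp {L L' L'' : List Slice} {F : Chain L →ₗ[ℚ] Chain L'}
    {G : Chain L' →ₗ[ℚ] Chain L''} {P : Point L} {P' : Point L'} {P'' : Point L''}
    (hG : Intertwines G P' P'') (hF : Intertwines F P P') : Intertwines (G ∘ₗ F) P P'' :=
  fun φ => by rw [LinearMap.comp_apply, hF φ, hG]; rfl

/-- Multiplication sends a generator to a generator or to zero, so the comparison of the
coefficients at `y` of both composites on `gen x` amounts to `h`. -/
theorem ofCoeff_intertwines {L L' : List Slice} {r : EState L → EState L' → Prop}
    [∀ x y, Decidable (r x y)] {P : Point L} {P' : Point L'}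
    (h : ∀ x y, (x.mark P = .plus ∧ r (x.set P .minus) y) ↔
      (y.mark P' = .minus ∧ r x (y.set P' .plus))) :
    Intertwines (ofCoeff fun x y => if r x y then 1 else 0) P P' := by
  intro φ
  have : (ofCoeff fun x y => if r x y then (1 : ℚ) else 0) ∘ₗ xOp P =
      xOp P' ∘ₗ ofCoeff fun x y => if r x y then (1 : ℚ) else 0 := by
    refine chain_ext fun x => ?_
    rw [LinearMap.comp_apply, LinearMap.comp_apply, ofCoeff_gen]
    ext y
    rw [xOp_apply]
    have hxy := h x y
    by_cases hP : x.mark P = .plus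
    · rw [xOp_gen_of_plus hP, ofCoeff_gen]
      by_cases h1 : y.mark P' = .minus
      · rw [if_pos h1]
        exact if_congr (by tauto) rfl rfl
      · rw [if_neg h1, if_neg (by tauto)]
    · rw [xOp_gen_of_minus (Mark.minus_of_ne hP), map_zero]
      by_cases h1 : y.mark P' = .minus
      · rw [if_pos h1, if_neg (by tauto)]; rfl
      · rw [if_neg h1]; rfl
  exact LinearMap.congr_fun this φ

/-- Two maps that are compatible with the multiplications at the points of `O` agree, if they agree
on the enhanced states in which all points of `O` are marked by `v₊`. -/
theorem eq_of_intertwines {L L' : List Slice} {F G : Chain L →ₗ[ℚ] Chain L'}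
    (O : Point L → Prop)
    (hO : ∀ P, O P → ∃ P', Intertwines F P P' ∧ Intertwines G P P')
    (s : State L)
    (h : ∀ x, x.smoothing = s → (∀ P, O P → x.mark P = .plus) → F (gen x) = G (gen x)) :
    ∀ x, x.smoothing = s → F (gen x) = G (gen x) := by
  classical
  -- Induction on the number of points marked by `v₋`. If a point of `O` has this mark, the state is
  -- `v₋` times a state whose loop through this point carries `v₊`, and the factor is taken out on
  -- both sides.
  have key : ∀ n, ∀ x : EState L, x.smoothing = s →
      (Finset.univ.filter fun P => x.mark P = .minus).card = n → F (gen x) = G (gen x) := by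
    intro n
    induction n using Nat.strong_induction_on with
    | _ n ih =>
      intro x hx hn
      by_cases hp : ∀ P, O P → x.mark P = .plus
      · exact h x hx hp
      · push Not at hp
        obtain ⟨P, hP, hm⟩ := hp
        have hm := Mark.minus_of_ne hm
        obtain ⟨P', hF, hG⟩ := hO P hP
        have e : gen x = xOp P (gen (x.set P .plus)) := by
          rw [xOp_gen_of_plus (x.set_mark_self P _), EState.set_set, x.set_of_mark hm]
        rw [e, hF, hG]
        congr 1
        refine ih _ ?_ (x.set P .plus) hx rfl
        rw [← hn]
        refine Finset.card_lt_card ?_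
        rw [Finset.ssubset_iff_of_subset]
        · exact ⟨P, by simpa using hm, by simp⟩
        · intro Q
          simp only [Finset.mem_filter, Finset.mem_univ, true_and]
          intro hQ
          by_cases hPQ : SameLoop x.smoothing P Q
          · rw [x.set_mark_of_rel hPQ] at hQ
            exact absurd hQ (by decide)
          · rwa [x.set_mark_of_not hPQ] at hQ
  exact fun x hx => key _ x hx rfl

/-! ## Maps between chain groups of the saddle type -/

section SaddleType

variable {L L' : List Slice} (K : EState L → Prop) (f : State L → State L')
  (same : Point L → Point L' → Prop)

open Classical in
/-- A saddle, applied to the enhanced states with the property `K`. -/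
noncomputable def saddleType (a b : Point L) (a' b' : Point L') : Chain L →ₗ[ℚ] Chain L' :=
  ofCoeff fun x y => if K x ∧ y.smoothing = f x.smoothing ∧
    SaddleRule (SameLoop x.smoothing) same x.mark y.mark a b a' b' then 1 else 0

open Classical in
/-- A map that keeps all marks, applied to the enhanced states with the property `K`. -/
noncomputable def keepType : Chain L →ₗ[ℚ] Chain L' :=
  ofCoeff fun x y => if K x ∧ y.smoothing = f x.smoothing ∧
    ∀ P P', same P P' → y.mark P' = x.mark P then 1 else 0

variable {K f same}

theorem saddleType_of_not {a b : Point L} {a' b' : Point L'} {x : EState L} (h : ¬ K x) :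
    saddleType K f same a b a' b' (gen x) = 0 := by
  unfold saddleType
  rw [ofCoeff_gen]
  ext y
  rw [if_neg (by tauto)]
  rfl

theorem keepType_of_not {x : EState L} (h : ¬ K x) : keepType K f same (gen x) = 0 := by
  unfold keepType
  rw [ofCoeff_gen]
  ext y
  rw [if_neg (by tauto)]
  rfl

/-- The condition `hK` keeps `P` away from loops whose mark is prescribed by `K`, such as the small
loop that a Reidemeister move erases. -/
theorem saddleType_intertwines {a b : Point L} {a' b' : Point L'}
    (S : ∀ x, K x → SaddlePair (SameLoop x.smoothing) (SameLoop (f x.smoothing)) same a b a' b')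
    {P : Point L} {P' : Point L'} (hP : same P P')
    (hK : ∀ x v, K (x.set P v) ↔ K x) : Intertwines (saddleType K f same a b a' b') P P' := by
  classical
  unfold saddleType
  refine ofCoeff_intertwines fun x y => ?_
  rw [hK]
  by_cases hx : K x
  swap
  · tauto
  by_cases hy : y.smoothing = f x.smoothing
  swap
  · have h1 : (x.set P .minus).smoothing = x.smoothing := rfl
    have h2 : (y.set P' .plus).smoothing = y.smoothing := rfl
    rw [h1, h2]
    tauto
  have S := S x hx
  rw [← hy] at S
  have := SaddleRule.lower_iff (sameLoop_equivalence _) (sameLoop_equivalence _) S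
    (fun p q => x.mark_eq) (fun p q => y.mark_eq) hP
  simp only [hx, EState.set_smoothing, hy, true_and]
  exact this

theorem keepType_intertwines
    (S : ∀ x, K x → ∀ P Q P' Q', same P P' → same Q Q' →
      (SameLoop x.smoothing P Q ↔ SameLoop (f x.smoothing) P' Q'))
    {P : Point L} {P' : Point L'} (hP : same P P')
    (hK : ∀ x v, K (x.set P v) ↔ K x) : Intertwines (keepType K f same) P P' := by
  classical
  unfold keepType
  refine ofCoeff_intertwines fun x y => ?_
  rw [hK]
  by_cases hx : K x
  swap
  · tauto
  by_cases hy : y.smoothing = f x.smoothing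
  swap
  · simp only [EState.set_smoothing, hy, false_and, and_false]
  have S := S x hx
  rw [← hy] at S
  simp only [hx, EState.set_smoothing, hy, true_and]
  constructor
  · rintro ⟨h, k⟩
    have hp' := k P P' hP
    rw [x.set_mark_self] at hp'
    refine ⟨hp', fun Q Q' hQ => ?_⟩
    have := k Q Q' hQ
    by_cases hPQ : SameLoop x.smoothing P Q
    · rw [y.set_mark_of_rel ((S P Q P' Q' hP hQ).1 hPQ), ← x.mark_eq hPQ, h]
    · rw [y.set_mark_of_not (mt (S P Q P' Q' hP hQ).2 hPQ), this, x.set_mark_of_not hPQ]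
  · rintro ⟨h, k⟩
    have hp' := k P P' hP
    rw [y.set_mark_self] at hp'
    refine ⟨hp'.symm, fun Q Q' hQ => ?_⟩
    have := k Q Q' hQ
    by_cases hPQ : SameLoop x.smoothing P Q
    · rw [x.set_mark_of_rel hPQ, ← y.mark_eq ((S P Q P' Q' hP hQ).1 hPQ), h]
    · rw [x.set_mark_of_not hPQ, ← this, y.set_mark_of_not (mt (S P Q P' Q' hP hQ).2 hPQ)]

/-- By `cover` every loop of the new state passes through a point that was there before, so the
marks leave no freedom and the image is a single generator. -/
theorem keepType_gen {x : EState L} (hx : K x) {y : EState L'}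
    (cover : ∀ P', ∃ P Q', same P Q' ∧ SameLoop (f x.smoothing) Q' P')
    (hy : y.smoothing = f x.smoothing) (hm : ∀ P P', same P P' → y.mark P' = x.mark P) :
    keepType K f same (gen x) = gen y := by
  classical
  unfold keepType
  rw [ofCoeff_gen]
  ext z
  rw [gen_apply]
  refine if_congr ⟨?_, ?_⟩ rfl rfl
  · rintro ⟨-, hz, h⟩
    refine EState.ext (hz.trans hy.symm) (funext fun P' => ?_)
    obtain ⟨P, Q', hs, hl⟩ := cover P'
    rw [← z.mark_eq (by rwa [hz]), ← y.mark_eq (by rwa [hy]), h P Q' hs, hm P Q' hs]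
  · rintro rfl
    exact ⟨hx, hy, hm⟩

theorem saddleType_gen_of_not {a b : Point L} {a' b' : Point L'} {x : EState L} (hx : K x)
    (S : SaddlePair (SameLoop x.smoothing) (SameLoop (f x.smoothing)) same a b a' b')
    (hm : ∀ P P', same P P' → x.mark P = .plus) (ha : x.mark a = .plus) (hb : x.mark b = .plus)
    (hab : ¬ SameLoop x.smoothing a b) :
    saddleType K f same a b a' b' (gen x) = gen (EState.plus (f x.smoothing)) := by
  classical
  unfold saddleType
  rw [ofCoeff_gen]
  ext z
  rw [gen_apply]
  refine if_congr ⟨?_, ?_⟩ rfl rfl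
  · rintro ⟨-, hz, h⟩
    refine EState.ext hz (funext ?_)
    rw [← hz] at S
    exact (SaddleRule.plus_iff_of_not S hm ha hb (fun p q => z.mark_eq) hab).1 h
  · rintro rfl
    exact ⟨hx, rfl, (SaddleRule.plus_iff_of_not S hm ha hb (fun p q h => rfl) hab).2
      fun _ => rfl⟩

/-- This is `Δ(v₊) = v₋ ⊗ v₊ + v₊ ⊗ v₋`, written with the multiplications at the two new loops. -/
theorem saddleType_gen {a b : Point L} {a' b' : Point L'} {x : EState L} (hx : K x)
    (S : SaddlePair (SameLoop x.smoothing) (SameLoop (f x.smoothing)) same a b a' b')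
    (hm : ∀ P P', same P P' → x.mark P = .plus) (ha : x.mark a = .plus)
    (hab : SameLoop x.smoothing a b) :
    saddleType K f same a b a' b' (gen x) =
      xOp a' (gen (EState.plus (f x.smoothing))) + xOp b' (gen (EState.plus (f x.smoothing))) := by
  classical
  have hn : ¬ SameLoop (f x.smoothing) a' b' := S.xor.1 hab
  have hn' : ¬ SameLoop (f x.smoothing) b' a' := fun h => hn ((sameLoop_equivalence _).symm h)
  rw [xOp_gen_of_plus rfl, xOp_gen_of_plus rfl]
  unfold saddleType
  rw [ofCoeff_gen]
  ext z
  rw [Pi.add_apply, gen_apply, gen_apply]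
  have key : ∀ c, z = (EState.plus (f x.smoothing)).set c .minus ↔ z.smoothing = f x.smoothing ∧
      z.mark c = .minus ∧ ∀ q, ¬ SameLoop z.smoothing c q → z.mark q = .plus := by
    intro c
    constructor
    · rintro rfl
      exact ⟨rfl, EState.set_mark_self _ _ _, fun q hq =>
        (EState.set_mark_of_not (EState.plus (f x.smoothing)) hq _).trans rfl⟩
    · rintro ⟨h1, h2, h3⟩
      refine EState.ext h1 (funext fun q => ?_)
      by_cases hq : SameLoop z.smoothing c q
      · rw [← z.mark_eq hq, h2, EState.set_mark_of_rel]
        rwa [h1] at hq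
      · rw [h3 q hq, EState.set_mark_of_not]
        · rfl
        · rwa [h1] at hq
  -- The two new loops are different, so the two terms are different generators and no coefficient
  -- `2` arises.
  have hne : (EState.plus (f x.smoothing)).set a' .minus ≠
      (EState.plus (f x.smoothing)).set b' .minus := by
    intro h
    have := congrArg (fun e => e.mark a') h
    simp only [EState.set_mark_self] at this
    rw [EState.set_mark_of_not _ (by exact hn')] at this
    exact Mark.noConfusion this
  have main : (K x ∧ z.smoothing = f x.smoothing ∧
      SaddleRule (SameLoop x.smoothing) same x.mark z.mark a b a' b') ↔
      (z = (EState.plus (f x.smoothing)).set a' .minus ∨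
        z = (EState.plus (f x.smoothing)).set b' .minus) := by
    rw [key, key]
    by_cases hz : z.smoothing = f x.smoothing
    · rw [← hz] at S
      rw [SaddleRule.plus_iff (sameLoop_equivalence _) S hm ha (fun p q => z.mark_eq) hab]
      simp only [hx, true_and, hz]
    · simp [hz]
  by_cases h1 : z = (EState.plus (f x.smoothing)).set a' .minus
  · rw [if_pos (main.2 (.inl h1)), if_pos h1, if_neg (fun h2 => hne (h1.symm.trans h2)), add_zero]
  · by_cases h2 : z = (EState.plus (f x.smoothing)).set b' .minus
    · rw [if_pos (main.2 (.inr h2)), if_pos h2, if_neg h1, zero_add]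
    · rw [if_neg (by rw [main]; tauto), if_neg h1, if_neg h2, add_zero]

end SaddleType

/-! ## Widths -/

/-- The number of strands above the slices `M` if there are `w` strands below. -/
def outWidth (M : List Slice) (w : ℕ) : ℕ := M.foldl (fun w σ => σ.out w) w

@[simp] theorem outWidth_nil (w : ℕ) : outWidth [] w = w := rfl

@[simp] theorem outWidth_cons (σ : Slice) (M : List Slice) (w : ℕ) :
    outWidth (σ :: M) w = outWidth M (σ.out w) := rfl

theorem outWidth_append (M N : List Slice) (w : ℕ) :
    outWidth (M ++ N) w = outWidth N (outWidth M w) := List.foldl_append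

theorem width_eq_outWidth (L : List Slice) (k : ℕ) : width L k = outWidth (L.take k) 0 := rfl

theorem width_succ {L : List Slice} {k : ℕ} {σ : Slice} (h : L[k]? = some σ) :
    width L (k + 1) = σ.out (width L k) := by
  rw [width_eq_outWidth, List.take_add_one, h, outWidth_append]
  rfl

/-- The slices `M` can be put on top of `w` strands. -/
def Stacks : List Slice → ℕ → Prop
  | [], _ => True
  | σ :: M, w => σ.Fits w ∧ Stacks M (σ.out w)

theorem stacks_append (M N : List Slice) (w : ℕ) :
    Stacks (M ++ N) w ↔ Stacks M w ∧ Stacks N (outWidth M w) := by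
  induction M generalizing w with
  | nil => simp [Stacks]
  | cons σ M ih => simp [Stacks, ih, and_assoc]

theorem stacks_iff (M : List Slice) (w : ℕ) :
    Stacks M w ↔ ∀ (k : ℕ) (σ : Slice), M[k]? = some σ → σ.Fits (outWidth (M.take k) w) := by
  induction M generalizing w with
  | nil => simp [Stacks]
  | cons τ M ih =>
    rw [Stacks, ih]
    constructor
    · rintro ⟨h, h'⟩ k σ hk
      cases k with
      | zero => simp at hk; subst hk; exact h
      | succ k => exact h' k σ (by simpa using hk)
    · intro h
      exact ⟨h 0 τ rfl, fun k σ hk => h (k + 1) σ (by simpa using hk)⟩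

theorem isLinkDiagram_iff (L : List Slice) :
    IsLinkDiagram L ↔ Stacks L 0 ∧ outWidth L 0 = 0 := by
  unfold IsLinkDiagram
  rw [width_eq_outWidth, List.take_length, stacks_iff]
  refine and_congr_left fun _ => ⟨fun h k σ hk => ?_, fun h k => ?_⟩
  · obtain ⟨hlt, rfl⟩ := List.getElem?_eq_some_iff.1 hk
    exact h ⟨k, hlt⟩
  · exact h k _ (List.getElem?_eq_getElem k.2)

theorem IsLinkDiagram.fits {L : List Slice} (hL : IsLinkDiagram L) {k : ℕ} {σ : Slice}
    (h : L[k]? = some σ) : σ.Fits (width L k) := by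
  obtain ⟨hlt, rfl⟩ := List.getElem?_eq_some_iff.1 h
  exact hL.1 ⟨k, hlt⟩

/-! ## Coordinates -/

/-- Two coordinates are joined by an arc of a smoothed slice. -/
def Linked (L : List Slice) (β : ℕ → Bool) (p q : ℕ × ℕ) : Prop :=
  ∃ (k : ℕ) (σ : Slice), L[k]? = some σ ∧ σ.Arc k (β k) p q

/-- Two coordinates are joined by a path of arcs of the smoothed diagram. -/
def Conn (L : List Slice) (β : ℕ → Bool) : ℕ × ℕ → ℕ × ℕ → Prop :=
  Relation.EqvGen (Linked L β)

theorem conn_equivalence (L : List Slice) (β : ℕ → Bool) : Equivalence (Conn L β) :=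
  Relation.EqvGen.is_equivalence _

theorem Conn.symm {L : List Slice} {β : ℕ → Bool} {p q : ℕ × ℕ} (h : Conn L β p q) :
    Conn L β q p := (conn_equivalence L β).symm h

theorem Conn.trans {L : List Slice} {β : ℕ → Bool} {p q r : ℕ × ℕ} (h : Conn L β p q)
    (h' : Conn L β q r) : Conn L β p r := (conn_equivalence L β).trans h h'

theorem Conn.refl {L : List Slice} {β : ℕ → Bool} (p : ℕ × ℕ) : Conn L β p p :=
  (conn_equivalence L β).refl p

theorem Conn.of_arc {L : List Slice} {β : ℕ → Bool} {p q : ℕ × ℕ} {k : ℕ} {σ : Slice}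
    (h : L[k]? = some σ) (ha : σ.Arc k (β k) p q) : Conn L β p q :=
  .rel _ _ ⟨k, σ, h, ha⟩

/-- A map of the coordinates that carries arcs to related points carries paths to related points. -/
theorem Conn.map {L : List Slice} {β : ℕ → Bool} {X : Type} {E : X → X → Prop}
    (hE : Equivalence E) (f : ℕ × ℕ → X)
    (hf : ∀ (k : ℕ) (σ : Slice) p q, L[k]? = some σ → σ.Arc k (β k) p q → E (f p) (f q)) {p q : ℕ × ℕ}
    (h : Conn L β p q) : E (f p) (f q) := by
  induction h with
  | rel p q h => obtain ⟨k, σ, h1, h2⟩ := h; exact hf k σ p q h1 h2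
  | refl => exact hE.refl _
  | symm _ _ _ ih => exact hE.symm ih
  | trans _ _ _ _ _ ih ih' => exact hE.trans ih ih'

/-- The smoothing in the `k`-th slice. -/
def bits {L : List Slice} (s : State L) (k : ℕ) : Bool :=
  if h : k < L.length then smoothingAt s ⟨k, h⟩ else false

theorem bits_crossing {L : List Slice} (s : State L) (c : Crossing L) : bits s c.idx = s c := by
  unfold bits smoothingAt Crossing.idx
  rw [dif_pos c.1.2, dif_pos c.2]

/-- The coordinate belongs to a point of the diagram. -/
def OnDiagram (L : List Slice) (p : ℕ × ℕ) : Prop := p.1 ≤ L.length ∧ p.2 < width L p.1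

theorem Point.onDiagram {L : List Slice} (P : Point L) : OnDiagram L P.coord :=
  ⟨Nat.lt_succ_iff.1 P.1.2, P.2.2⟩

/-- The point with a given coordinate. -/
def OnDiagram.point {L : List Slice} {p : ℕ × ℕ} (h : OnDiagram L p) : Point L :=
  ⟨⟨p.1, Nat.lt_succ_iff.2 h.1⟩, ⟨p.2, h.2⟩⟩

@[simp]
theorem OnDiagram.coord_point {L : List Slice} {p : ℕ × ℕ} (h : OnDiagram L p) :
    h.point.coord = p := rfl

theorem Point.coord_injective {L : List Slice} {P Q : Point L} (h : P.coord = Q.coord) :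
    P = Q := by
  obtain ⟨⟨k, hk⟩, ⟨x, hx⟩⟩ := P
  obtain ⟨⟨l, hl⟩, ⟨y, hy⟩⟩ := Q
  simp only [Point.coord, Prod.mk.injEq] at h
  obtain ⟨rfl, rfl⟩ := h
  rfl

theorem Slice.Arc.level {k : ℕ} {σ : Slice} {b : Bool} {p q : ℕ × ℕ} (h : σ.Arc k b p q) :
    (p.1 = k ∨ p.1 = k + 1) ∧ (q.1 = k ∨ q.1 = k + 1) := by
  cases h <;> simp

theorem Slice.Arc.range {k : ℕ} {σ : Slice} {b : Bool} {p q : ℕ × ℕ} (h : σ.Arc k b p q) {w : ℕ}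
    (hw : σ.Fits w) :
    ((p.1 = k ∧ p.2 < w) ∨ (p.1 = k + 1 ∧ p.2 < σ.out w)) ↔
      ((q.1 = k ∧ q.2 < w) ∨ (q.1 = k + 1 ∧ q.2 < σ.out w)) := by
  cases h <;> simp only [Slice.Fits, Slice.out, true_and] at hw ⊢ <;> omega

theorem onDiagram_iff {L : List Slice} {k : ℕ} {σ : Slice} (h : L[k]? = some σ) {p : ℕ × ℕ}
    (hp : p.1 = k ∨ p.1 = k + 1) :
    OnDiagram L p ↔
      ((p.1 = k ∧ p.2 < width L k) ∨ (p.1 = k + 1 ∧ p.2 < σ.out (width L k))) := by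
  obtain ⟨hlt, -⟩ := List.getElem?_eq_some_iff.1 h
  rw [← width_succ h]
  obtain ⟨l, x⟩ := p
  unfold OnDiagram
  simp only at hp ⊢
  rcases hp with rfl | rfl <;> simp <;> intros <;> omega

theorem IsLinkDiagram.onDiagram_arc {L : List Slice} (hL : IsLinkDiagram L) {k : ℕ} {σ : Slice}
    {b : Bool} {p q : ℕ × ℕ} (h : L[k]? = some σ) (ha : σ.Arc k b p q) :
    OnDiagram L p ↔ OnDiagram L q := by
  rw [onDiagram_iff h ha.level.1, onDiagram_iff h ha.level.2]
  exact ha.range (hL.fits h)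

theorem IsLinkDiagram.onDiagram_conn {L : List Slice} (hL : IsLinkDiagram L) {β : ℕ → Bool}
    {p q : ℕ × ℕ} (h : Conn L β p q) : OnDiagram L p ↔ OnDiagram L q :=
  Conn.map (E := fun p q => OnDiagram L p ↔ OnDiagram L q)
    ⟨fun _ => .rfl, fun h => h.symm, fun h h' => h.trans h'⟩ id
    (fun _ _ _ _ h1 h2 => hL.onDiagram_arc h1 h2) h

theorem adjacent_iff {L : List Slice} (s : State L) (P Q : Point L) :
    Adjacent s P Q ↔ Linked L (bits s) P.coord Q.coord := by
  constructor
  · rintro ⟨k, h⟩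
    refine ⟨k, L[k], List.getElem?_eq_getElem k.2, ?_⟩
    have : bits s k = smoothingAt s k := dif_pos k.2
    rwa [this]
  · rintro ⟨k, σ, h, ha⟩
    obtain ⟨hlt, rfl⟩ := List.getElem?_eq_some_iff.1 h
    refine ⟨⟨k, hlt⟩, ?_⟩
    have : bits s k = smoothingAt s ⟨k, hlt⟩ := dif_pos hlt
    rwa [this] at ha

/-- Paths of coordinates are easier to carry from one diagram to another, since a shift of levels is
plain arithmetic. Nothing is gained or lost: an arc with one end on the diagram has both ends there,
so a path of coordinates that starts at a point of the diagram consists of such points. -/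
theorem IsLinkDiagram.sameLoop_iff {L : List Slice} (hL : IsLinkDiagram L) (s : State L)
    (P Q : Point L) : SameLoop s P Q ↔ Conn L (bits s) P.coord Q.coord := by
  constructor
  · intro h
    induction h with
    | rel P Q h => exact .rel _ _ ((adjacent_iff s P Q).1 h)
    | refl => exact .refl _
    | symm _ _ _ ih => exact ih.symm
    | trans _ _ _ _ _ ih ih' => exact ih.trans ih'
  · intro h
    have key : ∀ p q, Conn L (bits s) p q → ∀ P Q : Point L, P.coord = p → Q.coord = q →
        SameLoop s P Q := by
      intro p q h
      induction h with
      | rel p q h =>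
        rintro P Q rfl rfl
        exact .rel _ _ ((adjacent_iff s P Q).2 h)
      | refl p =>
        rintro P Q hP hQ
        rw [Point.coord_injective (hP.trans hQ.symm)]
        exact .refl _
      | symm p q _ ih => exact fun P Q hP hQ => .symm _ _ (ih Q P hQ hP)
      | trans p q r h _ ih ih' =>
        rintro P Q hP hQ
        have hq : OnDiagram L q := (hL.onDiagram_conn h).1 (hP ▸ P.onDiagram)
        exact .trans _ _ _ (ih P hq.point hP rfl) (ih' hq.point Q rfl hQ)
    exact key _ _ h P Q rfl rfl

/-! ## Planarity

The loops of every state are oriented by the rule that a strand points upwards if its number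
is even.  Hence they are the cycles of a permutation of the points. -/

/-- The other end of the arc of the smoothed slice that starts at the lower point `x`. -/
def Slice.above (k : ℕ) : Slice → Bool → ℕ → ℕ × ℕ
  | cup i, _, x => if x < i then (k + 1, x) else (k + 1, x + 2)
  | cap i, _, x => if x < i then (k + 1, x) else if x = i then (k, i + 1) else
      if x = i + 1 then (k, i) else (k + 1, x - 2)
  | cross i e, b, x => if x = i then (if e = b then (k, i + 1) else (k + 1, i)) else
      if x = i + 1 then (if e = b then (k, i) else (k + 1, i + 1)) else (k + 1, x)

/-- The other end of the arc of the smoothed slice that starts at the upper point `x`. -/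
def Slice.below (k : ℕ) : Slice → Bool → ℕ → ℕ × ℕ
  | cup i, _, x => if x < i then (k, x) else if x = i then (k + 1, i + 1) else
      if x = i + 1 then (k + 1, i) else (k, x - 2)
  | cap i, _, x => if x < i then (k, x) else (k, x + 2)
  | cross i e, b, x => if x = i then (if e = b then (k + 1, i + 1) else (k, i)) else
      if x = i + 1 then (if e = b then (k + 1, i) else (k, i + 1)) else (k, x)

/-- An arc that passes to the next level preserves the parity of the strand number, and an arc that
turns back changes it. Hence the orientation by parity is consistent along every arc of every
smoothing. -/
theorem Slice.above_spec (k : ℕ) (σ : Slice) (b : Bool) (x : ℕ) :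
    (∃ y, σ.above k b x = (k + 1, y) ∧ y % 2 = x % 2 ∧ σ.below k b y = (k, x)) ∨
      ∃ y, σ.above k b x = (k, y) ∧ y % 2 ≠ x % 2 ∧ σ.above k b y = (k, x) := by
  cases σ with
  | cup i =>
    by_cases h : x < i
    · exact .inl ⟨x, by simp [above, h], rfl, by simp [below, h]⟩
    · refine .inl ⟨x + 2, by simp [above, h], by omega, ?_⟩
      simp only [below]
      rw [if_neg (by omega), if_neg (by omega), if_neg (by omega), Nat.add_sub_cancel]
  | cap i =>
    by_cases h : x < i
    · exact .inl ⟨x, by simp [above, h], rfl, by simp [below, h]⟩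
    · by_cases h1 : x = i
      · subst h1
        exact .inr ⟨x + 1, by simp [above], by omega, by simp [above]⟩
      · by_cases h2 : x = i + 1
        · subst h2
          exact .inr ⟨i, by simp [above], by omega, by simp [above]⟩
        · refine .inl ⟨x - 2, by simp [above, h, h1, h2], by omega, ?_⟩
          simp only [below]
          rw [if_neg (by omega), Nat.sub_add_cancel (by omega)]
  | cross i e =>
    by_cases h1 : x = i
    · subst h1
      by_cases he : e = b
      · exact .inr ⟨x + 1, by simp [above, he], by omega, by simp [above, he]⟩
      · exact .inl ⟨x, by simp [above, he], rfl, by simp [below, he]⟩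
    · by_cases h2 : x = i + 1
      · subst h2
        by_cases he : e = b
        · exact .inr ⟨i, by simp [above, he], by omega, by simp [above, he]⟩
        · exact .inl ⟨i + 1, by simp [above, he], rfl, by simp [below, he]⟩
      · exact .inl ⟨x, by simp [above, h1, h2], rfl, by simp [below, h1, h2]⟩

theorem Slice.below_spec (k : ℕ) (σ : Slice) (b : Bool) (x : ℕ) :
    (∃ y, σ.below k b x = (k, y) ∧ y % 2 = x % 2 ∧ σ.above k b y = (k + 1, x)) ∨
      ∃ y, σ.below k b x = (k + 1, y) ∧ y % 2 ≠ x % 2 ∧ σ.below k b y = (k + 1, x) := by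
  cases σ with
  | cap i =>
    by_cases h : x < i
    · exact .inl ⟨x, by simp [below, h], rfl, by simp [above, h]⟩
    · refine .inl ⟨x + 2, by simp [below, h], by omega, ?_⟩
      simp only [above]
      rw [if_neg (by omega), if_neg (by omega), if_neg (by omega), Nat.add_sub_cancel]
  | cup i =>
    by_cases h : x < i
    · exact .inl ⟨x, by simp [below, h], rfl, by simp [above, h]⟩
    · by_cases h1 : x = i
      · subst h1
        exact .inr ⟨x + 1, by simp [below], by omega, by simp [below]⟩
      · by_cases h2 : x = i + 1
        · subst h2
          exact .inr ⟨i, by simp [below], by omega, by simp [below]⟩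
        · refine .inl ⟨x - 2, by simp [below, h, h1, h2], by omega, ?_⟩
          simp only [above]
          rw [if_neg (by omega), Nat.sub_add_cancel (by omega)]
  | cross i e =>
    by_cases h1 : x = i
    · subst h1
      by_cases he : e = b
      · exact .inr ⟨x + 1, by simp [below, he], by omega, by simp [below, he]⟩
      · exact .inl ⟨x, by simp [below, he], rfl, by simp [above, he]⟩
    · by_cases h2 : x = i + 1
      · subst h2
        by_cases he : e = b
        · exact .inr ⟨i, by simp [below, he], by omega, by simp [below, he]⟩
        · exact .inl ⟨i + 1, by simp [below, he], rfl, by simp [above, he]⟩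
      · exact .inl ⟨x, by simp [below, h1, h2], rfl, by simp [above, h1, h2]⟩

theorem Slice.arc_above (k : ℕ) (σ : Slice) (b : Bool) (x : ℕ) :
    σ.Arc k b (k, x) (σ.above k b x) ∨ σ.Arc k b (σ.above k b x) (k, x) := by
  cases σ with
  | cup i =>
    by_cases h : x < i
    · simp only [above, h, if_true]; exact .inl (.cup_left h)
    · simp only [above, h, if_false]; exact .inl (.cup_right (by omega))
  | cap i =>
    by_cases h : x < i
    · simp only [above, h, if_true]; exact .inl (.cap_left h)
    · by_cases h1 : x = i
      · subst h1; simp only [above, h, if_false, if_true]; exact .inl .cap_turn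
      · by_cases h2 : x = i + 1
        · subst h2; simp only [above, h, h1, if_false, if_true]; exact .inr .cap_turn
        · simp only [above, h, h1, h2, if_false]
          obtain ⟨y, rfl⟩ : ∃ y, x = y + 2 := ⟨x - 2, by omega⟩
          exact .inl (.cap_right (by omega))
  | cross i e =>
    by_cases h1 : x = i
    · subst h1
      by_cases he : e = b
      · simp only [above, if_true, if_pos he]; exact .inl (.hor_bottom he)
      · simp only [above, if_true, if_neg he]; exact .inl (.vert_left he)
    · by_cases h2 : x = i + 1
      · subst h2
        by_cases he : e = b
        · simp only [above, h1, if_true, if_false, if_pos he]; exact .inr (.hor_bottom he)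
        · simp only [above, h1, if_true, if_false, if_neg he]; exact .inl (.vert_right he)
      · simp only [above, h1, h2, if_false]; exact .inl (.away h1 h2)

theorem Slice.arc_below (k : ℕ) (σ : Slice) (b : Bool) (x : ℕ) :
    σ.Arc k b (k + 1, x) (σ.below k b x) ∨ σ.Arc k b (σ.below k b x) (k + 1, x) := by
  rcases σ.below_spec k b x with ⟨y, h, -, h'⟩ | ⟨y, h, h2, h'⟩
  · rw [h, ← h']
    exact (σ.arc_above k b y).symm
  · cases σ with
    | cap i => simp only [below] at h; split_ifs at h <;> simp at h
    | cup i =>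
      simp only [below] at h ⊢
      split_ifs at h ⊢ with h1 h3 h4
      · simp at h
      · subst h3; exact .inl .cup_turn
      · subst h4; exact .inr .cup_turn
      · simp at h
    | cross i e =>
      simp only [below] at h ⊢
      split_ifs at h ⊢ with h1 h3 h4 h5
      · subst h1; exact .inl (.hor_top h3)
      · simp at h
      · subst h4; exact .inr (.hor_top h5)
      · simp at h
      · simp at h

theorem Slice.Arc.eq_or {k : ℕ} {σ : Slice} {b : Bool} {p q : ℕ × ℕ} (h : σ.Arc k b p q) :
    (p.1 = k ∧ σ.above k b p.2 = q) ∨ (p.1 = k + 1 ∧ σ.below k b p.2 = q) := by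
  cases h with
  | cup_left h => left; simp [above, h]
  | cup_right h => left; simp [above, Nat.not_lt.2 h]
  | cup_turn => right; simp [below]
  | cap_left h => left; simp [above, h]
  | cap_right h =>
    left
    refine ⟨rfl, ?_⟩
    simp only [above]
    rw [if_neg (by omega), if_neg (by omega), if_neg (by omega), Nat.add_sub_cancel]
  | cap_turn => left; simp [above]
  | away h h' => left; simp [above, h, h']
  | vert_left h => left; simp [above, h]
  | vert_right h => left; simp [above, h]
  | hor_bottom h => left; simp [above, h]
  | hor_top h => right; simp [below, h]

/-- The next point on the loop. -/
def nextCoord (L : List Slice) (β : ℕ → Bool) (p : ℕ × ℕ) : ℕ × ℕ :=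
  -- The fallback value `p` and the truncated subtraction at level `0` concern only coordinates that
  -- are not points of a link diagram, see `IsLinkDiagram.slices_at`.
  if p.2 % 2 = 0 then (L[p.1]?).elim p fun σ => σ.above p.1 (β p.1) p.2
  else (L[p.1 - 1]?).elim p fun σ => σ.below (p.1 - 1) (β (p.1 - 1)) p.2

/-- The previous point on the loop. -/
def prevCoord (L : List Slice) (β : ℕ → Bool) (p : ℕ × ℕ) : ℕ × ℕ :=
  if p.2 % 2 = 1 then (L[p.1]?).elim p fun σ => σ.above p.1 (β p.1) p.2
  else (L[p.1 - 1]?).elim p fun σ => σ.below (p.1 - 1) (β (p.1 - 1)) p.2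

theorem nextCoord_above {L : List Slice} {β : ℕ → Bool} {k x : ℕ} {σ : Slice}
    (h : L[k]? = some σ) (hx : x % 2 = 0) : nextCoord L β (k, x) = σ.above k (β k) x := by
  simp [nextCoord, hx, h]

theorem nextCoord_below {L : List Slice} {β : ℕ → Bool} {k x : ℕ} {σ : Slice}
    (h : L[k]? = some σ) (hx : x % 2 = 1) : nextCoord L β (k + 1, x) = σ.below k (β k) x := by
  simp [nextCoord, hx, h]

theorem prevCoord_above {L : List Slice} {β : ℕ → Bool} {k x : ℕ} {σ : Slice}
    (h : L[k]? = some σ) (hx : x % 2 = 1) : prevCoord L β (k, x) = σ.above k (β k) x := by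
  simp [prevCoord, hx, h]

theorem prevCoord_below {L : List Slice} {β : ℕ → Bool} {k x : ℕ} {σ : Slice}
    (h : L[k]? = some σ) (hx : x % 2 = 0) : prevCoord L β (k + 1, x) = σ.below k (β k) x := by
  simp [prevCoord, hx, h]

/-- A point of a link diagram is neither on the lowest nor on the highest level. -/
theorem IsLinkDiagram.slices_at {L : List Slice} (hL : IsLinkDiagram L) {p : ℕ × ℕ}
    (hp : OnDiagram L p) :
    ∃ (k x : ℕ) (σ τ : Slice), p = (k + 1, x) ∧ L[k]? = some σ ∧ L[k + 1]? = some τ := by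
  obtain ⟨l, x⟩ := p
  obtain ⟨h1, h2⟩ := hp
  simp only at h1 h2
  have h0 : l ≠ 0 := by
    rintro rfl
    exact absurd h2 (Nat.not_lt_zero _)
  have hl : l ≠ L.length := by
    rintro rfl
    rw [hL.2] at h2
    exact absurd h2 (Nat.not_lt_zero _)
  obtain ⟨k, rfl⟩ : ∃ k, l = k + 1 := ⟨l - 1, by omega⟩
  exact ⟨k, x, L[k], L[k + 1], rfl, List.getElem?_eq_getElem (by omega),
    List.getElem?_eq_getElem (by omega)⟩

/-- The two functions use opposite parity conventions. Since parity is kept by passing arcs and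
changed by turning arcs, the second function retraces the arc that the first one has followed. -/
theorem IsLinkDiagram.prevCoord_nextCoord {L : List Slice} (hL : IsLinkDiagram L) (β : ℕ → Bool)
    {p : ℕ × ℕ} (hp : OnDiagram L p) : prevCoord L β (nextCoord L β p) = p := by
  obtain ⟨k, x, σ, τ, rfl, hσ, hτ⟩ := hL.slices_at hp
  rcases Nat.mod_two_eq_zero_or_one x with hx | hx
  · rw [nextCoord_above hτ hx]
    rcases τ.above_spec (k + 1) (β (k + 1)) x with ⟨y, h, hy, h'⟩ | ⟨y, h, hy, h'⟩
    · rw [h, prevCoord_below hτ (by omega), h']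
    · rw [h, prevCoord_above hτ (by omega), h']
  · rw [nextCoord_below hσ hx]
    rcases σ.below_spec k (β k) x with ⟨y, h, hy, h'⟩ | ⟨y, h, hy, h'⟩
    · rw [h, prevCoord_above hσ (by omega), h']
    · rw [h, prevCoord_below hσ (by omega), h']

theorem IsLinkDiagram.linked_nextCoord {L : List Slice} (hL : IsLinkDiagram L) (β : ℕ → Bool)
    {p : ℕ × ℕ} (hp : OnDiagram L p) :
    Linked L β p (nextCoord L β p) ∨ Linked L β (nextCoord L β p) p := by
  obtain ⟨k, x, σ, τ, rfl, hσ, hτ⟩ := hL.slices_at hp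
  rcases Nat.mod_two_eq_zero_or_one x with hx | hx
  · rw [nextCoord_above hτ hx]
    exact (τ.arc_above (k + 1) (β (k + 1)) x).imp (⟨_, _, hτ, ·⟩) (⟨_, _, hτ, ·⟩)
  · rw [nextCoord_below hσ hx]
    exact (σ.arc_below k (β k) x).imp (⟨_, _, hσ, ·⟩) (⟨_, _, hσ, ·⟩)

/-- The parity decides from which of its two ends an arc is traversed. -/
theorem Linked.nextCoord_eq {L : List Slice} {β : ℕ → Bool} {p q : ℕ × ℕ} (h : Linked L β p q) :
    nextCoord L β p = q ∨ nextCoord L β q = p := by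
  obtain ⟨k, σ, hσ, ha⟩ := h
  obtain ⟨l, x⟩ := p
  rcases ha.eq_or with ⟨h, rfl⟩ | ⟨h, rfl⟩
  · simp only at h
    subst h
    rcases Nat.mod_two_eq_zero_or_one x with hx | hx
    · exact .inl (nextCoord_above hσ hx)
    · right
      rcases σ.above_spec l (β l) x with ⟨y, h, hy, h'⟩ | ⟨y, h, hy, h'⟩
      · simp only at h ⊢
        rw [h, nextCoord_below hσ (by omega), h']
      · simp only at h ⊢
        rw [h, nextCoord_above hσ (by omega), h']
  · simp only at h
    subst h
    rcases Nat.mod_two_eq_zero_or_one x with hx | hx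
    · right
      rcases σ.below_spec k (β k) x with ⟨y, h, hy, h'⟩ | ⟨y, h, hy, h'⟩
      · simp only at h ⊢
        rw [h, nextCoord_above hσ (by omega), h']
      · simp only at h ⊢
        rw [h, nextCoord_below hσ (by omega), h']
    · exact .inl (nextCoord_below hσ hx)

theorem IsLinkDiagram.onDiagram_nextCoord {L : List Slice} (hL : IsLinkDiagram L) (β : ℕ → Bool)
    {p : ℕ × ℕ} (hp : OnDiagram L p) : OnDiagram L (nextCoord L β p) := by
  rcases hL.linked_nextCoord β hp with ⟨k, σ, h, ha⟩ | ⟨k, σ, h, ha⟩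
  · exact (hL.onDiagram_arc h ha).1 hp
  · exact (hL.onDiagram_arc h ha).2 hp

/-- The permutation of the points whose cycles are the loops of the state. -/
noncomputable def IsLinkDiagram.next {L : List Slice} (hL : IsLinkDiagram L) (s : State L) :
    Equiv.Perm (Point L) :=
  Equiv.ofBijective (fun P => (hL.onDiagram_nextCoord (bits s) P.onDiagram).point)
    (Finite.injective_iff_bijective.1 fun P Q h => by
      have h' := congrArg Point.coord h
      simp only [OnDiagram.coord_point] at h'
      refine Point.coord_injective ?_
      rw [← hL.prevCoord_nextCoord (bits s) P.onDiagram, h',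
        hL.prevCoord_nextCoord (bits s) Q.onDiagram])

theorem IsLinkDiagram.coord_next {L : List Slice} (hL : IsLinkDiagram L) (s : State L)
    (P : Point L) : (hL.next s P).coord = nextCoord L (bits s) P.coord := rfl

/-- Each step of the permutation runs along an arc, and each arc is such a step from one of its
ends. -/
theorem IsLinkDiagram.sameCycle_next {L : List Slice} (hL : IsLinkDiagram L) (s : State L)
    (P Q : Point L) : (hL.next s).SameCycle P Q ↔ SameLoop s P Q := by
  constructor
  · intro h
    obtain ⟨n, rfl⟩ := h.exists_nat_pow_eq
    clear h
    induction n with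
    | zero => exact .refl _
    | succ n ih =>
      rw [pow_succ', Equiv.Perm.mul_apply]
      refine .trans _ _ _ ih ?_
      rcases hL.linked_nextCoord (bits s) ((hL.next s ^ n) P).onDiagram with h | h
      · exact .rel _ _ ((adjacent_iff s _ _).2 h)
      · exact .symm _ _ (.rel _ _ ((adjacent_iff s _ _).2 h))
  · intro h
    induction h with
    | rel P Q h =>
      rcases ((adjacent_iff s P Q).1 h).nextCoord_eq with h | h
      · exact ⟨1, Point.coord_injective h⟩
      · exact .symm ⟨1, Point.coord_injective h⟩
    | refl => exact .refl _ _
    | symm _ _ _ ih => exact ih.symm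
    | trans _ _ _ _ _ ih ih' => exact ih.trans ih'

theorem bits_congr {L : List Slice} {s s' : State L} {k : ℕ}
    (h : ∀ c : Crossing L, c.idx = k → s c = s' c) : bits s k = bits s' k := by
  unfold bits smoothingAt
  split_ifs with h1 h2
  · exact h _ rfl
  · rfl
  · rfl

theorem Crossing.ext_idx {L : List Slice} {c c' : Crossing L} (h : c.idx = c'.idx) : c = c' :=
  Subtype.ext (Fin.ext h)

theorem getElem?_of_crossing {L : List Slice} (c : Crossing L) :
    ∃ i e, L[c.idx]? = some (.cross i e) := by
  have h := c.2
  have h' : L[c.idx]? = some L[c.1] := List.getElem?_eq_getElem c.1.2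
  revert h h'
  generalize L[c.1] = σ
  intro h h'
  cases σ with
  | cup i => simp [Slice.isCross] at h
  | cap i => simp [Slice.isCross] at h
  | cross i e => exact ⟨i, e, h'⟩

/-- The crossing in a given slice. -/
def crossingAt {L : List Slice} {k i : ℕ} {e : Bool} (h : L[k]? = some (.cross i e)) :
    Crossing L :=
  ⟨⟨k, (List.getElem?_eq_some_iff.1 h).1⟩, by
    obtain ⟨h1, h2⟩ := List.getElem?_eq_some_iff.1 h
    simp only [Fin.getElem_fin, h2]
    rfl⟩

@[simp]
theorem crossingAt_idx {L : List Slice} {k i : ℕ} {e : Bool} (h : L[k]? = some (.cross i e)) :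
    (crossingAt h).idx = k := rfl

theorem pos_of_crossing {L : List Slice} {c : Crossing L} {i : ℕ} {e : Bool}
    (h : L[c.idx]? = some (.cross i e)) : L[c.1] = .cross i e := by
  obtain ⟨h1, h2⟩ := List.getElem?_eq_some_iff.1 h
  exact h2

/-- The band of a saddle may be attached anywhere along its loops: its ends are slid from `a, b` to
`c, d`, possibly in exchanged order, along loops of either state. -/
theorem SaddlePair.change {P : Type} {R R' : P → P → Prop} (hR : Equivalence R)
    (hR' : Equivalence R') {a b c d : P} (S : SaddlePair R R' Eq a b a b)
    (h : Matched R a b c d) (h' : Matched R' a b c d) : SaddlePair R R' Eq c d c d := by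
  have key : ∀ {T : P → P → Prop}, Equivalence T → Matched T a b c d →
      (T a b ↔ T c d) ∧ ∀ p, (T p a ∨ T p b) ↔ (T p c ∨ T p d) := by
    intro T hT hm
    have c1 : ∀ {x y}, T x y → ∀ p, T p x ↔ T p y := fun h p =>
      ⟨fun k => hT.trans k h, fun k => hT.trans k (hT.symm h)⟩
    have c2 : ∀ {x y}, T x y → ∀ p, T x p ↔ T y p := fun h p =>
      ⟨fun k => hT.trans (hT.symm h) k, fun k => hT.trans h k⟩
    rcases hm with ⟨h1, h2⟩ | ⟨h1, h2⟩
    · exact ⟨by rw [c1 h2, c2 h1], fun p => by rw [c1 h2, c1 h1]⟩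
    · refine ⟨by rw [c1 h2, c2 h1]; exact ⟨hT.symm, hT.symm⟩, fun p => ?_⟩
      rw [c1 h2, c1 h1]
      exact or_comm
  obtain ⟨k1, k2⟩ := key hR h
  obtain ⟨k1', k2'⟩ := key hR' h'
  refine ⟨by rw [← k1, ← k1', S.xor], ?_, ?_, fun p => .inr (.inr ⟨p, p, rfl, hR'.refl p⟩)⟩
  · rintro p q p' q' rfl rfl
    have := S.join p q p q rfl rfl
    unfold Joined at this ⊢
    rw [← k2, ← k2, ← k2', ← k2']
    exact this
  · rintro p p' rfl
    rw [← k2, ← k2', S.touch p p rfl]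

/-- Planarity enters here. The oriented loops run into the crossing at exactly two of its corners:
the lower one on an even strand and the upper one on an odd strand. The other smoothing exchanges
the successors of these two corners and changes nothing else. So `next` is multiplied by a
transposition, and a saddle from one loop to one loop is impossible. -/
theorem IsLinkDiagram.saddlePair {L : List Slice} (hL : IsLinkDiagram L) {s s' : State L}
    {c : Crossing L} {i : ℕ} {e : Bool} (hc : L[c.idx]? = some (.cross i e))
    (h : ∀ c' ≠ c, s' c' = s c') (hne : s' c ≠ s c) {a b : Point L}
    (ha : a.coord = (c.idx, i)) (hb : b.coord = (c.idx + 1, i + 1)) :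
    SaddlePair (SameLoop s) (SameLoop s') Eq a b a b := by
  classical
  set k := c.idx with hk
  have hbits : ∀ m, m ≠ k → bits s' m = bits s m := fun m hm =>
    bits_congr fun c' hc' => h c' (by rintro rfl; exact hm hc'.symm)
  have hbk : bits s' k ≠ bits s k := by
    rw [hk, bits_crossing, bits_crossing]; exact hne
  have hfit : i + 2 ≤ width L k := hL.fits hc
  have hfit' : width L (k + 1) = width L k := width_succ hc
  obtain ⟨hlt, -⟩ := List.getElem?_eq_some_iff.1 hc
  have main : ∀ (x y : Point L), x ≠ y →
      (∀ P : Point L, P ≠ x → P ≠ y →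
        nextCoord L (bits s') P.coord = nextCoord L (bits s) P.coord) →
      nextCoord L (bits s') x.coord = nextCoord L (bits s) y.coord →
      nextCoord L (bits s') y.coord = nextCoord L (bits s) x.coord →
      SaddlePair (SameLoop s) (SameLoop s') Eq x y x y := by
    intro x y hxy h1 h2 h3
    have hmul : hL.next s' = hL.next s * Equiv.swap x y := by
      ext1 P
      refine Point.coord_injective ?_
      rw [Equiv.Perm.mul_apply, hL.coord_next, hL.coord_next]
      by_cases hx : P = x
      · rw [hx, Equiv.swap_apply_left, h2]
      · by_cases hy : P = y
        · rw [hy, Equiv.swap_apply_right, h3]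
        · rw [Equiv.swap_apply_of_ne_of_ne hx hy, h1 P hx hy]
    have S := saddlePair_mul_swap (hL.next s) hxy
    rw [← hmul] at S
    have e1 : (hL.next s).SameCycle = SameLoop s := by
      ext P Q; exact hL.sameCycle_next s P Q
    have e2 : (hL.next s').SameCycle = SameLoop s' := by
      ext P Q; exact hL.sameCycle_next s' P Q
    rwa [e1, e2] at S
  have hcases : (e = bits s k ∧ e ≠ bits s' k) ∨ (e ≠ bits s k ∧ e = bits s' k) := by
    revert hbk
    generalize bits s k = u
    generalize bits s' k = v
    cases e <;> cases u <;> cases v <;> simp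
  have hother : ∀ P : Point L, ∀ l x, P.coord = (l, x) →
      (l = k → x % 2 = 0 → x ≠ i ∧ x ≠ i + 1) → (l = k + 1 → x % 2 = 1 → x ≠ i ∧ x ≠ i + 1) →
      nextCoord L (bits s') P.coord = nextCoord L (bits s) P.coord := by
    intro P l x hP h1 h2
    obtain ⟨m, y, σ, τ, hP', hσ, hτ⟩ := hL.slices_at P.onDiagram
    rw [hP', Prod.mk.injEq] at hP
    obtain ⟨rfl, rfl⟩ := hP
    rw [hP']
    rcases Nat.mod_two_eq_zero_or_one y with hy | hy
    · rw [nextCoord_above hτ hy, nextCoord_above hτ hy]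
      by_cases hm : m + 1 = k
      · obtain ⟨h3, h4⟩ := h1 hm hy
        rw [hm] at hτ
        rw [hc, Option.some.injEq] at hτ
        rw [← hτ]
        simp [Slice.above, h3, h4]
      · rw [hbits _ hm]
    · rw [nextCoord_below hσ hy, nextCoord_below hσ hy]
      by_cases hm : m = k
      · obtain ⟨h3, h4⟩ := h2 (by omega) hy
        rw [hm] at hσ
        rw [hc, Option.some.injEq] at hσ
        rw [← hσ]
        simp [Slice.below, h3, h4]
      · rw [hbits _ hm]
  -- For even `i` the incoming corners are `a` and `b`. For odd `i` they are the lower right and the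
  -- upper left corner, and the saddle is slid from there to `a, b`.
  rcases Nat.mod_two_eq_zero_or_one i with hi | hi
  · refine main a b ?_ ?_ ?_ ?_
    · rintro rfl
      rw [ha] at hb
      simp at hb
    · intro P hPa hPb
      have hPa : P.coord ≠ (k, i) := fun h' => hPa (Point.coord_injective (h'.trans ha.symm))
      have hPb : P.coord ≠ (k + 1, i + 1) := fun h' =>
        hPb (Point.coord_injective (h'.trans hb.symm))
      obtain ⟨l, x, hP⟩ : ∃ l x, P.coord = (l, x) := ⟨_, _, rfl⟩
      rw [hP] at hPa hPb
      simp only [ne_eq, Prod.mk.injEq, not_and] at hPa hPb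
      exact hother P l x hP (fun h1 h2 => ⟨hPa h1, by omega⟩) fun h1 h2 => ⟨by omega, hPb h1⟩
    · rw [ha, hb, nextCoord_above hc hi, nextCoord_below hc (by omega)]
      rcases hcases with ⟨h1, h2⟩ | ⟨h1, h2⟩
      · simp [Slice.above, Slice.below, ← h1, h2]
      · simp [Slice.above, Slice.below, h1, ← h2]
    · rw [ha, hb, nextCoord_above hc hi, nextCoord_below hc (by omega)]
      rcases hcases with ⟨h1, h2⟩ | ⟨h1, h2⟩
      · simp [Slice.above, Slice.below, ← h1, h2]
      · simp [Slice.above, Slice.below, h1, ← h2]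
  · have ha2 : OnDiagram L (k, i + 1) := ⟨by simp; omega, by simp; omega⟩
    have hb2 : OnDiagram L (k + 1, i) := ⟨by simp; omega, by simp; omega⟩
    have S : SaddlePair (SameLoop s) (SameLoop s') Eq ha2.point hb2.point ha2.point hb2.point := by
      refine main _ _ ?_ ?_ ?_ ?_
      · intro h'
        have := congrArg Point.coord h'
        simp at this
      · intro P hPa hPb
        have hPa : P.coord ≠ (k, i + 1) := fun h' => hPa (Point.coord_injective h')
        have hPb : P.coord ≠ (k + 1, i) := fun h' => hPb (Point.coord_injective h')
        obtain ⟨l, x, hP⟩ : ∃ l x, P.coord = (l, x) := ⟨_, _, rfl⟩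
        rw [hP] at hPa hPb
        simp only [ne_eq, Prod.mk.injEq, not_and] at hPa hPb
        exact hother P l x hP (fun h1 h2 => ⟨by omega, hPa h1⟩) fun h1 h2 => ⟨hPb h1, by omega⟩
      · rw [OnDiagram.coord_point, OnDiagram.coord_point, nextCoord_above hc (by omega),
          nextCoord_below hc hi]
        rcases hcases with ⟨h1, h2⟩ | ⟨h1, h2⟩
        · simp [Slice.above, Slice.below, ← h1, h2]
        · simp [Slice.above, Slice.below, h1, ← h2]
      · rw [OnDiagram.coord_point, OnDiagram.coord_point, nextCoord_above hc (by omega),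
          nextCoord_below hc hi]
        rcases hcases with ⟨h1, h2⟩ | ⟨h1, h2⟩
        · simp [Slice.above, Slice.below, ← h1, h2]
        · simp [Slice.above, Slice.below, h1, ← h2]
    have hmatch : ∀ t : State L, Matched (SameLoop t) ha2.point hb2.point a b := by
      intro t
      unfold Matched
      rw [hL.sameLoop_iff, hL.sameLoop_iff, hL.sameLoop_iff, hL.sameLoop_iff, ha, hb,
        OnDiagram.coord_point, OnDiagram.coord_point]
      by_cases ht : e = bits t k
      · exact .inl ⟨(Conn.of_arc hc (.hor_bottom ht)).symm, Conn.of_arc hc (.hor_top ht)⟩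
      · exact .inr ⟨Conn.of_arc hc (.vert_right ht), (Conn.of_arc hc (.vert_left ht)).symm⟩
    exact S.change (sameLoop_equivalence s) (sameLoop_equivalence s') (hmatch s) (hmatch s')

/-! ## Changing the slices in the middle of a diagram -/

/-- The coordinate `p` outside the changed part becomes `p'`. -/
def Outer (k r t : ℕ) (p p' : ℕ × ℕ) : Prop :=
  p'.2 = p.2 ∧ ((p.1 ≤ k ∧ p'.1 = p.1) ∨ (k + r ≤ p.1 ∧ p'.1 + r = p.1 + t))

theorem samePoint_iff {L L' : List Slice} {k r t : ℕ} {P : Point L} {P' : Point L'} :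
    SamePoint k r t P P' ↔ Outer k r t P.coord P'.coord := Iff.rfl

theorem Slice.Arc.shift {k : ℕ} {σ : Slice} {b : Bool} {p q : ℕ × ℕ} (h : σ.Arc k b p q)
    (k' : ℕ) : σ.Arc k' b (p.1 - k + k', p.2) (q.1 - k + k', q.2) := by
  have e1 : k - k + k' = k' := by omega
  have e2 : k + 1 - k + k' = k' + 1 := by omega
  cases h with
  | cup_left h => simp only [e1, e2]; exact .cup_left h
  | cup_right h => simp only [e1, e2]; exact .cup_right h
  | cup_turn => simp only [e2]; exact .cup_turn
  | cap_left h => simp only [e1, e2]; exact .cap_left h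
  | cap_right h => simp only [e1, e2]; exact .cap_right h
  | cap_turn => simp only [e1]; exact .cap_turn
  | away h h' => simp only [e1, e2]; exact .away h h'
  | vert_left h => simp only [e1, e2]; exact .vert_left h
  | vert_right h => simp only [e1, e2]; exact .vert_right h
  | hor_bottom h => simp only [e1]; exact .hor_bottom h
  | hor_top h => simp only [e2]; exact .hor_top h

theorem getElem?_left {A B : List Slice} {k : ℕ} (h : k < A.length) : (A ++ B)[k]? = A[k]? :=
  List.getElem?_append_left h

theorem getElem?_middle {A M B : List Slice} {k : ℕ} (h : k < M.length) :
    (A ++ (M ++ B))[A.length + k]? = M[k]? := by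
  rw [List.getElem?_append_right (by omega), Nat.add_sub_cancel_left,
    List.getElem?_append_left h]

theorem getElem?_right {A M B : List Slice} (k : ℕ) :
    (A ++ (M ++ B))[A.length + M.length + k]? = B[k]? := by
  rw [List.getElem?_append_right (by omega), List.getElem?_append_right (by omega)]
  congr 1
  omega

/-- Paths that use only what is outside a part that consists of parallel strands. -/
theorem conn_insert (A M B : List Slice) (β β' : ℕ → Bool) (hlow : ∀ m < A.length, β' m = β m)
    (hhigh : ∀ m, β' (A.length + M.length + m) = β (A.length + m)) (ρ : ℕ × ℕ → ℕ)
    (hρ : ∀ (m : ℕ) (σ : Slice) p q, M[m]? = some σ →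
      σ.Arc (A.length + m) (β' (A.length + m)) p q → ρ p = ρ q)
    (hρ0 : ∀ x, ρ (A.length, x) = x) (hρ1 : ∀ x, ρ (A.length + M.length, x) = x)
    (hthrough : ∀ x, Conn (A ++ (M ++ B)) β' (A.length, x) (A.length + M.length, x))
    {p q p' q' : ℕ × ℕ} (hp : Outer A.length 0 M.length p p')
    (hq : Outer A.length 0 M.length q q') :
    Conn (A ++ B) β p q ↔ Conn (A ++ (M ++ B)) β' p' q' := by
  set a := A.length with ha
  set t := M.length with ht
  have hE := conn_equivalence (A ++ B) β
  have hE' := conn_equivalence (A ++ (M ++ B)) β'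
  -- `up` skips the inserted part, `down` projects it to its lowest level by `ρ`. Level `a` of the
  -- smaller diagram corresponds to both the bottom and the top of `M`; these are reconciled by
  -- `hthrough`.
  let up : ℕ × ℕ → ℕ × ℕ := fun p => if p.1 ≤ a then p else (p.1 + t, p.2)
  let down : ℕ × ℕ → ℕ × ℕ := fun p =>
    if p.1 ≤ a then p else if p.1 < a + t then (a, ρ p) else (p.1 - t, p.2)
  have up_high : ∀ l x, a ≤ l → Conn (A ++ (M ++ B)) β' (up (l, x)) (l + t, x) := by
    intro l x hl
    by_cases h : l ≤ a
    · obtain rfl : l = a := le_antisymm h hl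
      simp only [up, le_refl, if_true]
      exact hthrough x
    · simp only [up, h, if_false]
      exact .refl _
  have down_high : ∀ l x, a + t ≤ l → down (l, x) = (l - t, x) := by
    intro l x hl
    by_cases h : l ≤ a
    · have : t = 0 := by omega
      simp only [down, h, if_true]
      rw [this]; simp
    · simp only [down, h, if_false]
      rw [if_neg (by omega)]
  have down_mid : ∀ l x, a ≤ l → l ≤ a + t → down (l, x) = (a, ρ (l, x)) := by
    intro l x hl hl'
    by_cases h : l ≤ a
    · obtain rfl : l = a := le_antisymm h hl
      simp only [down, le_refl, if_true]
      rw [hρ0]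
    · by_cases h' : l < a + t
      · simp only [down, h, if_false, if_pos h']
      · obtain rfl : l = a + t := by omega
        simp only [down, h, if_false]
        rw [if_neg (by omega), hρ1, Nat.add_sub_cancel]
  have hup : ∀ p q, Conn (A ++ B) β p q → Conn (A ++ (M ++ B)) β' (up p) (up q) := by
    intro p q h
    refine Conn.map hE' up (fun k σ p q hσ harc => ?_) h
    obtain ⟨hp, hq⟩ := harc.level
    by_cases hk : k < a
    · have e1 : up p = p := if_pos (by omega)
      have e2 : up q = q := if_pos (by omega)
      rw [e1, e2]
      rw [getElem?_left hk] at hσ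
      refine Conn.of_arc (k := k) (by rwa [getElem?_left hk]) ?_
      rwa [hlow k hk]
    · obtain ⟨m, rfl⟩ : ∃ m, k = a + m := ⟨k - a, by omega⟩
      rw [List.getElem?_append_right (by omega), Nat.add_sub_cancel_left] at hσ
      refine (up_high p.1 p.2 (by omega)).trans (.trans ?_ (up_high q.1 q.2 (by omega)).symm)
      have := harc.shift (a + t + m)
      have e1 : p.1 - (a + m) + (a + t + m) = p.1 + t := by omega
      have e2 : q.1 - (a + m) + (a + t + m) = q.1 + t := by omega
      rw [e1, e2, ← hhigh] at this
      exact Conn.of_arc ((getElem?_right m).trans hσ) this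
  have hdown : ∀ p q, Conn (A ++ (M ++ B)) β' p q → Conn (A ++ B) β (down p) (down q) := by
    intro p q h
    refine Conn.map hE down (fun k σ p q hσ harc => ?_) h
    obtain ⟨hp, hq⟩ := harc.level
    by_cases hk : k < a
    · have e1 : down p = p := if_pos (by omega)
      have e2 : down q = q := if_pos (by omega)
      rw [e1, e2]
      rw [getElem?_left hk] at hσ
      refine Conn.of_arc (k := k) (by rwa [getElem?_left hk]) ?_
      rwa [← hlow k hk]
    · by_cases hk' : k < a + t
      · obtain ⟨m, rfl⟩ : ∃ m, k = a + m := ⟨k - a, by omega⟩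
        rw [getElem?_middle (by omega)] at hσ
        have := hρ m σ p q hσ harc
        have e1 := down_mid p.1 p.2 (by omega) (by omega)
        have e2 := down_mid q.1 q.2 (by omega) (by omega)
        have e1 : down p = (a, ρ p) := e1
        have e2 : down q = (a, ρ q) := e2
        rw [e1, e2, this]
        exact .refl _
      · obtain ⟨m, rfl⟩ : ∃ m, k = a + t + m := ⟨k - a - t, by omega⟩
        rw [getElem?_right] at hσ
        have e1 : down p = (p.1 - t, p.2) := down_high p.1 p.2 (by omega)
        have e2 : down q = (q.1 - t, q.2) := down_high q.1 q.2 (by omega)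
        rw [e1, e2]
        have := harc.shift (a + m)
        have e1 : p.1 - (a + t + m) + (a + m) = p.1 - t := by omega
        have e2 : q.1 - (a + t + m) + (a + m) = q.1 - t := by omega
        rw [e1, e2, hhigh] at this
        refine Conn.of_arc (k := a + m) ?_ this
        rw [List.getElem?_append_right (by omega), ← ha, Nat.add_sub_cancel_left, hσ]
  have rel_up : ∀ p p', Outer a 0 t p p' → Conn (A ++ (M ++ B)) β' (up p) p' := by
    rintro ⟨l, x⟩ ⟨l', x'⟩ ⟨h1, h2⟩
    simp only at h1 h2
    subst h1
    rcases h2 with ⟨h2, rfl⟩ | ⟨h2, h3⟩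
    · have : up (l', x') = (l', x') := if_pos h2
      rw [this]; exact .refl _
    · obtain rfl : l' = l + t := by omega
      exact up_high l x' (by omega)
  have rel_down : ∀ p p', Outer a 0 t p p' → down p' = p := by
    rintro ⟨l, x⟩ ⟨l', x'⟩ ⟨h1, h2⟩
    simp only at h1 h2
    subst h1
    rcases h2 with ⟨h2, rfl⟩ | ⟨h2, h3⟩
    · exact if_pos h2
    · obtain rfl : l' = l + t := by omega
      rw [down_high _ _ (by omega), Nat.add_sub_cancel]
  constructor
  · exact fun h => (rel_up p p' hp).symm.trans ((hup p q h).trans (rel_up q q' hq))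
  · intro h
    have := hdown p' q' h
    rwa [rel_down p p' hp, rel_down q q' hq] at this

/-- A strand of a stack of crossings that are smoothed vertically. -/
theorem conn_vertical (A M B : List Slice) (β : ℕ → Bool)
    (hM : ∀ (m : ℕ) (σ : Slice), M[m]? = some σ → ∃ i e, σ = .cross i e ∧ e ≠ β (A.length + m))
    (x : ℕ) : ∀ m ≤ M.length, Conn (A ++ (M ++ B)) β (A.length, x) (A.length + m, x) := by
  intro m hm
  induction m with
  | zero => exact .refl _
  | succ m ih =>
    refine (ih (by omega)).trans ?_
    obtain ⟨i, e, h, he⟩ := hM m M[m] (List.getElem?_eq_getElem (by omega))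
    have hs : (A ++ (M ++ B))[A.length + m]? = some (.cross i e) := by
      rw [getElem?_middle (by omega), ← h]
      exact List.getElem?_eq_getElem (by omega)
    refine Conn.of_arc hs ?_
    by_cases h1 : x = i
    · subst h1; exact .vert_left he
    · by_cases h2 : x = i + 1
      · subst h2; exact .vert_right he
      · exact .away h1 h2

/-- A stack of crossings in which all strands run upwards after smoothing. -/
theorem conn_insert_vertical (A M B : List Slice) (β β' : ℕ → Bool)
    (hlow : ∀ m < A.length, β' m = β m)
    (hhigh : ∀ m, β' (A.length + M.length + m) = β (A.length + m))
    (hM : ∀ (m : ℕ) (σ : Slice), M[m]? = some σ →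
      ∃ i e, σ = .cross i e ∧ e ≠ β' (A.length + m))
    {p q p' q' : ℕ × ℕ} (hp : Outer A.length 0 M.length p p')
    (hq : Outer A.length 0 M.length q q') :
    Conn (A ++ B) β p q ↔ Conn (A ++ (M ++ B)) β' p' q' := by
  -- Vertical arcs keep the strand number, which therefore serves as the projection.
  refine conn_insert A M B β β' hlow hhigh Prod.snd ?_ (fun _ => rfl) (fun _ => rfl) ?_ hp hq
  · intro m σ p q hσ harc
    obtain ⟨i, e, rfl, he⟩ := hM m σ hσ
    cases harc with
    | hor_bottom h => exact absurd h he
    | hor_top h => exact absurd h he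
    | _ => rfl
  · intro x
    exact conn_vertical A M B β' hM x M.length le_rfl

/-! ## The edges of the cube -/

theorem IsLinkDiagram.onDiagram_lower {L : List Slice} (hL : IsLinkDiagram L) (c : Crossing L) :
    OnDiagram L (c.idx, (L[c.1]).pos) := by
  obtain ⟨i, e, h⟩ := getElem?_of_crossing c
  have hf : i + 2 ≤ width L c.idx := hL.fits h
  rw [pos_of_crossing h]
  exact ⟨c.1.2.le, by simp only [Slice.pos]; omega⟩

theorem IsLinkDiagram.onDiagram_upper {L : List Slice} (hL : IsLinkDiagram L) (c : Crossing L) :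
    OnDiagram L (c.idx + 1, (L[c.1]).pos + 1) := by
  obtain ⟨i, e, h⟩ := getElem?_of_crossing c
  have hf : i + 2 ≤ width L c.idx := hL.fits h
  have hw : width L (c.idx + 1) = width L c.idx := width_succ h
  rw [pos_of_crossing h]
  exact ⟨c.1.2, by simp only [Slice.pos]; omega⟩

/-- The lower left corner of a crossing. -/
def IsLinkDiagram.lower {L : List Slice} (hL : IsLinkDiagram L) (c : Crossing L) : Point L :=
  (hL.onDiagram_lower c).point

/-- The upper right corner of a crossing. -/
def IsLinkDiagram.upper {L : List Slice} (hL : IsLinkDiagram L) (c : Crossing L) : Point L :=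
  (hL.onDiagram_upper c).point

theorem IsLinkDiagram.coord_lower {L : List Slice} (hL : IsLinkDiagram L) {c : Crossing L} {i : ℕ}
    {e : Bool} (h : L[c.idx]? = some (.cross i e)) : (hL.lower c).coord = (c.idx, i) := by
  have := pos_of_crossing h
  unfold lower
  rw [OnDiagram.coord_point, this]
  rfl

theorem IsLinkDiagram.coord_upper {L : List Slice} (hL : IsLinkDiagram L) {c : Crossing L} {i : ℕ}
    {e : Bool} (h : L[c.idx]? = some (.cross i e)) :
    (hL.upper c).coord = (c.idx + 1, i + 1) := by
  have := pos_of_crossing h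
  unfold upper
  rw [OnDiagram.coord_point, this]
  rfl

/-- The state with a `1`-smoothing at `c`. -/
def flip {L : List Slice} (c : Crossing L) (s : State L) : State L := Function.update s c true

@[simp]
theorem flip_self {L : List Slice} (c : Crossing L) (s : State L) : flip c s c = true :=
  Function.update_self _ _ _

theorem flip_of_ne {L : List Slice} {c c' : Crossing L} (h : c' ≠ c) (s : State L) :
    flip c s c' = s c' :=
  Function.update_of_ne h _ _

theorem IsLinkDiagram.saddlePair_flip {L : List Slice} (hL : IsLinkDiagram L) {s : State L}
    {c : Crossing L} (hs : s c = false) :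
    SaddlePair (SameLoop s) (SameLoop (flip c s)) Eq (hL.lower c) (hL.upper c) (hL.lower c)
      (hL.upper c) := by
  obtain ⟨i, e, h⟩ := getElem?_of_crossing c
  exact hL.saddlePair h (fun c' hc' => flip_of_ne hc' s) (by simp [hs]) (hL.coord_lower h)
    (hL.coord_upper h)

theorem ofCoeff_congr {L L' : List Slice} {r r' : EState L → EState L' → Prop}
    {i : ∀ x y, Decidable (r x y)} {i' : ∀ x y, Decidable (r' x y)} (h : ∀ x y, r x y ↔ r' x y) :
    (ofCoeff fun x y => if r x y then 1 else 0) = ofCoeff fun x y => if r' x y then 1 else 0 := by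
  congr 1
  ext x y
  exact if_congr (h x y) rfl rfl

open Classical in
/-- The part of the differential that belongs to the crossing `c`, without its sign. -/
noncomputable def edgeMap {L : List Slice} (c : Crossing L) : Chain L →ₗ[ℚ] Chain L :=
  ofCoeff fun x y => if EdgeRel c x y then 1 else 0

theorem IsLinkDiagram.edgeRel_iff {L : List Slice} (hL : IsLinkDiagram L) (c : Crossing L)
    (x y : EState L) : EdgeRel c x y ↔ x.smoothing c = false ∧ y.smoothing = flip c x.smoothing ∧
      SaddleRule (SameLoop x.smoothing) Eq x.mark y.mark (hL.lower c) (hL.upper c) (hL.lower c)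
        (hL.upper c) := by
  unfold EdgeRel
  refine and_congr_right fun _ => and_congr_right fun _ => ⟨?_, fun h => ?_⟩
  · rintro ⟨a, b, ha, hb, h⟩
    obtain rfl : a = hL.lower c := Point.coord_injective ha
    obtain rfl : b = hL.upper c := Point.coord_injective hb
    exact h
  · exact ⟨_, _, rfl, rfl, h⟩

theorem IsLinkDiagram.edgeMap_eq {L : List Slice} (hL : IsLinkDiagram L) (c : Crossing L) :
    edgeMap c = saddleType (fun x => x.smoothing c = false) (flip c) Eq (hL.lower c) (hL.upper c)
      (hL.lower c) (hL.upper c) := by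
  exact ofCoeff_congr (hL.edgeRel_iff c)

theorem IsLinkDiagram.edgeMap_intertwines {L : List Slice} (hL : IsLinkDiagram L) (c : Crossing L)
    (P : Point L) : Intertwines (edgeMap c) P P := by
  rw [hL.edgeMap_eq c]
  exact saddleType_intertwines (fun x hx => hL.saddlePair_flip hx) rfl fun _ _ => Iff.rfl

theorem edgeMap_of_true {L : List Slice} {c : Crossing L} {x : EState L}
    (h : x.smoothing c = true) : edgeMap c (gen x) = 0 := by
  classical
  unfold edgeMap
  rw [ofCoeff_gen]
  ext y
  rw [if_neg]
  · rfl
  · rintro ⟨h', -⟩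
    rw [h] at h'
    exact Bool.noConfusion h'

/-- The chain is a combination of enhanced states that belong to the state `s`. -/
def SupportedOn {L : List Slice} (s : State L) (φ : Chain L) : Prop :=
  ∀ y, φ y ≠ 0 → y.smoothing = s

theorem chain_eq_sum {L : List Slice} (φ : Chain L) : φ = ∑ y, φ y • gen y := by
  classical
  ext z
  rw [Finset.sum_apply, Finset.sum_eq_single z]
  · rw [Pi.smul_apply, gen_apply, if_pos rfl, smul_eq_mul, mul_one]
  · intro y _ hy
    rw [Pi.smul_apply, gen_apply, if_neg (Ne.symm hy), smul_zero]
  · simp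

/-- Two linear maps agree on a chain if they agree on the enhanced states of its state. -/
theorem SupportedOn.ext {L : List Slice} {W : Type} [AddCommGroup W] [Module ℚ W] {s : State L}
    {φ : Chain L} (hφ : SupportedOn s φ) {F G : Chain L →ₗ[ℚ] W}
    (h : ∀ x, x.smoothing = s → F (gen x) = G (gen x)) : F φ = G φ := by
  rw [chain_eq_sum φ, map_sum, map_sum]
  refine Finset.sum_congr rfl fun y _ => ?_
  rw [map_smul, map_smul]
  by_cases hy : φ y = 0
  · rw [hy, zero_smul, zero_smul]
  · rw [h y (hφ y hy)]

theorem supportedOn_edgeMap {L : List Slice} (c : Crossing L) (x : EState L) :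
    SupportedOn (flip c x.smoothing) (edgeMap c (gen x)) := by
  classical
  intro y hy
  unfold edgeMap at hy
  rw [ofCoeff_gen] at hy
  split_ifs at hy with h
  · exact h.2.1
  · exact absurd rfl hy

/-- The sign of an edge. -/
def signAt {L : List Slice} (c : Crossing L) (s : State L) : ℚ :=
  (-1) ^ (Finset.univ.filter fun c' : Crossing L => c' < c ∧ s c' = true).card

theorem differential_gen {L : List Slice} (x : EState L) :
    differential L (gen x) = ∑ c, signAt c x.smoothing • edgeMap c (gen x) := by
  classical
  unfold differential
  rw [ofCoeff_gen]
  ext y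
  rw [Finset.sum_apply]
  refine Finset.sum_congr rfl fun c _ => ?_
  unfold edgeMap
  rw [ofCoeff_gen, Pi.smul_apply, smul_eq_mul, mul_ite, mul_one, mul_zero]
  rfl

theorem SupportedOn.differential_eq {L : List Slice} {s : State L} {φ : Chain L}
    (hφ : SupportedOn s φ) : differential L φ = ∑ c, signAt c s • edgeMap c φ := by
  have := hφ.ext (F := differential L) (G := ∑ c, signAt c s • edgeMap c) fun x hx => by
    rw [differential_gen, hx, LinearMap.sum_apply]
    rfl
  rw [this, LinearMap.sum_apply]
  rfl

/-- A criterion for chain maps.  The crossings of `L'` correspond to some crossings of `L`; the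
contributions of the other crossings of `L` have to cancel. -/
theorem isChainMap_of_edges {L L' : List Slice} {F f : Chain L →ₗ[ℚ] Chain L'}
    (g : State L → State L') (sgn : State L → ℚ) (ι : Crossing L' → Crossing L)
    (hι : Function.Injective ι)
    (hF : ∀ x, F (gen x) = sgn x.smoothing • f (gen x))
    (hsupp : ∀ x, SupportedOn (g x.smoothing) (f (gen x)))
    (hcomm : ∀ c' x, f (edgeMap (ι c') (gen x)) = edgeMap c' (f (gen x)))
    (hsgn : ∀ c' x, f (gen x) ≠ 0 → x.smoothing (ι c') = false →
      signAt (ι c') x.smoothing * sgn (flip (ι c') x.smoothing) =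
        sgn x.smoothing * signAt c' (g x.smoothing))
    (hrest : ∀ x, ∑ c ∈ Finset.univ.filter (fun c => c ∉ Set.range ι),
      (signAt c x.smoothing * sgn (flip c x.smoothing)) • f (edgeMap c (gen x)) = 0) :
    IsChainMap F := by
  classical
  have key : F ∘ₗ differential L = differential L' ∘ₗ F := by
    refine chain_ext fun x => ?_
    rw [LinearMap.comp_apply, LinearMap.comp_apply, differential_gen, map_sum, hF, map_smul,
      (hsupp x).differential_eq, Finset.smul_sum]
    have e1 : ∀ c, F (signAt c x.smoothing • edgeMap c (gen x)) =
        (signAt c x.smoothing * sgn (flip c x.smoothing)) • f (edgeMap c (gen x)) := by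
      intro c
      rw [map_smul, (supportedOn_edgeMap c x).ext (F := F) (G := sgn (flip c x.smoothing) • f)
        fun y hy => by rw [hF, hy]; rfl, mul_smul]
      rfl
    -- The crossings of `L` that come from `L'` are matched with the edges of `L'`; the
    -- contributions of all others add up to zero by `hrest`.
    rw [Finset.sum_congr rfl fun c _ => e1 c,
      ← Finset.sum_filter_add_sum_filter_not Finset.univ (fun c => c ∈ Set.range ι)]
    have hrest := hrest x
    rw [hrest, add_zero]
    have e2 : Finset.univ.filter (fun c => c ∈ Set.range ι) = Finset.univ.image ι := by
      ext c; simp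
    rw [e2, Finset.sum_image fun _ _ _ _ h => hι h]
    refine Finset.sum_congr rfl fun c' _ => ?_
    rw [smul_smul]
    by_cases hx : x.smoothing (ι c') = true
    · have := hcomm c' x
      rw [edgeMap_of_true hx, map_zero] at this
      rw [edgeMap_of_true hx, ← this, map_zero, smul_zero, smul_zero]
    · rw [hcomm]
      -- Signs have to agree only where the map does not vanish; the sign rules of the Reidemeister
      -- moves hold only there.
      by_cases h0 : f (gen x) = 0
      · rw [h0, map_zero, smul_zero, smul_zero]
      · rw [hsgn c' x h0 (by simpa using hx)]
  exact fun z => LinearMap.congr_fun key z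

/-! ## Saddles commute -/

open Classical in
/-- The factor `v₋ ⊗ 1 + 1 ⊗ v₋` of a splitting. -/
noncomputable def splitFactor {L : List Slice} (p : Prop) (a b : Point L) (φ : Chain L) :
    Chain L :=
  if p then xOp a φ + xOp b φ else φ

theorem splitFactor_pos {L : List Slice} {p : Prop} (h : p) (a b : Point L) (φ : Chain L) :
    splitFactor p a b φ = xOp a φ + xOp b φ := if_pos h

theorem splitFactor_neg {L : List Slice} {p : Prop} (h : ¬ p) (a b : Point L) (φ : Chain L) :
    splitFactor p a b φ = φ := if_neg h

theorem Intertwines.splitFactor {L L' : List Slice} {F : Chain L →ₗ[ℚ] Chain L'}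
    {a b : Point L} {a' b' : Point L'} (ha : Intertwines F a a') (hb : Intertwines F b b')
    (p : Prop) (φ : Chain L) : F (splitFactor p a b φ) = splitFactor p a' b' (F φ) := by
  by_cases h : p
  · rw [splitFactor_pos h, splitFactor_pos h, map_add, ha, hb]
  · rw [splitFactor_neg h, splitFactor_neg h]

theorem xOp_intertwines {L : List Slice} (P Q : Point L) : Intertwines (xOp P) Q Q :=
  fun φ => xOp_comm P Q φ

theorem saddleType_plus {L L' : List Slice} {K : EState L → Prop} {f : State L → State L'}
    {same : Point L → Point L' → Prop} {a b : Point L} {a' b' : Point L'} {x : EState L} (hx : K x)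
    (S : SaddlePair (SameLoop x.smoothing) (SameLoop (f x.smoothing)) same a b a' b')
    (hm : ∀ P P', same P P' → x.mark P = .plus) (ha : x.mark a = .plus) (hb : x.mark b = .plus) :
    saddleType K f same a b a' b' (gen x) =
      splitFactor (SameLoop x.smoothing a b) a' b' (gen (EState.plus (f x.smoothing))) := by
  by_cases hab : SameLoop x.smoothing a b
  · rw [splitFactor_pos hab, saddleType_gen hx S hm ha hab]
  · rw [splitFactor_neg hab, saddleType_gen_of_not hx S hm ha hb hab]

theorem IsLinkDiagram.edgeMap_plus {L : List Slice} (hL : IsLinkDiagram L) {s : State L}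
    {c : Crossing L} (hs : s c = false) :
    edgeMap c (gen (EState.plus s)) = splitFactor (SameLoop s (hL.lower c) (hL.upper c))
      (hL.lower c) (hL.upper c) (gen (EState.plus (flip c s))) := by
  rw [hL.edgeMap_eq c]
  exact saddleType_plus (x := EState.plus s) hs (hL.saddlePair_flip hs) (fun _ _ _ => rfl) rfl rfl

theorem xOp_plus_congr {L : List Slice} {s : State L} {P Q : Point L} (h : SameLoop s P Q) :
    xOp P (gen (EState.plus s)) = xOp Q (gen (EState.plus s)) :=
  xOp_gen_congr (x := EState.plus s) h

theorem add_xOp_of_matched {L : List Slice} {s : State L} {a b c d : Point L}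
    (h : Matched (SameLoop s) a b c d) :
    xOp a (gen (EState.plus s)) + xOp b (gen (EState.plus s)) =
      xOp c (gen (EState.plus s)) + xOp d (gen (EState.plus s)) := by
  rcases h with ⟨h, h'⟩ | ⟨h, h'⟩
  · rw [xOp_plus_congr h, xOp_plus_congr h']
  · rw [xOp_plus_congr h, xOp_plus_congr h', add_comm]

/-- Two saddles commute. -/
theorem splitFactor_square {L L' : List Slice} {s00 s01 : State L} {s10 s11 : State L'}
    {same : Point L → Point L' → Prop} {a b c d : Point L} {a' b' c' d' : Point L'}
    (S1 : SaddlePair (SameLoop s00) (SameLoop s10) same a b a' b')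
    (S1' : SaddlePair (SameLoop s01) (SameLoop s11) same a b a' b')
    (S2 : SaddlePair (SameLoop s00) (SameLoop s01) Eq c d c d)
    (S2' : SaddlePair (SameLoop s10) (SameLoop s11) Eq c' d' c' d')
    (hc : same c c') (hd : same d d') :
    splitFactor (SameLoop s00 c d) c' d'
        (splitFactor (SameLoop s01 a b) a' b' (gen (EState.plus s11))) =
      splitFactor (SameLoop s00 a b) a' b'
        (splitFactor (SameLoop s10 c' d') c' d' (gen (EState.plus s11))) := by
  obtain ⟨h1, h2, h3, h4, h5, h6⟩ := saddle_square (sameLoop_equivalence s00)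
    (sameLoop_equivalence s01) (sameLoop_equivalence s10) (sameLoop_equivalence s11) S1 S1' S2 S2'
    hc hd
  -- With two splits the factors commute, and with two merges there are none. If `a, b` splits and
  -- `c', d'` merges afterwards, then in the other order either both saddles exchange types and all
  -- four points end on one loop, so both factors are twice the same operator, or the types stay and
  -- the factors are identical. If `a, b` merges and `c', d'` splits, the factors are identical or
  -- belong to the same two loops.
  by_cases hA : SameLoop s00 a b <;> by_cases hD : SameLoop s10 c' d'
  · obtain ⟨hC, hB⟩ := h2 hA hD
    rw [splitFactor_pos hA, splitFactor_pos hD, splitFactor_pos hC, splitFactor_pos hB]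
    simp only [map_add]
    rw [xOp_comm c' a', xOp_comm d' a', xOp_comm c' b', xOp_comm d' b']
    abel
  · by_cases hC : SameLoop s00 c d
    · obtain ⟨hB, k1, k2, k3⟩ := h4 hA hD hC
      rw [splitFactor_pos hA, splitFactor_neg hD, splitFactor_pos hC, splitFactor_neg hB]
      exact add_xOp_of_matched (.inl ⟨(sameLoop_equivalence _).symm k1,
        (sameLoop_equivalence _).symm ((sameLoop_equivalence _).trans k2 k3)⟩)
    · have hB := h6 hA hD hC
      rw [splitFactor_pos hA, splitFactor_neg hD, splitFactor_neg hC, splitFactor_pos hB]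
  · by_cases hC : SameLoop s00 c d
    · have hB := h5 hA hD hC
      rw [splitFactor_neg hA, splitFactor_pos hD, splitFactor_pos hC, splitFactor_neg hB]
    · obtain ⟨hB, k⟩ := h3 hA hD hC
      rw [splitFactor_neg hA, splitFactor_pos hD, splitFactor_neg hC, splitFactor_pos hB]
      exact add_xOp_of_matched k
  · obtain ⟨hC, hB⟩ := h1 hA hD
    rw [splitFactor_neg hA, splitFactor_neg hD, splitFactor_neg hC, splitFactor_neg hB]

/-- A saddle, applied to a chain `u` with all marks `v₊` away from a small loop, commutes with the
edges of the cube away from it. -/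
theorem comm_edgeMap_of_saddle {L L' : List Slice} (hL : IsLinkDiagram L) (hL' : IsLinkDiagram L')
    {f : Chain L →ₗ[ℚ] Chain L'} {g : State L → State L'} {same : Point L → Point L' → Prop}
    {a b : Point L} {a' b' : Point L'} {u : Chain L →ₗ[ℚ] Chain L}
    {c : Crossing L} {c' : Crossing L'} {s : State L} (hs : s c = false) (hs' : g s c' = false)
    (hg : g (flip c s) = flip c' (g s))
    (hf : ∀ P P', same P P' → Intertwines f P P') (hu : ∀ P, Intertwines u P P)
    (huc : ∀ φ, edgeMap c (u φ) = u (edgeMap c φ))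
    (S : ∀ t, t = s ∨ t = flip c s → SaddlePair (SameLoop t) (SameLoop (g t)) same a b a' b')
    (hplus : ∀ t, t = s ∨ t = flip c s → f (u (gen (EState.plus t))) =
      splitFactor (SameLoop t a b) a' b' (gen (EState.plus (g t))))
    (hlow : same (hL.lower c) (hL'.lower c')) (hupp : same (hL.upper c) (hL'.upper c')) :
    f (edgeMap c (u (gen (EState.plus s)))) = edgeMap c' (f (u (gen (EState.plus s)))) := by
  have S1' := S _ (.inr rfl)
  rw [hg] at S1'
  -- The operator `u` is the identity or the multiplication at a small loop that `f` erases. Both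
  -- ways around the square become products of split factors applied to the same state with all
  -- marks `v₊`.
  rw [huc, hL.edgeMap_plus hs, (hu _).splitFactor (hu _), (hf _ _ hlow).splitFactor (hf _ _ hupp),
    hplus _ (.inr rfl), hplus _ (.inl rfl),
    (hL'.edgeMap_intertwines c' _).splitFactor (hL'.edgeMap_intertwines c' _),
    hL'.edgeMap_plus hs', hg]
  exact splitFactor_square (S _ (.inl rfl)) S1' (hL.saddlePair_flip hs) (hL'.saddlePair_flip hs')
    hlow hupp

/-- The same for a map that keeps the marks. -/
theorem comm_edgeMap_of_keep {L L' : List Slice} (hL : IsLinkDiagram L) (hL' : IsLinkDiagram L')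
    {f : Chain L →ₗ[ℚ] Chain L'} {g : State L → State L'} {same : Point L → Point L' → Prop}
    {u : Chain L →ₗ[ℚ] Chain L}
    {c : Crossing L} {c' : Crossing L'} {s : State L} (hs : s c = false) (hs' : g s c' = false)
    (hg : g (flip c s) = flip c' (g s))
    (hf : ∀ P P', same P P' → Intertwines f P P') (hu : ∀ P, Intertwines u P P)
    (huc : ∀ φ, edgeMap c (u φ) = u (edgeMap c φ))
    (S : ∀ P Q P' Q', same P P' → same Q Q' → (SameLoop s P Q ↔ SameLoop (g s) P' Q'))
    (hplus : ∀ t, t = s ∨ t = flip c s → f (u (gen (EState.plus t))) = gen (EState.plus (g t)))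
    (hlow : same (hL.lower c) (hL'.lower c')) (hupp : same (hL.upper c) (hL'.upper c')) :
    f (edgeMap c (u (gen (EState.plus s)))) = edgeMap c' (f (u (gen (EState.plus s)))) := by
  have S1 := S _ _ _ _ hlow hupp
  rw [huc, hL.edgeMap_plus hs, (hu _).splitFactor (hu _), (hf _ _ hlow).splitFactor (hf _ _ hupp),
    hplus _ (.inr rfl), hplus _ (.inl rfl), hL'.edgeMap_plus hs', hg, propext S1]

/-! ## Correspondence of crossings under a local change -/

theorem Outer.symm {k r t : ℕ} {p p' : ℕ × ℕ} (h : Outer k r t p p') : Outer k t r p' p := by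
  obtain ⟨h1, h2⟩ := h
  refine ⟨h1.symm, ?_⟩
  omega

section Change

variable {A M M' B : List Slice}

theorem getElem?_change_low {m : ℕ} (h : m < A.length) :
    (A ++ (M' ++ B))[m]? = (A ++ (M ++ B))[m]? := by
  rw [getElem?_left h, getElem?_left h]

theorem getElem?_change_high (m : ℕ) :
    (A ++ (M' ++ B))[A.length + M'.length + m]? = (A ++ (M ++ B))[A.length + M.length + m]? := by
  rw [getElem?_right, getElem?_right]

theorem SameCrossing.getElem?_eq {c : Crossing (A ++ (M ++ B))} {c' : Crossing (A ++ (M' ++ B))}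
    (h : SameCrossing A.length M.length M'.length c c') :
    (A ++ (M' ++ B))[c'.idx]? = (A ++ (M ++ B))[c.idx]? := by
  rcases h with ⟨h1, h2⟩ | ⟨h1, h2⟩
  · rw [h2]; exact getElem?_change_low h1
  · obtain ⟨m, hm⟩ : ∃ m, c.idx = A.length + M.length + m := ⟨_, (Nat.add_sub_cancel' h1).symm⟩
    have hm' : c'.idx = A.length + M'.length + m := by omega
    rw [hm, hm']
    exact getElem?_change_high m

theorem exists_sameCrossing {c' : Crossing (A ++ (M' ++ B))}
    (h : c'.idx < A.length ∨ A.length + M'.length ≤ c'.idx) :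
    ∃ c : Crossing (A ++ (M ++ B)), SameCrossing A.length M.length M'.length c c' := by
  obtain ⟨i, e, hc⟩ := getElem?_of_crossing c'
  rcases h with h | h
  · rw [getElem?_change_low (M := M) h] at hc
    exact ⟨crossingAt hc, .inl ⟨h, rfl⟩⟩
  · obtain ⟨m, hm⟩ : ∃ m, c'.idx = A.length + M'.length + m := ⟨_, (Nat.add_sub_cancel' h).symm⟩
    rw [hm, getElem?_change_high (M := M)] at hc
    exact ⟨crossingAt hc, .inr ⟨by simp, by simp; omega⟩⟩

theorem bits_eq_bits {L L' : List Slice} {s : State L} {s' : State L'} {m n : ℕ}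
    (h : L'[m]? = L[n]?)
    (hs : ∀ (c : Crossing L) (c' : Crossing L'), c.idx = n → c'.idx = m → s' c' = s c) :
    bits s' m = bits s n := by
  unfold bits smoothingAt
  by_cases h1 : m < L'.length
  · have h2 : n < L.length := by
      rw [List.getElem?_eq_getElem h1] at h
      exact (List.getElem?_eq_some_iff.1 h.symm).1
    rw [dif_pos h1, dif_pos h2]
    rw [List.getElem?_eq_getElem h1, List.getElem?_eq_getElem h2, Option.some.injEq] at h
    by_cases h3 : (L[n]).isCross = true
    · have h4 : (L'[m]).isCross = true := by rw [h]; exact h3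
      have h3' : (L[(⟨n, h2⟩ : Fin L.length)]).isCross = true := h3
      have h4' : (L'[(⟨m, h1⟩ : Fin L'.length)]).isCross = true := h4
      rw [dif_pos h3', dif_pos h4']
      exact hs _ _ rfl rfl
    · have h4 : ¬ (L'[m]).isCross = true := by rw [h]; exact h3
      have h3' : ¬ (L[(⟨n, h2⟩ : Fin L.length)]).isCross = true := h3
      have h4' : ¬ (L'[(⟨m, h1⟩ : Fin L'.length)]).isCross = true := h4
      rw [dif_neg h3', dif_neg h4']
  · have h2 : ¬ n < L.length := by
      intro h2
      rw [List.getElem?_eq_getElem h2] at h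
      exact h1 (List.getElem?_eq_some_iff.1 h).1
    rw [dif_neg h1, dif_neg h2]

theorem SameSmoothing.bits_low {s : State (A ++ (M ++ B))} {s' : State (A ++ (M' ++ B))}
    (h : SameSmoothing A.length M.length M'.length s s') {m : ℕ} (hm : m < A.length) :
    bits s' m = bits s m :=
  bits_eq_bits (getElem?_change_low hm) fun c c' hc hc' =>
    h c c' (.inl ⟨by omega, by omega⟩)

theorem SameSmoothing.bits_high {s : State (A ++ (M ++ B))} {s' : State (A ++ (M' ++ B))}
    (h : SameSmoothing A.length M.length M'.length s s') (m : ℕ) :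
    bits s' (A.length + M'.length + m) = bits s (A.length + M.length + m) :=
  bits_eq_bits (getElem?_change_high m) fun c c' hc hc' =>
    h c c' (.inr ⟨by omega, by omega⟩)

theorem SameCrossing.samePoint_lower (hL : IsLinkDiagram (A ++ (M ++ B)))
    (hL' : IsLinkDiagram (A ++ (M' ++ B))) {c : Crossing (A ++ (M ++ B))}
    {c' : Crossing (A ++ (M' ++ B))} (h : SameCrossing A.length M.length M'.length c c') :
    SamePoint A.length M.length M'.length (hL.lower c) (hL'.lower c') := by
  obtain ⟨i, e, hc⟩ := getElem?_of_crossing c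
  have hc' := h.getElem?_eq.trans hc
  rw [samePoint_iff, hL.coord_lower hc, hL'.coord_lower hc']
  refine ⟨rfl, ?_⟩
  unfold SameCrossing at h
  simp only
  omega

theorem SameCrossing.samePoint_upper (hL : IsLinkDiagram (A ++ (M ++ B)))
    (hL' : IsLinkDiagram (A ++ (M' ++ B))) {c : Crossing (A ++ (M ++ B))}
    {c' : Crossing (A ++ (M' ++ B))} (h : SameCrossing A.length M.length M'.length c c') :
    SamePoint A.length M.length M'.length (hL.upper c) (hL'.upper c') := by
  obtain ⟨i, e, hc⟩ := getElem?_of_crossing c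
  have hc' := h.getElem?_eq.trans hc
  rw [samePoint_iff, hL.coord_upper hc, hL'.coord_upper hc']
  refine ⟨rfl, ?_⟩
  unfold SameCrossing at h
  simp only
  omega

/-- The width at a level outside the changed part. -/
theorem width_change (hw : outWidth M (width A A.length) = outWidth M' (width A A.length))
    (m : ℕ) : width (A ++ (M ++ B)) (A.length + M.length + m) =
      width (A ++ (M' ++ B)) (A.length + M'.length + m) := by
  have key : ∀ N : List Slice, width (A ++ (N ++ B)) (A.length + N.length + m) =
      outWidth (B.take m) (outWidth N (width A A.length)) := by
    intro N
    rw [width_eq_outWidth, ← List.append_assoc, ← List.length_append, List.take_length_add_append,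
      outWidth_append, outWidth_append, width_eq_outWidth, List.take_length]
  rw [key, key, hw]

theorem width_append_of_le {L N : List Slice} {m : ℕ} (h : m ≤ L.length) :
    width (L ++ N) m = width L m := by
  rw [width_eq_outWidth, width_eq_outWidth, List.take_append_of_le_length h]

/-- The point of the changed diagram with a given coordinate outside the changed part. -/
theorem onDiagram_of_outer (hw : outWidth M (width A A.length) = outWidth M' (width A A.length))
    {p p' : ℕ × ℕ} (h : Outer A.length M.length M'.length p p')
    (hp : OnDiagram (A ++ (M ++ B)) p) : OnDiagram (A ++ (M' ++ B)) p' := by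
  obtain ⟨l, x⟩ := p
  obtain ⟨l', x'⟩ := p'
  obtain ⟨h1, h2⟩ := h
  obtain ⟨h3, h4⟩ := hp
  simp only at h1 h2 h3 h4
  subst h1
  simp only [List.length_append] at h3
  rcases h2 with ⟨h2, rfl⟩ | ⟨h2, h5⟩
  · refine ⟨by simp only [List.length_append]; omega, ?_⟩
    rw [width_append_of_le h2] at h4 ⊢
    exact h4
  · obtain ⟨m, rfl⟩ : ∃ m, l = A.length + M.length + m := ⟨_, (Nat.add_sub_cancel' h2).symm⟩
    obtain rfl : l' = A.length + M'.length + m := by omega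
    refine ⟨by simp only [List.length_append]; omega, ?_⟩
    rw [width_change hw] at h4
    exact h4

end Change

theorem Crossing.lt_iff {L : List Slice} {c c' : Crossing L} : c < c' ↔ c.idx < c'.idx := Iff.rfl

/-- The sign of an edge and the crossings that do not belong to the smaller diagram. -/
theorem signAt_comp {L L' : List Slice} {ι : Crossing L' → Crossing L} (hι : StrictMono ι)
    (c' : Crossing L') (s : State L) [DecidablePred fun c => c ∈ Set.range ι] :
    signAt (ι c') s = signAt c' (s ∘ ι) * (-1) ^ (Finset.univ.filter fun c : Crossing L =>
      c ∉ Set.range ι ∧ c < ι c' ∧ s c = true).card := by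
  classical
  unfold signAt
  rw [← pow_add]
  congr 1
  rw [← Finset.card_filter_add_card_filter_not (p := fun c => c ∈ Set.range ι)]
  congr 1
  · rw [← Finset.card_image_of_injective _ hι.injective]
    congr 1
    ext c
    simp only [Finset.mem_filter, Finset.mem_univ, true_and, Finset.mem_image, Set.mem_range,
      Function.comp]
    constructor
    · rintro ⟨⟨h1, h2⟩, d, rfl⟩
      exact ⟨d, ⟨hι.lt_iff_lt.1 h1, h2⟩, rfl⟩
    · rintro ⟨d, ⟨h1, h2⟩, rfl⟩
      exact ⟨⟨hι.lt_iff_lt.2 h1, h2⟩, d, rfl⟩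
  · congr 1
    ext c
    simp only [Finset.mem_filter, Finset.mem_univ, true_and]
    tauto

/-- Commutation with an edge has to be checked only if all outer points are marked by `v₊`. -/
theorem comm_edgeMap_outer {L L' : List Slice} (hL : IsLinkDiagram L) (hL' : IsLinkDiagram L')
    {f : Chain L →ₗ[ℚ] Chain L'} {g : State L → State L'} {same : Point L → Point L' → Prop}
    {u : Chain L →ₗ[ℚ] Chain L} {c : Crossing L} {c' : Crossing L'} (Ks : State L → Prop)
    (hf : ∀ P P', same P P' → Intertwines f P P')
    (hsupp : ∀ x, SupportedOn (g x.smoothing) (f (gen x)))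
    (hg : ∀ s, g s c' = s c)
    (hKs : ∀ s, Ks (flip c s) ↔ Ks s)
    (h0 : ∀ x, ¬ Ks x.smoothing → f (gen x) = 0)
    (hlow : same (hL.lower c) (hL'.lower c')) (hupp : same (hL.upper c) (hL'.upper c'))
    -- With outer marks `v₊` only the mark of a small loop is open: either it is the one produced by
    -- `u`, or it is `v₊` and the map is zero.
    (hbase : ∀ x : EState L, Ks x.smoothing → (∀ P P', same P P' → x.mark P = .plus) →
      gen x = u (gen (EState.plus x.smoothing)) ∨
        (x = EState.plus x.smoothing ∧ ∀ t, Ks t → f (gen (EState.plus t)) = 0))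
    (hmain : ∀ s, Ks s → s c = false → f (edgeMap c (u (gen (EState.plus s)))) =
      edgeMap c' (f (u (gen (EState.plus s))))) (x : EState L) :
    f (edgeMap c (gen x)) = edgeMap c' (f (gen x)) := by
  by_cases hx : x.smoothing c = true
  · rw [edgeMap_of_true hx, map_zero]
    symm
    have := (hsupp x).ext (F := edgeMap c') (G := 0) fun y hy => by
      rw [edgeMap_of_true (by rw [hy, hg, hx])]; rfl
    rw [this]; rfl
  have hx : x.smoothing c = false := by simpa using hx
  by_cases hK : Ks x.smoothing
  · refine eq_of_intertwines (F := f ∘ₗ edgeMap c) (G := edgeMap c' ∘ₗ f)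
      (fun P => ∃ P', same P P') ?_ x.smoothing ?_ x rfl
    · rintro P ⟨P', hP⟩
      exact ⟨P', (hf P P' hP).comp (hL.edgeMap_intertwines c P),
        (hL'.edgeMap_intertwines c' P').comp (hf P P' hP)⟩
    · intro y hy hp
      rw [LinearMap.comp_apply, LinearMap.comp_apply]
      rcases hbase y (hy ▸ hK) (fun P P' h => hp P ⟨P', h⟩) with h | ⟨h, h'⟩
      · rw [h, hy]
        exact hmain _ hK hx
      · rw [h, h' _ (hy ▸ hK), map_zero, hL.edgeMap_plus (hy ▸ hx),
          (hf _ _ hlow).splitFactor (hf _ _ hupp), h' _ ((hKs _).2 (hy ▸ hK))]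
        unfold splitFactor
        simp
  · rw [h0 x hK, map_zero]
    have := (supportedOn_edgeMap c x).ext (F := f) (G := 0) fun y hy => by
      rw [h0 y (by rw [hy, hKs]; exact hK)]; rfl
    rw [this]; rfl

/-- Only the loop through `z` can avoid the points of `O`, so its mark is the only freedom left. -/
theorem gen_eq_plus_or {L : List Slice} {x : EState L} {O : Point L → Prop} {z : Point L}
    (hO : ∀ P, O P → x.mark P = .plus)
    (hcover : ∀ P, SameLoop x.smoothing z P ∨ ∃ Q, O Q ∧ SameLoop x.smoothing Q P) :
    gen x = xOp z (gen (EState.plus x.smoothing)) ∨ x = EState.plus x.smoothing := by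
  have hp : ∀ P, ¬ SameLoop x.smoothing z P → x.mark P = .plus := by
    intro P hP
    rcases hcover P with h | ⟨Q, hQ, h⟩
    · exact absurd h hP
    · rw [← x.mark_eq h, hO Q hQ]
  rcases hm : x.mark z with _ | _
  · right
    refine EState.ext rfl (funext fun P => ?_)
    by_cases h : SameLoop x.smoothing z P
    · rw [← x.mark_eq h, hm]; rfl
    · rw [hp P h]; rfl
  · left
    rw [xOp_gen_of_plus rfl]
    congr 1
    refine EState.ext rfl (funext fun P => ?_)
    by_cases h : SameLoop x.smoothing z P
    · rw [← x.mark_eq h, hm, EState.set_mark_of_rel _ (by exact h)]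
    · rw [hp P h, EState.set_mark_of_not _ (by exact h)]
      rfl

theorem eq_plus {L : List Slice} {x : EState L} {O : Point L → Prop}
    (hO : ∀ P, O P → x.mark P = .plus)
    (hcover : ∀ P, ∃ Q, O Q ∧ SameLoop x.smoothing Q P) : x = EState.plus x.smoothing := by
  refine EState.ext rfl (funext fun P => ?_)
  obtain ⟨Q, hQ, h⟩ := hcover P
  rw [← x.mark_eq h, hO Q hQ]
  rfl

theorem supportedOn_saddleType {L L' : List Slice} {K : EState L → Prop} {f : State L → State L'}
    {same : Point L → Point L' → Prop} {a b : Point L} {a' b' : Point L'} (x : EState L) :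
    SupportedOn (f x.smoothing) (saddleType K f same a b a' b' (gen x)) := by
  intro y hy
  unfold saddleType at hy
  rw [ofCoeff_gen] at hy
  split_ifs at hy with h
  · exact h.2.1
  · exact absurd rfl hy

theorem supportedOn_keepType {L L' : List Slice} {K : EState L → Prop} {f : State L → State L'}
    {same : Point L → Point L' → Prop} (x : EState L) :
    SupportedOn (f x.smoothing) (keepType K f same (gen x)) := by
  intro y hy
  unfold keepType at hy
  rw [ofCoeff_gen] at hy
  split_ifs at hy with h
  · exact h.2.1
  · exact absurd rfl hy

/-! ## The positive kink -/

/-- A positive kink in the strand `i`. -/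
def kink (i : ℕ) : List Slice := [.cup (i + 1), .cross i true, .cap (i + 1)]

section Kink

variable (A B : List Slice) (i : ℕ)

theorem getElem?_kink_cup : (A ++ (kink i ++ B))[A.length]? = some (.cup (i + 1)) :=
  getElem?_middle (k := 0) (M := kink i) (by simp [kink])

theorem getElem?_kink_cross : (A ++ (kink i ++ B))[A.length + 1]? = some (.cross i true) :=
  getElem?_middle (k := 1) (M := kink i) (by simp [kink])

theorem getElem?_kink_cap : (A ++ (kink i ++ B))[A.length + 2]? = some (.cap (i + 1)) :=
  getElem?_middle (k := 2) (M := kink i) (by simp [kink])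

variable {A B i} {β : ℕ → Bool}

theorem kink_conn_z1 : Conn (A ++ (kink i ++ B)) β (A.length + 1, i + 2) (A.length + 1, i + 1) :=
  (Conn.of_arc (getElem?_kink_cup A B i) .cup_turn).symm

theorem kink_conn_z2 : Conn (A ++ (kink i ++ B)) β (A.length + 1, i + 2) (A.length + 2, i + 2) :=
  Conn.of_arc (getElem?_kink_cross A B i) (.away (by omega) (by omega))

theorem kink_conn_z3 : Conn (A ++ (kink i ++ B)) β (A.length + 1, i + 2) (A.length + 2, i + 1) :=
  kink_conn_z2.trans (Conn.of_arc (getElem?_kink_cap A B i) .cap_turn).symm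

theorem kink_conn_low_left {x : ℕ} (h : x < i + 1) :
    Conn (A ++ (kink i ++ B)) β (A.length, x) (A.length + 1, x) :=
  Conn.of_arc (getElem?_kink_cup A B i) (.cup_left h)

theorem kink_conn_low_right {x : ℕ} (h : i + 1 ≤ x) :
    Conn (A ++ (kink i ++ B)) β (A.length, x) (A.length + 1, x + 2) :=
  Conn.of_arc (getElem?_kink_cup A B i) (.cup_right h)

theorem kink_conn_high_left {x : ℕ} (h : x < i + 1) :
    Conn (A ++ (kink i ++ B)) β (A.length + 2, x) (A.length + 3, x) :=
  Conn.of_arc (getElem?_kink_cap A B i) (.cap_left h)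

theorem kink_conn_high_right {x : ℕ} (h : i + 1 ≤ x) :
    Conn (A ++ (kink i ++ B)) β (A.length + 2, x + 2) (A.length + 3, x) :=
  Conn.of_arc (getElem?_kink_cap A B i) (.cap_right h)

/-- With a `1`-smoothing the strand turns back at the crossing but then runs around the small arc,
so the kink is passed for either smoothing. -/
theorem kink_conn_mid_left : Conn (A ++ (kink i ++ B)) β (A.length + 1, i) (A.length + 2, i) := by
  by_cases h : true = β (A.length + 1)
  · refine (Conn.of_arc (getElem?_kink_cross A B i) (.hor_bottom h)).trans
      (kink_conn_z1.symm.trans (kink_conn_z3.trans ?_))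
    exact (Conn.of_arc (getElem?_kink_cross A B i) (.hor_top h)).symm
  · exact Conn.of_arc (getElem?_kink_cross A B i) (.vert_left h)

theorem kink_conn_through (x : ℕ) : Conn (A ++ (kink i ++ B)) β (A.length, x) (A.length + 3, x) := by
  by_cases h : x < i + 1
  · refine (kink_conn_low_left h).trans (.trans ?_ (kink_conn_high_left h))
    by_cases hx : x = i
    · subst hx; exact kink_conn_mid_left
    · exact Conn.of_arc (getElem?_kink_cross A B i) (.away hx (by omega))
  · refine (kink_conn_low_right (by omega)).trans (.trans ?_ (kink_conn_high_right (by omega)))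
    exact Conn.of_arc (getElem?_kink_cross A B i) (.away (by omega) (by omega))

/-- Every point of the kink is connected to a point outside or to the small arc. -/
theorem kink_conn_cases (p : ℕ × ℕ) (h1 : A.length < p.1) (h2 : p.1 < A.length + 3) :
    Conn (A ++ (kink i ++ B)) β (A.length + 1, i + 2) p ∨ ∃ x, Conn (A ++ (kink i ++ B)) β (A.length, x) p := by
  obtain ⟨l, x⟩ := p
  simp only at h1 h2
  by_cases hx : x < i + 1
  · right
    refine ⟨x, ?_⟩
    by_cases hl : l = A.length + 1
    · subst hl; exact kink_conn_low_left hx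
    · obtain rfl : l = A.length + 2 := by omega
      exact (kink_conn_through x).trans (kink_conn_high_left hx).symm
  · by_cases hx2 : i + 3 ≤ x
    · right
      obtain ⟨y, rfl⟩ : ∃ y, x = y + 2 := ⟨x - 2, by omega⟩
      refine ⟨y, ?_⟩
      by_cases hl : l = A.length + 1
      · subst hl; exact kink_conn_low_right (by omega)
      · obtain rfl : l = A.length + 2 := by omega
        exact (kink_conn_through y).trans (kink_conn_high_right (by omega)).symm
    · left
      by_cases hl : l = A.length + 1
      · subst hl
        by_cases hx3 : x = i + 1
        · subst hx3; exact kink_conn_z1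
        · obtain rfl : x = i + 2 := by omega
          exact .refl _
      · obtain rfl : l = A.length + 2 := by omega
        by_cases hx3 : x = i + 1
        · subst hx3; exact kink_conn_z3
        · obtain rfl : x = i + 2 := by omega
          exact kink_conn_z2

/-- If the crossing of the kink is `0`-smoothed, the small loop has only four points. -/
theorem kink_isolated (hβ : β (A.length + 1) = false) {q : ℕ × ℕ}
    (h : Conn (A ++ (kink i ++ B)) β (A.length + 1, i + 2) q) :
    (q.1 = A.length + 1 ∨ q.1 = A.length + 2) ∧ (q.2 = i + 1 ∨ q.2 = i + 2) := by
  have key := Conn.map (E := fun P Q : Prop => P ↔ Q) ⟨fun _ => .rfl, Iff.symm, Iff.trans⟩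
    (fun q => (q.1 = A.length + 1 ∨ q.1 = A.length + 2) ∧ (q.2 = i + 1 ∨ q.2 = i + 2)) ?_ h
  · exact key.1 ⟨.inl rfl, .inr rfl⟩
  · intro k σ p q hσ harc
    obtain ⟨hp, hq⟩ := harc.level
    by_cases h0 : k = A.length
    · subst h0
      rw [getElem?_kink_cup, Option.some.injEq] at hσ
      subst hσ
      cases harc <;> simp only [true_and, true_or, or_true] <;> omega
    · by_cases h1 : k = A.length + 1
      · subst h1
        rw [getElem?_kink_cross, Option.some.injEq] at hσ
        subst hσ
        rw [hβ] at harc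
        cases harc with
        | hor_bottom h => exact absurd h (by decide)
        | hor_top h => exact absurd h (by decide)
        | _ => simp only [true_or, or_true]
      · by_cases h2 : k = A.length + 2
        · subst h2
          rw [getElem?_kink_cap, Option.some.injEq] at hσ
          subst hσ
          cases harc <;> simp only [true_and, true_or, or_true] <;> omega
        · omega

/-- The strand at the bottom that leads to a point of the kink. -/
def kinkFoot (a i : ℕ) (b : Bool) (p : ℕ × ℕ) : ℕ :=
  if p.1 = a + 1 ∨ p.1 = a + 2 then
    -- With a `0`-smoothing the strands `i + 1` and `i + 2` close up to the small loop, which leads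
    -- nowhere; the value `i + 1` is then an arbitrary constant.
    if p.2 < i + 1 then p.2 else if p.2 < i + 3 then (if b then i else i + 1) else p.2 - 2
  else p.2

/-- No condition on the smoothing of the kink is needed: the small arc is either a separate loop or
a detour of strand `i`, and the outer connections are the same in both cases. -/
theorem kink_conn_iff {β' : ℕ → Bool} (hlow : ∀ m < A.length, β' m = β m)
    (hhigh : ∀ m, β' (A.length + 3 + m) = β (A.length + m)) {p q p' q' : ℕ × ℕ}
    (hp : Outer A.length 0 3 p p') (hq : Outer A.length 0 3 q q') :
    Conn (A ++ B) β p q ↔ Conn (A ++ (kink i ++ B)) β' p' q' := by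
  refine conn_insert A (kink i) B β β' hlow hhigh (kinkFoot A.length i (β' (A.length + 1))) ?_
    ?_ ?_ kink_conn_through hp hq
  · intro m σ p q hσ harc
    have hm : m = 0 ∨ m = 1 ∨ m = 2 := by
      have := (List.getElem?_eq_some_iff.1 hσ).1
      simp only [kink, List.length_cons, List.length_nil] at this
      omega
    rcases hm with rfl | rfl | rfl
    · simp only [kink, List.getElem?_cons_zero, Option.some.injEq] at hσ
      subst hσ
      cases harc <;> simp only [kinkFoot, true_or, if_true] <;> split_ifs <;> omega
    · simp only [kink, List.getElem?_cons_zero, List.getElem?_cons_succ, Option.some.injEq] at hσ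
      subst hσ
      generalize hb : β' (A.length + 1) = b at harc ⊢
      cases harc with
      | hor_bottom h => subst h; simp only [kinkFoot, true_or, if_true]; split_ifs <;> omega
      | hor_top h => subst h; simp only [kinkFoot, or_true, if_true]; split_ifs <;> omega
      | vert_left h => simp only [kinkFoot, true_or, or_true, if_true]
      | vert_right h => simp only [kinkFoot, true_or, or_true, if_true]
      | away h h' => simp only [kinkFoot, true_or, or_true, if_true]
    · simp only [kink, List.getElem?_cons_zero, List.getElem?_cons_succ, Option.some.injEq] at hσ
      subst hσ
      cases harc <;> simp only [kinkFoot, or_true, if_true] <;> split_ifs <;> omega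
  · intro x; simp [kinkFoot]
  · intro x; simp [kinkFoot, kink]

end Kink

/-! ## Removing slices -/

section Removal

variable {A M B : List Slice}

theorem exists_crossing_of_removal (c' : Crossing (A ++ B)) :
    ∃ c : Crossing (A ++ (M ++ B)), SameCrossing A.length M.length 0 c c' :=
  exists_sameCrossing (M' := []) (by simp only [List.length_nil]; omega)

variable (A M B) in
/-- The crossing of the larger diagram. -/
noncomputable def liftCrossing (c' : Crossing (A ++ B)) : Crossing (A ++ (M ++ B)) :=
  (exists_crossing_of_removal c').choose

theorem liftCrossing_spec (c' : Crossing (A ++ B)) :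
    SameCrossing A.length M.length 0 (liftCrossing A M B c') c' :=
  (exists_crossing_of_removal c').choose_spec

theorem liftCrossing_strictMono : StrictMono (liftCrossing A M B) := by
  intro c c' h
  rw [Crossing.lt_iff] at h ⊢
  have h1 := liftCrossing_spec (M := M) c
  have h2 := liftCrossing_spec (M := M) c'
  unfold SameCrossing at h1 h2
  omega

theorem eq_liftCrossing {c : Crossing (A ++ (M ++ B))} {c' : Crossing (A ++ B)}
    (h : SameCrossing A.length M.length 0 c c') : c = liftCrossing A M B c' := by
  refine Crossing.ext_idx ?_
  have h1 := liftCrossing_spec (M := M) c'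
  unfold SameCrossing at h h1
  omega

theorem mem_range_liftCrossing (c : Crossing (A ++ (M ++ B))) :
    c ∈ Set.range (liftCrossing A M B) ↔ c.idx < A.length ∨ A.length + M.length ≤ c.idx := by
  constructor
  · rintro ⟨c', rfl⟩
    have := liftCrossing_spec (M := M) c'
    unfold SameCrossing at this
    omega
  · intro h
    obtain ⟨c', hc'⟩ := exists_sameCrossing (A := A) (M := []) (M' := M) (B := B) (c' := c) h
    refine ⟨c', (eq_liftCrossing ?_).symm⟩
    unfold SameCrossing at hc' ⊢
    simp only [List.length_nil] at hc'
    omega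

theorem sameSmoothing_removal_iff {s : State (A ++ (M ++ B))} {s' : State (A ++ B)} :
    SameSmoothing A.length M.length 0 s s' ↔ s' = s ∘ liftCrossing A M B := by
  constructor
  · intro h
    ext c'
    exact h _ _ (liftCrossing_spec c')
  · rintro rfl c c' h
    rw [Function.comp, eq_liftCrossing h]

theorem flip_comp_liftCrossing (c' : Crossing (A ++ B)) (s : State (A ++ (M ++ B))) :
    flip (liftCrossing A M B c') s ∘ liftCrossing A M B =
      flip c' (s ∘ liftCrossing A M B) := by
  ext d
  by_cases h : d = c'
  · subst h; simp
  · rw [Function.comp, flip_of_ne h, flip_of_ne fun h' => h (liftCrossing_strictMono.injective h')]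
    rfl

theorem exists_samePoint_of_removal (hw : outWidth M (width A A.length) = width A A.length)
    (P' : Point (A ++ B)) : ∃ P : Point (A ++ (M ++ B)), SamePoint A.length M.length 0 P P' := by
  by_cases h : P'.coord.1 ≤ A.length
  · have : Outer A.length 0 M.length P'.coord P'.coord := ⟨rfl, .inl ⟨h, rfl⟩⟩
    have hP := onDiagram_of_outer (M := []) (M' := M) (B := B) hw.symm this P'.onDiagram
    exact ⟨hP.point, this.symm⟩
  · have : Outer A.length 0 M.length P'.coord (P'.coord.1 + M.length, P'.coord.2) :=
      ⟨rfl, .inr ⟨by omega, rfl⟩⟩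
    have hP := onDiagram_of_outer (M := []) (M' := M) (B := B) hw.symm this P'.onDiagram
    exact ⟨hP.point, this.symm⟩

theorem exists_samePoint_of_outer (hw : outWidth M (width A A.length) = width A A.length)
    (P : Point (A ++ (M ++ B))) (h : P.coord.1 ≤ A.length ∨ A.length + M.length ≤ P.coord.1) :
    ∃ P' : Point (A ++ B), SamePoint A.length M.length 0 P P' := by
  rcases h with h | h
  · have : Outer A.length M.length 0 P.coord P.coord := ⟨rfl, .inl ⟨h, rfl⟩⟩
    have hP := onDiagram_of_outer (M := M) (M' := []) (B := B) hw this P.onDiagram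
    exact ⟨hP.point, this⟩
  · have : Outer A.length M.length 0 P.coord (P.coord.1 - M.length, P.coord.2) :=
      ⟨rfl, .inr ⟨h, by simp only; omega⟩⟩
    have hP := onDiagram_of_outer (M := M) (M' := []) (B := B) hw this P.onDiagram
    exact ⟨hP.point, this⟩

theorem SamePoint.level {L L' : List Slice} {k r t : ℕ} {P : Point L} {P' : Point L'}
    (h : SamePoint k r t P P') : P.coord.1 ≤ k ∨ k + r ≤ P.coord.1 := by
  unfold SamePoint at h
  omega

theorem bits_removal_low (s : State (A ++ (M ++ B))) {m : ℕ} (hm : m < A.length) :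
    bits s m = bits (s ∘ liftCrossing A M B) m :=
  (SameSmoothing.bits_low (M := M) (M' := []) (sameSmoothing_removal_iff.2 rfl) hm).symm

theorem bits_removal_high (s : State (A ++ (M ++ B))) (m : ℕ) :
    bits s (A.length + M.length + m) = bits (s ∘ liftCrossing A M B) (A.length + m) :=
  (SameSmoothing.bits_high (M := M) (M' := []) (sameSmoothing_removal_iff.2 rfl) m).symm

end Removal

/-! ## The first Reidemeister move -/

section KinkDiagram

variable {A B : List Slice} {i : ℕ}

theorem kink_width (hL : IsLinkDiagram (A ++ (kink i ++ B))) :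
    outWidth (kink i) (width A A.length) = width A A.length ∧ i + 1 ≤ width A A.length := by
  have h1 := hL.fits (getElem?_kink_cup A B i)
  rw [width_append_of_le le_rfl] at h1
  refine ⟨by simp [kink, Slice.out], ?_⟩
  exact h1

theorem kink_onDiagram (hL : IsLinkDiagram (A ++ (kink i ++ B))) : OnDiagram (A ++ (kink i ++ B)) (A.length + 1, i + 2) := by
  have h2 := width_succ (getElem?_kink_cup A B i)
  have h3 := (kink_width hL).2
  rw [width_append_of_le le_rfl] at h2
  simp only [Slice.out] at h2
  exact ⟨by simp [kink], by simp only; omega⟩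

/-- The point of the small arc of the kink. -/
def kinkPoint (hL : IsLinkDiagram (A ++ (kink i ++ B))) : Point (A ++ (kink i ++ B)) := (kink_onDiagram hL).point

/-- The crossing of the kink. -/
def kinkCrossing (A B : List Slice) (i : ℕ) : Crossing (A ++ (kink i ++ B)) := crossingAt (getElem?_kink_cross A B i)

theorem kinkCrossing_idx : (kinkCrossing A B i).idx = A.length + 1 := rfl

theorem kink_idx (c : Crossing (A ++ (kink i ++ B)))
    (hc : ¬ (c.idx < A.length ∨ A.length + 3 ≤ c.idx)) : c.idx = A.length + 1 := by
  obtain ⟨j, e, hj⟩ := getElem?_of_crossing c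
  by_contra hne
  by_cases h0 : c.idx = A.length
  · rw [h0, getElem?_kink_cup] at hj
    simp at hj
  · have : c.idx = A.length + 2 := by omega
    rw [this, getElem?_kink_cap] at hj
    simp at hj

theorem kink_sameLoop_iff (hL : IsLinkDiagram (A ++ (kink i ++ B))) (hL' : IsLinkDiagram (A ++ B)) (s : State (A ++ (kink i ++ B)))
    {P Q : Point (A ++ (kink i ++ B))} {P' Q' : Point (A ++ B)} (hP : SamePoint A.length 3 0 P P')
    (hQ : SamePoint A.length 3 0 Q Q') :
    SameLoop s P Q ↔ SameLoop (s ∘ liftCrossing A (kink i) B) P' Q' := by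
  rw [hL.sameLoop_iff, hL'.sameLoop_iff]
  exact (kink_conn_iff (fun m hm => bits_removal_low s hm) (fun m => bits_removal_high s m)
    (Outer.symm hP) (Outer.symm hQ)).symm

theorem kink_not_sameLoop (hL : IsLinkDiagram (A ++ (kink i ++ B))) {s : State (A ++ (kink i ++ B))}
    (hs : s (kinkCrossing A B i) = false) {P : Point (A ++ (kink i ++ B))}
    (hP : P.coord.1 ≤ A.length ∨ A.length + 3 ≤ P.coord.1) : ¬ SameLoop s (kinkPoint hL) P := by
  rw [hL.sameLoop_iff]
  intro h
  have := (kink_isolated ((bits_crossing s (kinkCrossing A B i)).trans hs) h).1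
  omega

theorem kink_cover (hL : IsLinkDiagram (A ++ (kink i ++ B))) (s : State (A ++ (kink i ++ B))) (P : Point (A ++ (kink i ++ B))) :
    SameLoop s (kinkPoint hL) P ∨
      ∃ Q : Point (A ++ (kink i ++ B)), (Q.coord.1 ≤ A.length ∨ A.length + 3 ≤ Q.coord.1) ∧ SameLoop s Q P := by
  by_cases h : P.coord.1 ≤ A.length ∨ A.length + 3 ≤ P.coord.1
  · exact .inr ⟨P, h, .refl _⟩
  · rcases kink_conn_cases (A := A) (β := bits s) (B := B) (i := i) P.coord (by omega) (by omega) with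
      h' | ⟨x, h'⟩
    · exact .inl ((hL.sameLoop_iff s _ _).2 h')
    · have hx := (hL.onDiagram_conn h').2 P.onDiagram
      exact .inr ⟨hx.point, .inl le_rfl, (hL.sameLoop_iff s _ _).2 h'⟩

/-- The map of the first Reidemeister move in the form of a map that keeps marks. -/
theorem rIMap_eq (hL : IsLinkDiagram (A ++ (kink i ++ B))) :
    rIMap (A ++ (kink i ++ B)) (A ++ B) A.length i = keepType
      (fun x => x.smoothing (kinkCrossing A B i) = false ∧ x.mark (kinkPoint hL) = .minus)
      (· ∘ liftCrossing A (kink i) B) (SamePoint A.length 3 0) := by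
  refine ofCoeff_congr fun x y => ?_
  unfold RIRel SameMark
  have h1 : SameSmoothing A.length 3 0 x.smoothing y.smoothing ↔
      y.smoothing = x.smoothing ∘ liftCrossing A (kink i) B :=
    sameSmoothing_removal_iff (M := kink i)
  rw [h1]
  constructor
  · rintro ⟨h1, h2, h3, h4⟩
    exact ⟨⟨h2 _ rfl, h3 _ rfl⟩, h1, h4⟩
  · rintro ⟨⟨h2, h3⟩, h1, h4⟩
    refine ⟨h1, fun c hc => ?_, fun P hP => ?_, h4⟩
    · rw [← h2]; congr 1; exact Crossing.ext_idx hc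
    · rw [← h3]; congr 1; exact Point.coord_injective hP

/-- The small loop contains no outer point, so the condition that it is marked by `v₋` is
insensitive to the mark at `P`. -/
theorem rIMap_intertwines (hL : IsLinkDiagram (A ++ (kink i ++ B))) (hL' : IsLinkDiagram (A ++ B)) {P : Point (A ++ (kink i ++ B))}
    {P' : Point (A ++ B)} (hP : SamePoint A.length 3 0 P P') :
    Intertwines (rIMap (A ++ (kink i ++ B)) (A ++ B) A.length i) P P' := by
  rw [rIMap_eq hL]
  refine keepType_intertwines (fun x _ P Q P' Q' hP hQ => kink_sameLoop_iff hL hL' _ hP hQ) hP ?_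
  intro x v
  refine and_congr_right fun hx => ?_
  rw [EState.set_mark_of_not]
  intro h
  exact kink_not_sameLoop hL hx hP.level ((sameLoop_equivalence _).symm h)

theorem rIMap_of_plus (hL : IsLinkDiagram (A ++ (kink i ++ B))) {x : EState (A ++ (kink i ++ B))}
    (h : x.mark (kinkPoint hL) = .plus) : rIMap (A ++ (kink i ++ B)) (A ++ B) A.length i (gen x) = 0 := by
  rw [rIMap_eq hL]
  refine keepType_of_not fun h' => ?_
  rw [h] at h'
  exact Mark.noConfusion h'.2

theorem rIMap_of_true (hL : IsLinkDiagram (A ++ (kink i ++ B))) {x : EState (A ++ (kink i ++ B))}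
    (h : ¬ x.smoothing (kinkCrossing A B i) = false) :
    rIMap (A ++ (kink i ++ B)) (A ++ B) A.length i (gen x) = 0 := by
  rw [rIMap_eq hL]
  exact keepType_of_not fun h' => h h'.1

theorem rIMap_xOp_plus (hL : IsLinkDiagram (A ++ (kink i ++ B))) {s : State (A ++ (kink i ++ B))}
    (hs : s (kinkCrossing A B i) = false) :
    rIMap (A ++ (kink i ++ B)) (A ++ B) A.length i (xOp (kinkPoint hL) (gen (EState.plus s))) =
      gen (EState.plus (s ∘ liftCrossing A (kink i) B)) := by
  rw [xOp_gen_of_plus rfl, rIMap_eq hL]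
  refine keepType_gen ⟨hs, EState.set_mark_self _ _ _⟩ (fun P' => ?_) rfl ?_
  · obtain ⟨P, hP⟩ := exists_samePoint_of_removal (M := kink i) (kink_width hL).1 P'
    exact ⟨P, P', hP, .refl _⟩
  · intro P P' hP
    rw [EState.set_mark_of_not _ (by exact kink_not_sameLoop hL hs hP.level)]
    rfl

/-- The edge at the crossing of the kink ends in states that the map kills, and the other edges do
not touch the erased loop. The signs agree because the lost crossing is `0`-smoothed wherever the
map is nonzero. -/
theorem rIMap_isChainMap (hL : IsLinkDiagram (A ++ (kink i ++ B))) (hL' : IsLinkDiagram (A ++ B)) :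
    IsChainMap (rIMap (A ++ (kink i ++ B)) (A ++ B) A.length i) := by
  classical
  have hrange : ∀ c : Crossing (A ++ (kink i ++ B)), c ∉ Set.range (liftCrossing A (kink i) B) →
      c = kinkCrossing A B i := by
    intro c hc
    rw [mem_range_liftCrossing] at hc
    exact Crossing.ext_idx (kink_idx c hc)
  refine isChainMap_of_edges (f := rIMap (A ++ (kink i ++ B)) (A ++ B) A.length i) (· ∘ liftCrossing A (kink i) B)
    (fun _ => 1) (liftCrossing A (kink i) B) liftCrossing_strictMono.injective ?_ ?_ ?_ ?_ ?_
  · intro x; rw [one_smul]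
  · intro x
    rw [rIMap_eq hL]
    exact supportedOn_keepType x
  · intro c' x
    have hc := liftCrossing_spec (M := kink i) c'
    have hne : kinkCrossing A B i ≠ liftCrossing A (kink i) B c' := by
      intro h
      have h1 := (mem_range_liftCrossing (M := kink i) (kinkCrossing A B i)).1 ⟨c', h.symm⟩
      rw [kinkCrossing_idx] at h1
      have hlen : (kink i).length = 3 := rfl
      omega
    have hflip : ∀ s : State (A ++ (kink i ++ B)), flip (liftCrossing A (kink i) B c') s (kinkCrossing A B i) =
        s (kinkCrossing A B i) := fun s => flip_of_ne hne s
    have hlow := hc.samePoint_lower (M' := []) hL hL'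
    have hupp := hc.samePoint_upper (M' := []) hL hL'
    refine comm_edgeMap_outer hL hL' (same := SamePoint A.length 3 0)
      (g := (· ∘ liftCrossing A (kink i) B)) (u := xOp (kinkPoint hL))
      (fun s => s (kinkCrossing A B i) = false) (fun P P' hP => rIMap_intertwines hL hL' hP) ?_
      (fun s => rfl) (fun s => by rw [hflip]) (fun x hx => rIMap_of_true hL hx) hlow hupp ?_ ?_ x
    · intro x
      rw [rIMap_eq hL]
      exact supportedOn_keepType x
    · intro x hx hO
      have hO' : ∀ P : Point (A ++ (kink i ++ B)),
          (P.coord.1 ≤ A.length ∨ A.length + 3 ≤ P.coord.1) → x.mark P = .plus := by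
        intro P hP
        obtain ⟨P', hP'⟩ := exists_samePoint_of_outer (M := kink i) (kink_width hL).1 P hP
        exact hO P P' hP'
      rcases gen_eq_plus_or hO' (kink_cover hL x.smoothing) with h | h
      · exact .inl h
      -- A small loop marked by `v₊` is sent to zero before and after the edge.
      · exact .inr ⟨h, fun t _ => rIMap_of_plus hL rfl⟩
    · intro s hs hsc
      refine comm_edgeMap_of_keep hL hL' (g := (· ∘ liftCrossing A (kink i) B))
        (same := SamePoint A.length 3 0) hsc hsc (flip_comp_liftCrossing c' s)
        (fun P P' hP => rIMap_intertwines hL hL' hP) (fun P => xOp_intertwines _ P)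
        (fun φ => hL.edgeMap_intertwines _ _ φ)
        (fun P Q P' Q' hP hQ => kink_sameLoop_iff hL hL' _ hP hQ) ?_ hlow hupp
      rintro t (rfl | rfl)
      · exact rIMap_xOp_plus hL hs
      · exact rIMap_xOp_plus hL (by rw [hflip, hs])
  · intro c' x hx _
    rw [signAt_comp liftCrossing_strictMono, mul_one, one_mul]
    have hK : x.smoothing (kinkCrossing A B i) = false := by
      by_contra h
      exact hx (rIMap_of_true hL h)
    rw [Finset.card_eq_zero.2, pow_zero, mul_one]
    rw [Finset.filter_eq_empty_iff]
    rintro c - ⟨h1, -, h3⟩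
    rw [hrange c h1, hK] at h3
    exact Bool.noConfusion h3
  · intro x
    refine Finset.sum_eq_zero fun c hc => ?_
    obtain rfl := hrange c (Finset.mem_filter.1 hc).2
    have := (supportedOn_edgeMap (kinkCrossing A B i) x).ext
      (F := rIMap (A ++ (kink i ++ B)) (A ++ B) A.length i) (G := 0) fun y hy => by
        rw [rIMap_of_true hL (by rw [hy, flip_self]; exact Bool.noConfusion)]; rfl
    rw [this, LinearMap.zero_apply, smul_zero]

end KinkDiagram

/-! ## Inserting vertically smoothed crossings -/

section Vertical

variable {A M B : List Slice}

/-- The slices are crossings, and they are smoothed vertically. -/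
def VerticalAt (k : ℕ) (M : List Slice) (β : ℕ → Bool) : Prop :=
  ∀ (m : ℕ) (σ : Slice), M[m]? = some σ → ∃ i e, σ = .cross i e ∧ e ≠ β (k + m)

theorem VerticalAt.sameLoop_iff (hL : IsLinkDiagram (A ++ (M ++ B))) (hN : IsLinkDiagram (A ++ B))
    {s : State (A ++ (M ++ B))} (hM : VerticalAt A.length M (bits s))
    {P Q : Point (A ++ (M ++ B))} {P' Q' : Point (A ++ B)}
    (hP : SamePoint A.length M.length 0 P P') (hQ : SamePoint A.length M.length 0 Q Q') :
    SameLoop s P Q ↔ SameLoop (s ∘ liftCrossing A M B) P' Q' := by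
  rw [hL.sameLoop_iff, hN.sameLoop_iff]
  exact (conn_insert_vertical A M B _ _ (fun m hm => bits_removal_low s hm)
    (fun m => bits_removal_high s m) hM (Outer.symm hP) (Outer.symm hQ)).symm

theorem VerticalAt.cover (hL : IsLinkDiagram (A ++ (M ++ B))) {s : State (A ++ (M ++ B))}
    (hM : VerticalAt A.length M (bits s)) (P : Point (A ++ (M ++ B))) :
    ∃ Q : Point (A ++ (M ++ B)), (Q.coord.1 ≤ A.length ∨ A.length + M.length ≤ Q.coord.1) ∧
      SameLoop s Q P := by
  by_cases h : P.coord.1 ≤ A.length ∨ A.length + M.length ≤ P.coord.1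
  · exact ⟨P, h, .refl _⟩
  · have hc := conn_vertical A M B (bits s) hM P.coord.2 (P.coord.1 - A.length) (by omega)
    have he : (A.length + (P.coord.1 - A.length), P.coord.2) = P.coord :=
      Prod.ext (by simp only; omega) rfl
    rw [he] at hc
    have hx := (hL.onDiagram_conn hc).2 P.onDiagram
    exact ⟨hx.point, .inl le_rfl, (hL.sameLoop_iff s _ _).2 hc⟩

theorem outWidth_crossings (hM : ∀ σ ∈ M, σ.isCross = true) (w : ℕ) : outWidth M w = w := by
  induction M with
  | nil => rfl
  | cons σ M ih =>
    rw [outWidth_cons]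
    cases σ with
    | cross i e => exact ih fun τ hτ => hM τ (List.mem_cons_of_mem _ hτ)
    | cup i => exact absurd (hM _ List.mem_cons_self) (by simp [Slice.isCross])
    | cap i => exact absurd (hM _ List.mem_cons_self) (by simp [Slice.isCross])

end Vertical

/-! ## Two kinds of saddles -/

section SaddleKinds

variable {P P' : Type} {R R0 : P → P → Prop} {R' : P' → P' → Prop} {same : P → P' → Prop}
  {a b a0 : P} {a' b' a0' : P'}

/-- A saddle that cuts off a new loop. -/
theorem SaddlePair.of_birth (hR : Equivalence R) (hR' : Equivalence R') (hab : R a b)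
    (haa' : same a a') (hiso : ∀ p p', same p p' → ¬ R' p' b')
    (hiff : ∀ p q p' q', same p p' → same q q' → (R p q ↔ R' p' q'))
    (hcover : ∀ p', R' b' p' ∨ ∃ p q', same p q' ∧ R' q' p') :
    SaddlePair R R' same a b a' b' := by
  have hb : ∀ p, R p b → R p a := fun p h => hR.trans h (hR.symm hab)
  refine ⟨iff_of_true hab (hiso _ _ haa'), ?_, ?_, ?_⟩
  · intro p q p' q' hp hq
    unfold Joined
    have h1 := hiff _ _ _ _ hp hq
    have h2 := hiff _ _ _ _ hp haa'
    have h3 := hiff _ _ _ _ hq haa'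
    have h4 := hiso _ _ hp
    have h5 := hiso _ _ hq
    have h6 := hb p
    have h7 := hb q
    tauto
  · intro p p' hp
    have h2 := hiff _ _ _ _ hp haa'
    have h4 := hiso _ _ hp
    have h6 := hb p
    tauto
  · intro p'
    rcases hcover p' with h | h
    · exact .inr (.inl (hR'.symm h))
    · exact .inr (.inr h)

/-- A saddle that goes back to the state before another saddle. -/
theorem SaddlePair.of_return (hR : Equivalence R) (hR0 : Equivalence R0) (hR' : Equivalence R')
    (S : SaddlePair R0 R Eq a0 b a0 b) (haa0 : R a a0) (hab0 : R0 a b)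
    (haa' : same a a') (ha0 : same a0 a0') (hb' : R' b' a0')
    (hiff : ∀ p q p' q', same p p' → same q q' → (R0 p q ↔ R' p' q'))
    (hcover : ∀ p', R' b' p' ∨ ∃ p q', same p q' ∧ R' q' p') :
    SaddlePair R R' same a b a' b' := by
  -- Everything is expressed through `R` and `R0` at the points `a0, b`; the claims are then those
  -- of `S` read backwards.
  have h1 : ∀ p, R p a ↔ R p a0 := fun p =>
    ⟨fun h => hR.trans h haa0, fun h => hR.trans h (hR.symm haa0)⟩
  have h2 : ∀ p, R0 p b ↔ R0 p a := fun p =>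
    ⟨fun h => hR0.trans h (hR0.symm hab0), fun h => hR0.trans h hab0⟩
  have h3 : ∀ p', R' p' b' ↔ R' p' a0' := fun p' =>
    ⟨fun h => hR'.trans h hb', fun h => hR'.trans h (hR'.symm hb')⟩
  have htouch : ∀ p p', same p p' → ((R p a ∨ R p b) ↔ (R' p' a' ∨ R' p' b')) := by
    intro p p' hp
    have e1 := S.touch p p rfl
    rw [h1, h3, ← hiff _ _ _ _ hp haa', ← hiff _ _ _ _ hp ha0]
    rw [h2] at e1
    tauto
  refine ⟨?_, ?_, htouch, ?_⟩
  · have e1 : R a b ↔ R a0 b :=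
      ⟨fun h => hR.trans (hR.symm haa0) h, fun h => hR.trans haa0 h⟩
    have e2 : R' a' b' ↔ R0 a0 b := by
      rw [h3, ← hiff _ _ _ _ haa' ha0, h2]
      exact ⟨hR0.symm, hR0.symm⟩
    have e3 := S.xor
    rw [e1, e2]
    tauto
  · intro p q p' q' hp hq
    have e1 := S.join p q p q rfl rfl
    have e2 := hiff _ _ _ _ hp hq
    have e3 := htouch _ _ hp
    have e4 := htouch _ _ hq
    unfold Joined at e1 ⊢
    rw [← e3, ← e4, ← e2, h1, h1]
    rw [S.touch p p rfl, S.touch q q rfl] at e1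
    exact e1.symm
  · intro p'
    rcases hcover p' with h | h
    · exact .inr (.inl (hR'.symm h))
    · exact .inr (.inr h)

end SaddleKinds

/-! ## The saddle move -/

section SaddleMove

variable {A B : List Slice} {i : ℕ}

theorem getElem?_single (A B : List Slice) (σ : Slice) : (A ++ ([σ] ++ B))[A.length]? = some σ :=
  getElem?_middle (k := 0) (M := [σ]) (by simp)

/-- The crossing next to the saddle. -/
def centralCrossing (A B : List Slice) (i : ℕ) : Crossing (A ++ ([.cross i true] ++ B)) :=
  crossingAt (getElem?_single A B (.cross i true))

theorem centralCrossing_idx : (centralCrossing A B i).idx = A.length := rfl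

theorem exists_crossing_of_kink (c' : Crossing (A ++ (kink i ++ B))) :
    ∃ c : Crossing (A ++ ([.cross i true] ++ B)), SameCrossing A.length 1 3 c c' ∨
      (c.idx = A.length ∧ c'.idx = A.length + 1) := by
  by_cases h : c'.idx < A.length ∨ A.length + 3 ≤ c'.idx
  · obtain ⟨c, hc⟩ := exists_sameCrossing (M := [.cross i true]) (M' := kink i) h
    exact ⟨c, .inl hc⟩
  · exact ⟨centralCrossing A B i, .inr ⟨rfl, kink_idx c' h⟩⟩

/-- The crossing of the diagram before the saddle. -/
noncomputable def saddleCrossing (c' : Crossing (A ++ (kink i ++ B))) :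
    Crossing (A ++ ([.cross i true] ++ B)) :=
  (exists_crossing_of_kink c').choose

theorem saddleCrossing_spec (c' : Crossing (A ++ (kink i ++ B))) :
    SameCrossing A.length 1 3 (saddleCrossing c') c' ∨
      ((saddleCrossing c').idx = A.length ∧ c'.idx = A.length + 1) :=
  (exists_crossing_of_kink c').choose_spec

theorem saddleCrossing_strictMono :
    StrictMono (saddleCrossing : Crossing (A ++ (kink i ++ B)) → _) := by
  intro c c' h
  rw [Crossing.lt_iff] at h ⊢
  have h1 := saddleCrossing_spec c
  have h2 := saddleCrossing_spec c'
  unfold SameCrossing at h1 h2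
  omega

theorem saddleCrossing_kink : saddleCrossing (kinkCrossing A B i) = centralCrossing A B i := by
  refine Crossing.ext_idx ?_
  have h := saddleCrossing_spec (kinkCrossing A B i)
  rw [centralCrossing_idx]
  unfold SameCrossing at h
  rw [kinkCrossing_idx] at h
  omega

theorem eq_saddleCrossing {c : Crossing (A ++ ([.cross i true] ++ B))}
    {c' : Crossing (A ++ (kink i ++ B))} (h : SameCrossing A.length 1 3 c c') :
    c = saddleCrossing c' := by
  refine Crossing.ext_idx ?_
  have h1 := saddleCrossing_spec c'
  unfold SameCrossing at h h1
  omega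

theorem saddleCrossing_surjective :
    Function.Surjective (saddleCrossing : Crossing (A ++ (kink i ++ B)) → _) := by
  intro c
  by_cases h : c.idx < A.length ∨ A.length + 1 ≤ c.idx
  · obtain ⟨c', hc⟩ := exists_sameCrossing (M := kink i) (M' := [.cross i true]) h
    refine ⟨c', (eq_saddleCrossing ?_).symm⟩
    have e1 : (kink i).length = 3 := rfl
    have e2 : [Slice.cross i true].length = 1 := rfl
    unfold SameCrossing at hc ⊢
    omega
  · refine ⟨kinkCrossing A B i, ?_⟩
    rw [saddleCrossing_kink]
    exact Crossing.ext_idx (by rw [centralCrossing_idx]; omega)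

theorem sameSmoothing_saddle_iff {s : State (A ++ ([.cross i true] ++ B))}
    {s' : State (A ++ (kink i ++ B))} :
    (SameSmoothing A.length 1 3 s s' ∧ ∀ (c : Crossing (A ++ ([.cross i true] ++ B)))
      (c' : Crossing (A ++ (kink i ++ B))), c.idx = A.length → c'.idx = A.length + 1 →
      s' c' = s c) ↔ s' = s ∘ saddleCrossing := by
  constructor
  · rintro ⟨h, h'⟩
    ext c'
    rcases saddleCrossing_spec c' with hc | ⟨hc, hc'⟩
    · exact h _ _ hc
    · exact h' _ _ hc hc'
  · rintro rfl
    refine ⟨fun c c' h => ?_, fun c c' hc hc' => ?_⟩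
    · rw [Function.comp, eq_saddleCrossing h]
    · have e1 : c' = kinkCrossing A B i := Crossing.ext_idx hc'
      have e2 : c = centralCrossing A B i := Crossing.ext_idx hc
      rw [Function.comp, e1, e2, saddleCrossing_kink]

theorem flip_comp_saddleCrossing (c' : Crossing (A ++ (kink i ++ B)))
    (s : State (A ++ ([.cross i true] ++ B))) :
    flip (saddleCrossing c') s ∘ saddleCrossing = flip c' (s ∘ saddleCrossing) := by
  ext d
  by_cases h : d = c'
  · subst h; simp
  · rw [Function.comp, flip_of_ne h,
      flip_of_ne fun h' => h (saddleCrossing_strictMono.injective h')]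
    rfl

theorem comp_saddleCrossing_lift (s : State (A ++ ([.cross i true] ++ B))) :
    (s ∘ saddleCrossing) ∘ liftCrossing A (kink i) B = s ∘ liftCrossing A [.cross i true] B := by
  ext c
  simp only [Function.comp]
  congr 1
  refine eq_liftCrossing ?_
  have h1 := saddleCrossing_spec (liftCrossing A (kink i) B c)
  have h2 := liftCrossing_spec (M := kink i) c
  have e1 : (kink i).length = 3 := rfl
  have e2 : [Slice.cross i true].length = 1 := rfl
  unfold SameCrossing at *
  omega

theorem saddle_onDiagram (hL : IsLinkDiagram (A ++ ([.cross i true] ++ B))) {x : ℕ}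
    (hx : x < i + 2) : OnDiagram (A ++ ([.cross i true] ++ B)) (A.length, x) ∧
      OnDiagram (A ++ ([.cross i true] ++ B)) (A.length + 1, x) := by
  have h1 : i + 2 ≤ width (A ++ ([.cross i true] ++ B)) A.length :=
    hL.fits (getElem?_single A B _)
  have h2 : width (A ++ ([.cross i true] ++ B)) (A.length + 1) =
    width (A ++ ([.cross i true] ++ B)) A.length := width_succ (getElem?_single A B _)
  exact ⟨⟨by simp, by simp only; omega⟩, ⟨by simp, by simp only; omega⟩⟩

/-- The point below the saddle. -/
def saddleLow (hL : IsLinkDiagram (A ++ ([.cross i true] ++ B))) :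
    Point (A ++ ([.cross i true] ++ B)) := (saddle_onDiagram hL (x := i + 1) (by omega)).1.point

/-- The point above the saddle. -/
def saddleHigh (hL : IsLinkDiagram (A ++ ([.cross i true] ++ B))) :
    Point (A ++ ([.cross i true] ++ B)) := (saddle_onDiagram hL (x := i + 1) (by omega)).2.point

theorem exists_samePoint_kink
    (hK : IsLinkDiagram (A ++ (kink i ++ B))) (P : Point (A ++ ([.cross i true] ++ B))) :
    ∃ P' : Point (A ++ (kink i ++ B)), SamePoint A.length 1 3 P P' := by
  have hw : outWidth [.cross i true] (width A A.length) = outWidth (kink i) (width A A.length) :=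
    (kink_width hK).1.symm
  by_cases h : P.coord.1 ≤ A.length
  · have h' : Outer A.length 1 3 P.coord P.coord := ⟨rfl, .inl ⟨h, rfl⟩⟩
    exact ⟨(onDiagram_of_outer hw h' P.onDiagram).point, h'⟩
  · have h' : Outer A.length 1 3 P.coord (P.coord.1 + 2, P.coord.2) :=
      ⟨rfl, .inr ⟨by omega, rfl⟩⟩
    exact ⟨(onDiagram_of_outer hw h' P.onDiagram).point, h'⟩

theorem exists_samePoint_saddle
    (hK : IsLinkDiagram (A ++ (kink i ++ B))) (P' : Point (A ++ (kink i ++ B)))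
    (hP' : P'.coord.1 ≤ A.length ∨ A.length + 3 ≤ P'.coord.1) :
    ∃ P : Point (A ++ ([.cross i true] ++ B)), SamePoint A.length 1 3 P P' := by
  have hw : outWidth (kink i) (width A A.length) = outWidth [.cross i true] (width A A.length) :=
    (kink_width hK).1
  rcases hP' with h | h
  · have h' : Outer A.length 3 1 P'.coord P'.coord := ⟨rfl, .inl ⟨h, rfl⟩⟩
    exact ⟨(onDiagram_of_outer hw h' P'.onDiagram).point, h'.symm⟩
  · have h' : Outer A.length 3 1 P'.coord (P'.coord.1 - 2, P'.coord.2) :=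
      ⟨rfl, .inr ⟨by omega, by simp only; omega⟩⟩
    exact ⟨(onDiagram_of_outer hw h' P'.onDiagram).point, h'.symm⟩

theorem SamePoint.level_right {L L' : List Slice} {k r t : ℕ} {P : Point L} {P' : Point L'}
    (h : SamePoint k r t P P') : P'.coord.1 ≤ k ∨ k + t ≤ P'.coord.1 := by
  unfold SamePoint at h
  omega

/-- The part of the saddle move that belongs to the small loop. -/
theorem saddle_cover (hK : IsLinkDiagram (A ++ (kink i ++ B))) (s : State (A ++ (kink i ++ B)))
    (P' : Point (A ++ (kink i ++ B))) : SameLoop s (kinkPoint hK) P' ∨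
      ∃ (P : Point (A ++ ([.cross i true] ++ B))) (Q' : Point (A ++ (kink i ++ B))),
        SamePoint A.length 1 3 P Q' ∧ SameLoop s Q' P' := by
  rcases kink_cover hK s P' with h | ⟨Q', hQ, h⟩
  · exact .inl h
  · obtain ⟨P, hP⟩ := exists_samePoint_saddle hK Q' hQ
    exact .inr ⟨P, Q', hP, h⟩

theorem central_vertical {s : State (A ++ ([.cross i true] ++ B))}
    (hs : s (centralCrossing A B i) = false) : VerticalAt A.length [.cross i true] (bits s) := by
  intro m σ hm
  obtain rfl : m = 0 := by
    have := (List.getElem?_eq_some_iff.1 hm).1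
    simp only [List.length_cons, List.length_nil] at this
    omega
  simp only [List.getElem?_cons_zero, Option.some.injEq] at hm
  subst hm
  refine ⟨i, true, rfl, ?_⟩
  have := bits_crossing s (centralCrossing A B i)
  rw [centralCrossing_idx] at this
  rw [Nat.add_zero, this, hs]
  decide

/-- If the crossing is `0`-smoothed, the kink diagram has the same loops and the small one. -/
theorem saddle_sameLoop_iff (hL : IsLinkDiagram (A ++ ([.cross i true] ++ B)))
    (hK : IsLinkDiagram (A ++ (kink i ++ B))) (hN : IsLinkDiagram (A ++ B))
    {s : State (A ++ ([.cross i true] ++ B))} (hs : s (centralCrossing A B i) = false)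
    {s' : State (A ++ (kink i ++ B))}
    (hs' : s' ∘ liftCrossing A (kink i) B = s ∘ liftCrossing A [.cross i true] B)
    {P Q : Point (A ++ ([.cross i true] ++ B))} {P' Q' : Point (A ++ (kink i ++ B))}
    (hP : SamePoint A.length 1 3 P P') (hQ : SamePoint A.length 1 3 Q Q') :
    SameLoop s P Q ↔ SameLoop s' P' Q' := by
  obtain ⟨P'', hP''⟩ := exists_samePoint_of_outer (M := kink i) (kink_width hK).1 P' hP.level_right
  obtain ⟨Q'', hQ''⟩ := exists_samePoint_of_outer (M := kink i) (kink_width hK).1 Q' hQ.level_right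
  rw [kink_sameLoop_iff hK hN s' hP'' hQ'', hs']
  have comp : ∀ {X : Point (A ++ ([.cross i true] ++ B))} {Y : Point (A ++ (kink i ++ B))}
      {Z : Point (A ++ B)}, SamePoint A.length 1 3 X Y → SamePoint A.length 3 0 Y Z →
      SamePoint A.length [Slice.cross i true].length 0 X Z := by
    intro X Y Z h1 h2
    have e2 : [Slice.cross i true].length = 1 := rfl
    unfold SamePoint at *
    omega
  exact (central_vertical hs).sameLoop_iff hL hN (comp hP hP'') (comp hQ hQ'')

end SaddleMove

/-! ### The saddle map as a chain map, and its composition with the removal of the kink -/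

section SaddleMap

variable {A B : List Slice} {i : ℕ}

theorem saddle_conn_of_true {s : State (A ++ (kink i ++ B))}
    (hK : IsLinkDiagram (A ++ (kink i ++ B))) (hs : s (kinkCrossing A B i) = true)
    {P : Point (A ++ (kink i ++ B))} (hP : P.coord = (A.length, i)) :
    SameLoop s (kinkPoint hK) P := by
  rw [hK.sameLoop_iff, hP]
  have hb := bits_crossing s (kinkCrossing A B i)
  rw [kinkCrossing_idx, hs] at hb
  have h1 : Conn (A ++ (kink i ++ B)) (bits s) (A.length + 1, i) (A.length + 1, i + 1) :=
    Conn.of_arc (getElem?_kink_cross A B i) (.hor_bottom hb.symm)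
  exact kink_conn_z1.trans (h1.symm.trans (kink_conn_low_left (by omega)).symm)

theorem saddle_vert {L : List Slice} (hL : IsLinkDiagram L) {s : State L} {c : Crossing L} {i : ℕ}
    {e : Bool} (hc : L[c.idx]? = some (.cross i e)) (hs : e ≠ s c) {P Q : Point L}
    (hP : P.coord = (c.idx, i + 1)) (hQ : Q.coord = (c.idx + 1, i + 1)) : SameLoop s P Q := by
  rw [hL.sameLoop_iff, hP, hQ]
  refine Conn.of_arc hc (.vert_right ?_)
  rwa [bits_crossing]

theorem saddle_hor {L : List Slice} (hL : IsLinkDiagram L) {s : State L} {c : Crossing L} {i : ℕ}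
    {e : Bool} (hc : L[c.idx]? = some (.cross i e)) (hs : e = s c) {P Q : Point L}
    (hP : P.coord = (c.idx, i)) (hQ : Q.coord = (c.idx, i + 1)) : SameLoop s P Q := by
  rw [hL.sameLoop_iff, hP, hQ]
  refine Conn.of_arc hc (.hor_bottom ?_)
  rwa [bits_crossing]

theorem kinkLow_onDiagram (hK : IsLinkDiagram (A ++ (kink i ++ B)))
    (hL : IsLinkDiagram (A ++ ([.cross i true] ++ B))) {x : ℕ} (hx : x < i + 2) :
    OnDiagram (A ++ (kink i ++ B)) (A.length, x) := by
  have h := (saddle_onDiagram hL hx).1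
  obtain ⟨P', hP', h'⟩ := exists_samePoint_kink hK h.point
  have : P'.coord = (A.length, x) := Prod.ext (by simp at h'; simp; omega) hP'
  exact this ▸ P'.onDiagram

/-- The point below the saddle in the kink diagram. -/
def kinkLow (hK : IsLinkDiagram (A ++ (kink i ++ B)))
    (hL : IsLinkDiagram (A ++ ([.cross i true] ++ B))) : Point (A ++ (kink i ++ B)) :=
  (kinkLow_onDiagram hK hL (x := i + 1) (by omega)).point

theorem saddle_samePoint_low (hK : IsLinkDiagram (A ++ (kink i ++ B)))
    (hL : IsLinkDiagram (A ++ ([.cross i true] ++ B))) :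
    SamePoint A.length 1 3 (saddleLow hL) (kinkLow hK hL) := ⟨rfl, .inl ⟨le_rfl, rfl⟩⟩

/-- With a `0`-smoothing the band is attached to a single vertical strand and cuts off the small
loop. With a `1`-smoothing the kink diagram has the loops of the `0`-smoothed crossing, so the band
undoes the passage from the `0`-smoothing to the `1`-smoothing. -/
theorem saddlePair_saddle (hL : IsLinkDiagram (A ++ ([.cross i true] ++ B)))
    (hK : IsLinkDiagram (A ++ (kink i ++ B))) (hN : IsLinkDiagram (A ++ B))
    (s : State (A ++ ([.cross i true] ++ B))) :
    SaddlePair (SameLoop s) (SameLoop (s ∘ saddleCrossing)) (SamePoint A.length 1 3)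
      (saddleLow hL) (saddleHigh hL) (kinkLow hK hL) (kinkPoint hK) := by
  have hc : (A ++ ([.cross i true] ++ B))[(centralCrossing A B i).idx]? = some (.cross i true) :=
    getElem?_single A B _
  by_cases hs : s (centralCrossing A B i) = false
  · refine SaddlePair.of_birth (sameLoop_equivalence _) (sameLoop_equivalence _)
      (saddle_vert hL hc (by rw [hs]; decide) rfl rfl) (saddle_samePoint_low hK hL) ?_
      (fun P Q P' Q' hP hQ => saddle_sameLoop_iff hL hK hN hs (comp_saddleCrossing_lift s) hP hQ)
      (saddle_cover hK _)
    intro P P' hP h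
    refine kink_not_sameLoop hK ?_ hP.level_right ((sameLoop_equivalence _).symm h)
    rw [Function.comp, saddleCrossing_kink, hs]
  · have hs : s (centralCrossing A B i) = true := by simpa using hs
    have hlow := saddle_onDiagram hL (x := i) (by omega)
    have hlow' := kinkLow_onDiagram hK hL (x := i) (by omega)
    set s0 : State (A ++ ([.cross i true] ++ B)) :=
      Function.update s (centralCrossing A B i) false with hs0
    have h0 : s0 (centralCrossing A B i) = false := Function.update_self _ _ _
    have h0' : ∀ c ≠ centralCrossing A B i, s c = s0 c := fun c hc =>
      (Function.update_of_ne hc _ _).symm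
    -- The saddle of the crossing is attached at its lower left corner, the band at the lower right
    -- one; the horizontal smoothing joins the two.
    refine SaddlePair.of_return (R0 := SameLoop s0) (a0 := hlow.1.point) (a0' := hlow'.point)
      (sameLoop_equivalence _) (sameLoop_equivalence _) (sameLoop_equivalence _)
      (hL.saddlePair hc h0' (by rw [hs, h0]; decide) rfl rfl)
      ((sameLoop_equivalence _).symm (saddle_hor hL hc hs.symm rfl rfl))
      (saddle_vert hL hc (by rw [h0]; decide) rfl rfl)
      (saddle_samePoint_low hK hL) ⟨rfl, .inl ⟨le_rfl, rfl⟩⟩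
      (saddle_conn_of_true hK (by rw [Function.comp, saddleCrossing_kink, hs]) rfl)
      (fun P Q P' Q' hP hQ => saddle_sameLoop_iff hL hK hN h0 ?_ hP hQ)
      (saddle_cover hK _)
    rw [comp_saddleCrossing_lift]
    ext d
    refine h0' _ fun h => ?_
    have := liftCrossing_spec (M := [.cross i true]) d
    have e2 : [Slice.cross i true].length = 1 := rfl
    rw [h] at this
    unfold SameCrossing at this
    rw [centralCrossing_idx] at this
    omega

theorem saddleMap_eq (hL : IsLinkDiagram (A ++ ([.cross i true] ++ B)))
    (hK : IsLinkDiagram (A ++ (kink i ++ B))) :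
    saddleMap (A ++ ([.cross i true] ++ B)) (A ++ (kink i ++ B)) A.length i =
      saddleType (fun _ => True) (· ∘ saddleCrossing) (SamePoint A.length 1 3)
        (saddleLow hL) (saddleHigh hL) (kinkLow hK hL) (kinkPoint hK) := by
  refine ofCoeff_congr fun x y => ?_
  unfold SaddleRel
  rw [← and_assoc, sameSmoothing_saddle_iff, true_and]
  refine and_congr_right fun _ => ⟨?_, fun h => ⟨_, _, _, _, rfl, rfl, rfl, rfl, h⟩⟩
  rintro ⟨a, b, a', b', ha, hb, ha', hb', h⟩
  obtain rfl : a = saddleLow hL := Point.coord_injective ha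
  obtain rfl : b = saddleHigh hL := Point.coord_injective hb
  obtain rfl : a' = kinkLow hK hL := Point.coord_injective ha'
  obtain rfl : b' = kinkPoint hK := Point.coord_injective hb'
  exact h

theorem saddleMap_intertwines (hL : IsLinkDiagram (A ++ ([.cross i true] ++ B)))
    (hK : IsLinkDiagram (A ++ (kink i ++ B))) (hN : IsLinkDiagram (A ++ B))
    {P : Point (A ++ ([.cross i true] ++ B))} {P' : Point (A ++ (kink i ++ B))}
    (hP : SamePoint A.length 1 3 P P') :
    Intertwines (saddleMap (A ++ ([.cross i true] ++ B)) (A ++ (kink i ++ B)) A.length i) P P' := by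
  rw [saddleMap_eq hL hK]
  exact saddleType_intertwines (fun x _ => saddlePair_saddle hL hK hN x.smoothing) hP
    fun _ _ => Iff.rfl

theorem saddleMap_plus (hL : IsLinkDiagram (A ++ ([.cross i true] ++ B)))
    (hK : IsLinkDiagram (A ++ (kink i ++ B))) (hN : IsLinkDiagram (A ++ B))
    (s : State (A ++ ([.cross i true] ++ B))) :
    saddleMap (A ++ ([.cross i true] ++ B)) (A ++ (kink i ++ B)) A.length i
      (gen (EState.plus s)) = splitFactor (SameLoop s (saddleLow hL) (saddleHigh hL))
        (kinkLow hK hL) (kinkPoint hK) (gen (EState.plus (s ∘ saddleCrossing))) := by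
  rw [saddleMap_eq hL hK]
  exact saddleType_plus (x := EState.plus s) trivial (saddlePair_saddle hL hK hN s)
    (fun _ _ _ => rfl) rfl rfl

theorem supportedOn_saddleMap (hL : IsLinkDiagram (A ++ ([.cross i true] ++ B)))
    (hK : IsLinkDiagram (A ++ (kink i ++ B))) (x : EState (A ++ ([.cross i true] ++ B))) :
    SupportedOn (x.smoothing ∘ saddleCrossing)
      (saddleMap (A ++ ([.cross i true] ++ B)) (A ++ (kink i ++ B)) A.length i (gen x)) := by
  rw [saddleMap_eq hL hK]
  exact supportedOn_saddleType x

/-- An enhanced state all of whose points are marked by `v₊`. -/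
theorem eq_plus_of_forall {L : List Slice} {x : EState L} (h : ∀ P, x.mark P = .plus) :
    x = EState.plus x.smoothing := EState.ext rfl (funext h)

/-- The corners of the crossing of the kink lie inside the changed part, so the argument for two
separate saddles does not apply. With all marks `v₊`, each way around consists of one split and one
merge, and the two factors are compared directly. -/
theorem saddleMap_comm_central (hL : IsLinkDiagram (A ++ ([.cross i true] ++ B)))
    (hK : IsLinkDiagram (A ++ (kink i ++ B))) (hN : IsLinkDiagram (A ++ B))
    (x : EState (A ++ ([.cross i true] ++ B))) :
    saddleMap (A ++ ([.cross i true] ++ B)) (A ++ (kink i ++ B)) A.length i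
        (edgeMap (centralCrossing A B i) (gen x)) =
      edgeMap (kinkCrossing A B i)
        (saddleMap (A ++ ([.cross i true] ++ B)) (A ++ (kink i ++ B)) A.length i (gen x)) := by
  set f := saddleMap (A ++ ([.cross i true] ++ B)) (A ++ (kink i ++ B)) A.length i with hf
  set c := centralCrossing A B i with hcdef
  set c' := kinkCrossing A B i with hcdef'
  have hcc : saddleCrossing c' = c := saddleCrossing_kink
  by_cases hx : x.smoothing c = true
  · rw [edgeMap_of_true hx, map_zero]
    symm
    have := (supportedOn_saddleMap hL hK x).ext (F := edgeMap c') (G := 0) fun y hy => by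
      rw [edgeMap_of_true (by rw [hy, Function.comp, hcc, hx])]; rfl
    rw [this]; rfl
  have hx : x.smoothing c = false := by simpa using hx
  refine eq_of_intertwines (F := f ∘ₗ edgeMap c) (G := edgeMap c' ∘ₗ f)
    (fun _ => True) ?_ x.smoothing ?_ x rfl
  · rintro P -
    obtain ⟨P', hP⟩ := exists_samePoint_kink hK P
    exact ⟨P', (saddleMap_intertwines hL hK hN hP).comp (hL.edgeMap_intertwines c P),
      (hK.edgeMap_intertwines c' P').comp (saddleMap_intertwines hL hK hN hP)⟩
  intro y hy hp
  rw [LinearMap.comp_apply, LinearMap.comp_apply, eq_plus_of_forall fun P => hp P trivial, hy]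
  generalize x.smoothing = s at hx
  have hc : (A ++ ([.cross i true] ++ B))[c.idx]? = some (.cross i true) :=
    getElem?_single A B _
  have hc' : (A ++ (kink i ++ B))[c'.idx]? = some (.cross i true) := getElem?_kink_cross A B i
  have hs' : (s ∘ saddleCrossing) c' = false := by rw [Function.comp, hcc, hx]
  have hflip : flip c s ∘ saddleCrossing = flip c' (s ∘ saddleCrossing) := by
    rw [← hcc]; exact flip_comp_saddleCrossing c' s
  have hab : SameLoop s (saddleLow hL) (saddleHigh hL) :=
    saddle_vert hL hc (by rw [hx]; decide) rfl rfl
  -- The upper right corner lies on the small loop, so in the kink diagram the edge merges this loop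
  -- with the left strand.
  have hlr : ¬ SameLoop (s ∘ saddleCrossing) (hK.lower c') (hK.upper c') := by
    rw [hK.sameLoop_iff, hK.coord_lower hc', hK.coord_upper hc']
    intro h
    have h1 := kink_isolated ((bits_crossing _ c').trans hs')
      (kink_conn_z3.trans h.symm)
    omega
  obtain ⟨l', hl'⟩ := exists_samePoint_kink hK (hL.lower c)
  obtain ⟨r', hr'⟩ := exists_samePoint_kink hK (hL.upper c)
  rw [hf, saddleMap_plus hL hK hN, splitFactor_pos hab, map_add,
    hK.edgeMap_intertwines c', hK.edgeMap_intertwines c', hK.edgeMap_plus hs', splitFactor_neg hlr,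
    hL.edgeMap_plus hx, (saddleMap_intertwines hL hK hN hl').splitFactor
      (saddleMap_intertwines hL hK hN hr'), saddleMap_plus hL hK hN, hflip]
  have hup : hL.upper c = saddleHigh hL := Point.coord_injective (hL.coord_upper hc)
  have hlow := hL.coord_lower hc
  have hR : SameLoop (flip c s) (hL.lower c) (saddleLow hL) :=
    saddle_hor hL hc (by simp) hlow rfl
  have hxor := (hL.saddlePair_flip hx).xor
  have hR2 : SameLoop (flip c s) (saddleLow hL) (saddleHigh hL) ↔
      SameLoop (flip c s) (hL.lower c) (hL.upper c) := by
    rw [hup]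
    exact ⟨fun h => hR.trans _ _ _ h, fun h => ((sameLoop_equivalence _).symm hR).trans _ _ _ h⟩
  -- By `hxor` exactly one of the edge at `c` and the band after it splits. If it is the edge, its
  -- corners lie on the loops of the ends of the band, in exchanged order.
  by_cases h : SameLoop s (hL.lower c) (hL.upper c)
  · rw [splitFactor_pos h, splitFactor_neg (by rw [hR2]; exact hxor.1 h)]
    have e1 : SameLoop (flip c' (s ∘ saddleCrossing)) (kinkPoint hK) l' := by
      refine saddle_conn_of_true hK (flip_self _ _) ?_
      rw [samePoint_iff, hlow] at hl'
      obtain ⟨h1, h2⟩ := hl'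
      have e0 : c.idx = A.length := rfl
      exact Prod.ext (by simp only at h2 ⊢; omega) h1
    have e2 : SameLoop (flip c' (s ∘ saddleCrossing)) (kinkLow hK hL) r' := by
      rw [hK.sameLoop_iff]
      have : r'.coord = (A.length + 3, i + 1) := by
        rw [samePoint_iff, hL.coord_upper hc] at hr'
        obtain ⟨h1, h2⟩ := hr'
        have e0 : c.idx = A.length := rfl
        exact Prod.ext (by simp only at h2 ⊢; omega) h1
      rw [this]
      exact kink_conn_through _
    rw [xOp_plus_congr e1, xOp_plus_congr e2, add_comm]
  · rw [splitFactor_neg h, splitFactor_pos (by rw [hR2]; exact not_not.1 fun h' => h (hxor.2 h'))]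

/-- The crossings of the two diagrams correspond bijectively and in the same order, so there are no
extra edges and the signs agree. -/
theorem saddleMap_isChainMap (hL : IsLinkDiagram (A ++ ([.cross i true] ++ B)))
    (hK : IsLinkDiagram (A ++ (kink i ++ B))) (hN : IsLinkDiagram (A ++ B)) :
    IsChainMap (saddleMap (A ++ ([.cross i true] ++ B)) (A ++ (kink i ++ B)) A.length i) := by
  classical
  set f := saddleMap (A ++ ([.cross i true] ++ B)) (A ++ (kink i ++ B)) A.length i with hf
  have hrange : ∀ c : Crossing (A ++ ([.cross i true] ++ B)),
      c ∈ Set.range (saddleCrossing : Crossing (A ++ (kink i ++ B)) → _) := saddleCrossing_surjective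
  refine isChainMap_of_edges (f := f) (· ∘ saddleCrossing) (fun _ => 1) saddleCrossing
    saddleCrossing_strictMono.injective (fun x => (one_smul _ _).symm)
    (supportedOn_saddleMap hL hK) ?_ ?_ ?_
  · intro c' x
    rcases saddleCrossing_spec c' with hc | ⟨hc, hc'⟩
    · have hlow := hc.samePoint_lower (M := [.cross i true]) (M' := kink i) hL hK
      have hupp := hc.samePoint_upper (M := [.cross i true]) (M' := kink i) hL hK
      refine comm_edgeMap_outer hL hK (same := SamePoint A.length 1 3) (g := (· ∘ saddleCrossing))
        (u := LinearMap.id) (fun _ => True) (fun P P' hP => saddleMap_intertwines hL hK hN hP)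
        (supportedOn_saddleMap hL hK) (fun s => rfl) (fun s => Iff.rfl)
        (fun x hx => absurd trivial hx) hlow hupp ?_ ?_ x
      · intro x _ hO
        refine .inl (congrArg gen (eq_plus_of_forall fun P => ?_))
        obtain ⟨P', hP'⟩ := exists_samePoint_kink hK P
        exact hO P P' hP'
      · intro s _ hsc
        exact comm_edgeMap_of_saddle hL hK (g := (· ∘ saddleCrossing))
          (same := SamePoint A.length 1 3) hsc hsc (flip_comp_saddleCrossing c' s)
          (fun P P' hP => saddleMap_intertwines hL hK hN hP) (fun P φ => rfl) (fun φ => rfl)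
          (fun t _ => saddlePair_saddle hL hK hN t) (fun t _ => saddleMap_plus hL hK hN t) hlow hupp
    · have e1 : c' = kinkCrossing A B i := Crossing.ext_idx hc'
      rw [e1, saddleCrossing_kink]
      exact saddleMap_comm_central hL hK hN x
  · intro c' x _ _
    rw [signAt_comp saddleCrossing_strictMono, mul_one, one_mul, Finset.card_eq_zero.2, pow_zero,
      mul_one]
    rw [Finset.filter_eq_empty_iff]
    rintro c - ⟨h1, -⟩
    exact h1 (hrange c)
  · intro x
    refine Finset.sum_eq_zero fun c hc => absurd (hrange c) (Finset.mem_filter.1 hc).2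

/-- The saddle move followed by the first Reidemeister move, at a state with a `0`-smoothing. -/
theorem rIMap_saddleMap_gen (hL : IsLinkDiagram (A ++ ([.cross i true] ++ B)))
    (hK : IsLinkDiagram (A ++ (kink i ++ B))) (hN : IsLinkDiagram (A ++ B))
    {x : EState (A ++ ([.cross i true] ++ B))} (hx : x.smoothing (centralCrossing A B i) = false)
    {y : EState (A ++ B)} (hs : SameSmoothing A.length 1 0 x.smoothing y.smoothing)
    (hm : SameMark A.length 1 0 x.mark y.mark) :
    rIMap (A ++ (kink i ++ B)) (A ++ B) A.length i
      (saddleMap (A ++ ([.cross i true] ++ B)) (A ++ (kink i ++ B)) A.length i (gen x)) = gen y := by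
  set f := saddleMap (A ++ ([.cross i true] ++ B)) (A ++ (kink i ++ B)) A.length i with hf
  set r := rIMap (A ++ (kink i ++ B)) (A ++ B) A.length i with hr
  have hw : outWidth [.cross i true] (width A A.length) = width A A.length := rfl
  have hs : y.smoothing = x.smoothing ∘ liftCrossing A [.cross i true] B :=
    sameSmoothing_removal_iff.1 hs
  have hpt : ∀ P : Point (A ++ ([.cross i true] ++ B)), ∃ (P' : Point (A ++ (kink i ++ B)))
      (P'' : Point (A ++ B)), SamePoint A.length 1 3 P P' ∧ SamePoint A.length 3 0 P' P'' ∧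
        SamePoint A.length 1 0 P P'' := by
    intro P
    obtain ⟨P', hP'⟩ := exists_samePoint_kink hK P
    obtain ⟨P'', hP''⟩ := exists_samePoint_of_outer (M := kink i) (kink_width hK).1 P' hP'.level_right
    have e1 : (kink i).length = 3 := rfl
    rw [e1] at hP''
    refine ⟨P', P'', hP', hP'', ?_⟩
    unfold SamePoint at *
    omega
  have hcov : ∀ (s : State (A ++ B)) (P' : Point (A ++ B)), ∃ (P : Point (A ++ ([.cross i true] ++ B)))
      (Q' : Point (A ++ B)), SamePoint A.length 1 0 P Q' ∧ SameLoop s Q' P' := by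
    intro s P'
    obtain ⟨P, hP⟩ := exists_samePoint_of_removal (M := [.cross i true]) hw P'
    exact ⟨P, P', hP, .refl _⟩
  let K : EState (A ++ ([.cross i true] ++ B)) → Prop :=
    fun x => x.smoothing (centralCrossing A B i) = false
  -- The composite is compared with the map that keeps all marks. Both are compatible with the
  -- multiplications at all points, so only the state with all marks `v₊` has to be computed.
  rw [← keepType_gen (K := K) (f := (· ∘ liftCrossing A [.cross i true] B)) (x := x) hx
    (hcov _) hs hm]
  refine eq_of_intertwines (F := r ∘ₗ f) (fun _ => True) ?_ x.smoothing ?_ x rfl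
  · rintro P -
    obtain ⟨P', P'', h1, h2, h3⟩ := hpt P
    refine ⟨P'', (rIMap_intertwines hK hN h2).comp (saddleMap_intertwines hL hK hN h1),
      keepType_intertwines ?_ h3 fun _ _ => Iff.rfl⟩
    intro x hx P Q P' Q' hP hQ
    exact (central_vertical hx).sameLoop_iff hL hN hP hQ
  · intro z hz hp
    rw [← hz] at hx
    have hc : (A ++ ([.cross i true] ++ B))[(centralCrossing A B i).idx]? = some (.cross i true) :=
      getElem?_single A B _
    have hk : (z.smoothing ∘ saddleCrossing) (kinkCrossing A B i) = false := by
      rw [Function.comp, saddleCrossing_kink, hx]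
    rw [keepType_gen (K := K) (y := EState.plus (z.smoothing ∘ liftCrossing A [.cross i true] B)) hx
      (hcov _) rfl fun P P' _ => (hp P trivial).symm, LinearMap.comp_apply,
      eq_plus_of_forall fun P => hp P trivial, hf, saddleMap_plus hL hK hN, splitFactor_pos
      (saddle_vert hL hc (by
        have : (EState.plus z.smoothing).smoothing = z.smoothing := rfl
        rw [hx]; decide) rfl rfl), map_add, hr, rIMap_xOp_plus hK hk]
    obtain ⟨P', P'', h1, h2, h3⟩ := hpt (saddleLow hL)
    obtain rfl : P' = kinkLow hK hL := by
      refine Point.coord_injective ?_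
      obtain ⟨h4, h5⟩ := h1
      have e1 : (saddleLow hL).coord = (A.length, i + 1) := rfl
      rw [e1] at h4 h5
      exact Prod.ext (by simp only at h5; simp only [kinkLow, OnDiagram.coord_point]; omega) h4
    -- Of the two terms of the splitting, the one with `v₋` on the strand has `v₊` on the small loop
    -- and is killed; the other one is the state with all marks `v₊`.
    rw [rIMap_intertwines hK hN h2, rIMap_of_plus hK rfl, map_zero, zero_add,
      comp_saddleCrossing_lift]
    rfl

end SaddleMap

/-! ## Two inverse crossings -/

/-- Two inverse crossings of the strands `i` and `i + 1`. -/
def bigon (i : ℕ) (e : Bool) : List Slice := [.cross i e, .cross i (!e)]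

section Bigon

variable (A B : List Slice) (i : ℕ) (e : Bool)

theorem getElem?_bigon_low : (A ++ (bigon i e ++ B))[A.length]? = some (.cross i e) :=
  getElem?_middle (k := 0) (M := bigon i e) (by simp [bigon])

theorem getElem?_bigon_high : (A ++ (bigon i e ++ B))[A.length + 1]? = some (.cross i (!e)) :=
  getElem?_middle (k := 1) (M := bigon i e) (by simp [bigon])

variable {A B i e} {β β' : ℕ → Bool}

theorem bigon_vert_low {x : ℕ} (h : e ≠ β A.length) :
    Conn (A ++ (bigon i e ++ B)) β (A.length, x) (A.length + 1, x) := by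
  have hσ := getElem?_bigon_low A B i e
  by_cases h1 : x = i
  · subst h1; exact .of_arc hσ (.vert_left h)
  · by_cases h2 : x = i + 1
    · subst h2; exact .of_arc hσ (.vert_right h)
    · exact .of_arc hσ (.away h1 h2)

theorem bigon_vert_high {x : ℕ} (h : (!e) ≠ β (A.length + 1)) :
    Conn (A ++ (bigon i e ++ B)) β (A.length + 1, x) (A.length + 2, x) := by
  have hσ := getElem?_bigon_high A B i e
  by_cases h1 : x = i
  · subst h1; exact .of_arc hσ (.vert_left h)
  · by_cases h2 : x = i + 1
    · subst h2; exact .of_arc hσ (.vert_right h)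
    · exact .of_arc hσ (.away h1 h2)

theorem bigon_mid (h : e = β A.length ∨ (!e) = β (A.length + 1)) :
    Conn (A ++ (bigon i e ++ B)) β (A.length + 1, i) (A.length + 1, i + 1) := by
  rcases h with h | h
  · exact .of_arc (getElem?_bigon_low A B i e) (.hor_top h)
  · exact .of_arc (getElem?_bigon_high A B i e) (.hor_bottom h)

/-- If the lower crossing is vertical, the connection runs up to the horizontal upper crossing and
back. -/
theorem bigon_bottom (h : e = β A.length ∨ (!e) = β (A.length + 1)) :
    Conn (A ++ (bigon i e ++ B)) β (A.length, i) (A.length, i + 1) := by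
  by_cases h' : e = β A.length
  · exact .of_arc (getElem?_bigon_low A B i e) (.hor_bottom h')
  · exact (bigon_vert_low h').trans ((bigon_mid h).trans (bigon_vert_low h').symm)

theorem bigon_top (h : e = β A.length ∨ (!e) = β (A.length + 1)) :
    Conn (A ++ (bigon i e ++ B)) β (A.length + 2, i) (A.length + 2, i + 1) := by
  by_cases h' : (!e) = β (A.length + 1)
  · exact .of_arc (getElem?_bigon_high A B i e) (.hor_top h')
  · exact (bigon_vert_high h').symm.trans ((bigon_mid h).trans (bigon_vert_high h'))

/-- If both crossings are smoothed horizontally, the loop between them has only two points. -/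
theorem bigon_isolated (h0 : e = β A.length) (h1 : (!e) = β (A.length + 1)) {q : ℕ × ℕ}
    (h : Conn (A ++ (bigon i e ++ B)) β (A.length + 1, i) q) :
    q.1 = A.length + 1 ∧ (q.2 = i ∨ q.2 = i + 1) := by
  have key := Conn.map (E := fun P Q : Prop => P ↔ Q) ⟨fun _ => .rfl, Iff.symm, Iff.trans⟩
    (fun q => q.1 = A.length + 1 ∧ (q.2 = i ∨ q.2 = i + 1)) ?_ h
  · exact key.1 ⟨rfl, .inl rfl⟩
  · intro k σ p q hσ harc
    obtain ⟨hp, hq⟩ := harc.level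
    by_cases hk : k = A.length
    · subst hk
      rw [getElem?_bigon_low, Option.some.injEq] at hσ
      subst hσ
      cases harc with
      | vert_left h => exact absurd h0 h
      | vert_right h => exact absurd h0 h
      | away h h' => simp only; omega
      | hor_bottom h => simp only; omega
      | hor_top h => simp only [true_or, or_true]
    · by_cases hk1 : k = A.length + 1
      · subst hk1
        rw [getElem?_bigon_high, Option.some.injEq] at hσ
        subst hσ
        cases harc with
        | vert_left h => exact absurd h1 h
        | vert_right h => exact absurd h1 h
        | away h h' => simp only; omega
        | hor_bottom h => simp only [true_or, or_true]
        | hor_top h => simp only; omega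
      · omega

open Classical in
/-- The outer point that is joined to a point of the bigon, if exactly one of the two crossings is
smoothed horizontally. -/
noncomputable def bigonExit (a i : ℕ) (p : Prop) (q : ℕ × ℕ) : ℕ × ℕ :=
  if q.1 = a + 1 ∧ (q.2 = i ∨ q.2 = i + 1) then (if p then (a, i) else (a + 2, i)) else q

theorem bigonExit_low {a x : ℕ} {p : Prop} : bigonExit a i p (a, x) = (a, x) :=
  if_neg (by simp only; omega)

theorem bigonExit_high {a x : ℕ} {p : Prop} : bigonExit a i p (a + 2, x) = (a + 2, x) :=
  if_neg (by simp only; omega)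

theorem bigonExit_away {a x : ℕ} {p : Prop} (h : x ≠ i) (h' : x ≠ i + 1) :
    bigonExit a i p (a + 1, x) = (a + 1, x) :=
  if_neg (by simp only; omega)

theorem bigonExit_mid {a : ℕ} {p : Prop} :
    bigonExit a i p (a + 1, i + 1) = bigonExit a i p (a + 1, i) := by
  simp [bigonExit]

theorem bigonExit_of {a : ℕ} {p : Prop} (h : p) : bigonExit a i p (a + 1, i) = (a, i) := by
  simp [bigonExit, h]

theorem bigonExit_of_not {a : ℕ} {p : Prop} (h : ¬ p) :
    bigonExit a i p (a + 1, i) = (a + 2, i) := by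
  simp [bigonExit, h]

/-- As soon as one crossing is horizontal, the outer points see the two lower ends joined and the
two upper ends joined, whatever happens in between. A path is followed by pushing the middle points
out of the bigon with `bigonExit`. -/
theorem bigon_conn_mono (hββ : ∀ m, m ≠ A.length → m ≠ A.length + 1 → β' m = β m)
    (h : e = β A.length ∨ (!e) = β (A.length + 1))
    (h' : e = β' A.length ∨ (!e) = β' (A.length + 1)) {p q : ℕ × ℕ}
    (hp : p.1 ≠ A.length + 1) (hq : q.1 ≠ A.length + 1)
    (hc : Conn (A ++ (bigon i e ++ B)) β p q) : Conn (A ++ (bigon i e ++ B)) β' p q := by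
  have key := Conn.map (conn_equivalence (A ++ (bigon i e ++ B)) β')
    (bigonExit A.length i (e ≠ β A.length)) ?_ hc
  · have e1 : ∀ r : ℕ × ℕ, r.1 ≠ A.length + 1 →
        bigonExit A.length i (e ≠ β A.length) r = r := fun r hr => if_neg fun h => hr h.1
    rwa [e1 p hp, e1 q hq] at key
  · intro k σ p q hσ harc
    obtain ⟨hp, hq⟩ := harc.level
    have hσ' := hσ
    by_cases hk : k = A.length
    · subst hk
      rw [getElem?_bigon_low, Option.some.injEq] at hσ
      subst hσ
      cases harc with
      | vert_left h => rw [bigonExit_low, bigonExit_of h]; exact .refl _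
      | vert_right h =>
        rw [bigonExit_low, bigonExit_mid, bigonExit_of h]; exact (bigon_bottom h').symm
      | away h h' => rw [bigonExit_low, bigonExit_away h h']; exact .of_arc hσ' (.away h h')
      | hor_bottom h => rw [bigonExit_low, bigonExit_low]; exact bigon_bottom h'
      | hor_top h => rw [bigonExit_mid]; exact .refl _
    · by_cases hk1 : k = A.length + 1
      · subst hk1
        rw [getElem?_bigon_high, Option.some.injEq] at hσ
        subst hσ
        cases harc with
        | vert_left hv =>
          rw [bigonExit_of_not fun h0 => h.elim h0 hv]
          erw [bigonExit_high]
          exact .refl _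
        | vert_right hv =>
          rw [bigonExit_mid, bigonExit_of_not fun h0 => h.elim h0 hv]
          erw [bigonExit_high]
          exact bigon_top h'
        | away h h' =>
          erw [bigonExit_high]
          rw [bigonExit_away h h']; exact .of_arc hσ' (.away h h')
        | hor_bottom h => rw [bigonExit_mid]; exact .refl _
        | hor_top h => erw [bigonExit_high, bigonExit_high]; exact bigon_top h'
      · have e1 : ∀ r : ℕ × ℕ, (r.1 = k ∨ r.1 = k + 1) → r.1 ≠ A.length + 1 →
            bigonExit A.length i (e ≠ β A.length) r = r := fun r _ hr => if_neg fun h => hr h.1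
        rw [e1 p hp (by omega), e1 q hq (by omega)]
        rw [← hββ k hk hk1] at harc
        exact .of_arc hσ' harc

end Bigon

section BigonDiagram

variable {A B : List Slice} {i : ℕ} {e : Bool}

/-- The lower crossing of the bigon. -/
def bigonLow (A B : List Slice) (i : ℕ) (e : Bool) : Crossing (A ++ (bigon i e ++ B)) :=
  crossingAt (getElem?_bigon_low A B i e)

/-- The upper crossing of the bigon. -/
def bigonHigh (A B : List Slice) (i : ℕ) (e : Bool) : Crossing (A ++ (bigon i e ++ B)) :=
  crossingAt (getElem?_bigon_high A B i e)

theorem bigonLow_idx : (bigonLow A B i e).idx = A.length := rfl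

theorem bigonHigh_idx : (bigonHigh A B i e).idx = A.length + 1 := rfl

theorem bits_bigonLow (s : State (A ++ (bigon i e ++ B))) :
    bits s A.length = s (bigonLow A B i e) := bits_crossing s (bigonLow A B i e)

theorem bits_bigonHigh (s : State (A ++ (bigon i e ++ B))) :
    bits s (A.length + 1) = s (bigonHigh A B i e) := bits_crossing s (bigonHigh A B i e)

theorem bigonLow_ne_high : bigonLow A B i e ≠ bigonHigh A B i e := by
  intro h
  have := congrArg Crossing.idx h
  rw [bigonLow_idx, bigonHigh_idx] at this
  omega

theorem not_mem_range_bigon (c : Crossing (A ++ (bigon i e ++ B))) :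
    c ∉ Set.range (liftCrossing A (bigon i e) B) ↔ c = bigonLow A B i e ∨ c = bigonHigh A B i e := by
  have hlen : (bigon i e).length = 2 := rfl
  rw [mem_range_liftCrossing]
  constructor
  · intro h
    by_cases h0 : c.idx = A.length
    · exact .inl (Crossing.ext_idx h0)
    · exact .inr (Crossing.ext_idx (by rw [bigonHigh_idx]; omega))
  · rintro (rfl | rfl)
    · rw [bigonLow_idx]; omega
    · rw [bigonHigh_idx]; omega

theorem liftCrossing_ne_bigon (c' : Crossing (A ++ B)) :
    liftCrossing A (bigon i e) B c' ≠ bigonLow A B i e ∧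
      liftCrossing A (bigon i e) B c' ≠ bigonHigh A B i e := by
  have := mt (not_mem_range_bigon (liftCrossing A (bigon i e) B c')).2 fun h => h ⟨c', rfl⟩
  tauto

theorem bigon_onDiagram (hL : IsLinkDiagram (A ++ (bigon i e ++ B))) {x m : ℕ}
    (hx : x < i + 2) (hm : m ≤ 2) : OnDiagram (A ++ (bigon i e ++ B)) (A.length + m, x) := by
  have h1 : i + 2 ≤ width (A ++ (bigon i e ++ B)) A.length := hL.fits (getElem?_bigon_low A B i e)
  have h2 : width (A ++ (bigon i e ++ B)) (A.length + 1) =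
    width (A ++ (bigon i e ++ B)) A.length := width_succ (getElem?_bigon_low A B i e)
  have h3 : width (A ++ (bigon i e ++ B)) (A.length + 2) =
    width (A ++ (bigon i e ++ B)) (A.length + 1) := width_succ (getElem?_bigon_high A B i e)
  have hlen : (bigon i e).length = 2 := rfl
  refine ⟨by simp only [List.length_append]; omega, ?_⟩
  simp only
  interval_cases m
  · rw [Nat.add_zero]; omega
  · omega
  · omega

/-- The point of the bigon at level `A.length + m` on the strand `x`. -/
def bigonPoint (hL : IsLinkDiagram (A ++ (bigon i e ++ B))) (m : Fin 3) (x : Fin 2) :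
    Point (A ++ (bigon i e ++ B)) :=
  (bigon_onDiagram hL (x := i + x) (m := m) (by omega) (by omega)).point

theorem bigon_conn_iff (hL : IsLinkDiagram (A ++ (bigon i e ++ B)))
    {s t : State (A ++ (bigon i e ++ B))}
    (hst : s ∘ liftCrossing A (bigon i e) B = t ∘ liftCrossing A (bigon i e) B)
    (hs : e = s (bigonLow A B i e) ∨ (!e) = s (bigonHigh A B i e))
    (ht : e = t (bigonLow A B i e) ∨ (!e) = t (bigonHigh A B i e))
    {P Q : Point (A ++ (bigon i e ++ B))}
    (hP : P.coord.1 ≤ A.length ∨ A.length + 2 ≤ P.coord.1)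
    (hQ : Q.coord.1 ≤ A.length ∨ A.length + 2 ≤ Q.coord.1) :
    SameLoop s P Q ↔ SameLoop t P Q := by
  rw [hL.sameLoop_iff, hL.sameLoop_iff]
  have hbits : ∀ m, m ≠ A.length → m ≠ A.length + 1 → bits s m = bits t m := by
    intro m h0 h1
    refine bits_congr fun c hc => ?_
    have : c ∈ Set.range (liftCrossing A (bigon i e) B) := by
      rw [mem_range_liftCrossing]
      have hlen : (bigon i e).length = 2 := rfl
      omega
    obtain ⟨c', rfl⟩ := this
    exact congrFun hst c'
  rw [← bits_bigonLow s, ← bits_bigonHigh s] at hs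
  rw [← bits_bigonLow t, ← bits_bigonHigh t] at ht
  exact ⟨bigon_conn_mono (fun m h h' => (hbits m h h').symm) hs ht (by omega) (by omega),
    bigon_conn_mono hbits ht hs (by omega) (by omega)⟩

theorem bigon_not_sameLoop (hL : IsLinkDiagram (A ++ (bigon i e ++ B)))
    {s : State (A ++ (bigon i e ++ B))}
    (hs : s (bigonLow A B i e) = e ∧ s (bigonHigh A B i e) = !e) {P : Point (A ++ (bigon i e ++ B))}
    (hP : P.coord.1 ≤ A.length ∨ A.length + 2 ≤ P.coord.1) :
    ¬ SameLoop s (bigonPoint hL 1 0) P := by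
  rw [hL.sameLoop_iff]
  rw [← bits_bigonLow s, ← bits_bigonHigh s] at hs
  intro h
  have := (bigon_isolated hs.1.symm hs.2.symm h).1
  omega

/-- A horizontal crossing joins the two middle points, so at most one loop is hidden inside the
bigon. -/
theorem bigon_cover (hL : IsLinkDiagram (A ++ (bigon i e ++ B)))
    {s : State (A ++ (bigon i e ++ B))}
    (hs : e = s (bigonLow A B i e) ∨ (!e) = s (bigonHigh A B i e))
    (P : Point (A ++ (bigon i e ++ B))) :
    SameLoop s (bigonPoint hL 1 0) P ∨ ∃ Q : Point (A ++ (bigon i e ++ B)),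
      (Q.coord.1 ≤ A.length ∨ A.length + 2 ≤ Q.coord.1) ∧ SameLoop s Q P := by
  by_cases h : P.coord.1 ≤ A.length ∨ A.length + 2 ≤ P.coord.1
  · exact .inr ⟨P, h, .refl _⟩
  · obtain ⟨l, x, hP⟩ : ∃ l x, P.coord = (l, x) := ⟨_, _, rfl⟩
    rw [hP] at h
    obtain rfl : l = A.length + 1 := by simp only at h; omega
    rw [← bits_bigonLow s, ← bits_bigonHigh s] at hs
    by_cases h0 : x = i
    · subst h0
      left
      rw [hL.sameLoop_iff, hP]
      exact .refl _
    · by_cases h1 : x = i + 1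
      · subst h1
        left
        rw [hL.sameLoop_iff, hP]
        exact bigon_mid hs
      · right
        have hc : Conn (A ++ (bigon i e ++ B)) (bits s) (A.length, x) (A.length + 1, x) :=
          .of_arc (getElem?_bigon_low A B i e) (.away h0 h1)
        have hx := (hL.onDiagram_conn hc).2 (hP ▸ P.onDiagram)
        exact ⟨hx.point, .inl le_rfl, (hL.sameLoop_iff s _ _).2 (by rw [hP]; exact hc)⟩

theorem bigon_vertical {s : State (A ++ (bigon i e ++ B))}
    (hs : s (bigonLow A B i e) = !e ∧ s (bigonHigh A B i e) = e) :
    VerticalAt A.length (bigon i e) (bits s) := by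
  rw [← bits_bigonLow s, ← bits_bigonHigh s] at hs
  intro m σ hm
  have hm2 := (List.getElem?_eq_some_iff.1 hm).1
  have hlen : (bigon i e).length = 2 := rfl
  rw [hlen] at hm2
  interval_cases m
  · simp only [bigon, List.getElem?_cons_zero, Option.some.injEq] at hm
    subst hm
    refine ⟨i, e, rfl, ?_⟩
    rw [Nat.add_zero, hs.1]
    cases e <;> decide
  · simp only [bigon, List.getElem?_cons_zero, List.getElem?_cons_succ, Option.some.injEq] at hm
    subst hm
    refine ⟨i, !e, rfl, ?_⟩
    rw [hs.2]
    cases e <;> decide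

end BigonDiagram

/-- The conditions of a saddle involve only its ends and the points that survive it, so `R` may be
altered at other points, such as those of a small loop. -/
theorem SaddlePair.congr_left {P P' : Type} {R R2 : P → P → Prop} {R' : P' → P' → Prop}
    {same : P → P' → Prop} {a b : P} {a' b' : P'} (S : SaddlePair R R' same a b a' b')
    (O : P → Prop) (hO : ∀ p p', same p p' → O p) (ha : O a) (hb : O b)
    (h : ∀ p q, O p → O q → (R2 p q ↔ R p q)) : SaddlePair R2 R' same a b a' b' := by
  refine ⟨(h a b ha hb).trans S.xor, fun p q p' q' hp hq => ?_, fun p p' hp => ?_, S.cover⟩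
  · have hp' := hO p p' hp
    have hq' := hO q q' hq
    rw [← S.join p q p' q' hp hq]
    unfold Joined
    rw [h p q hp' hq', h p a hp' ha, h p b hp' hb, h q a hq' ha, h q b hq' hb]
  · have hp' := hO p p' hp
    rw [← S.touch p p' hp, h p a hp' ha, h p b hp' hb]

/-! ### The saddle in the second Reidemeister map -/

section BigonSaddle

variable {A B : List Slice} {i : ℕ} {e : Bool}

theorem comp_lift_bigon_congr {s t : State (A ++ (bigon i e ++ B))}
    (h : ∀ c, c ≠ bigonLow A B i e → c ≠ bigonHigh A B i e → s c = t c) :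
    s ∘ liftCrossing A (bigon i e) B = t ∘ liftCrossing A (bigon i e) B := by
  ext c'
  exact h _ (liftCrossing_ne_bigon c').1 (liftCrossing_ne_bigon c').2

theorem bigonFoot_onDiagram (hL : IsLinkDiagram (A ++ (bigon i e ++ B))) (x : Fin 2) :
    OnDiagram (A ++ B) (A.length, i + x) := by
  have h := bigon_onDiagram hL (x := i + x) (m := 0) (by omega) (by omega)
  exact onDiagram_of_outer (M := bigon i e) (M' := []) rfl ⟨rfl, .inl ⟨le_rfl, rfl⟩⟩ h

/-- The points of the smaller diagram at the place of the bigon. -/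
def bigonFoot (hL : IsLinkDiagram (A ++ (bigon i e ++ B))) (x : Fin 2) : Point (A ++ B) :=
  (bigonFoot_onDiagram hL x).point

theorem samePoint_bigonFoot (hL : IsLinkDiagram (A ++ (bigon i e ++ B))) (x : Fin 2) :
    SamePoint A.length 2 0 (bigonPoint hL 0 x) (bigonFoot hL x) :=
  ⟨rfl, .inl ⟨le_rfl, rfl⟩⟩

/-- Between outer points, the horizontal state `s` looks like the state `m` in which only the lower
crossing is vertical, and the diagram without the bigon looks like the vertical state `v`. The
saddle is thus the reverse of the change of the upper crossing from `v` to `m`, to which planarity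
applies. -/
theorem bigon_saddlePair (hL : IsLinkDiagram (A ++ (bigon i e ++ B)))
    (hN : IsLinkDiagram (A ++ B)) {s : State (A ++ (bigon i e ++ B))}
    (hs : s (bigonLow A B i e) = e ∧ s (bigonHigh A B i e) = !e) :
    SaddlePair (SameLoop s) (SameLoop (s ∘ liftCrossing A (bigon i e) B)) (SamePoint A.length 2 0)
      (bigonPoint hL 0 0) (bigonPoint hL 2 0) (bigonFoot hL 0) (bigonFoot hL 1) := by
  have hne := bigonLow_ne_high (A := A) (B := B) (i := i) (e := e)
  set m : State (A ++ (bigon i e ++ B)) := Function.update s (bigonLow A B i e) (!e) with hm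
  set v : State (A ++ (bigon i e ++ B)) := Function.update m (bigonHigh A B i e) e with hv
  have hm0 : m (bigonLow A B i e) = !e := Function.update_self _ _ _
  have hm1 : m (bigonHigh A B i e) = !e := by rw [hm, Function.update_of_ne hne.symm, hs.2]
  have hv0 : v (bigonLow A B i e) = !e := by rw [hv, Function.update_of_ne hne, hm0]
  have hv1 : v (bigonHigh A B i e) = e := Function.update_self _ _ _
  have hms : m ∘ liftCrossing A (bigon i e) B = s ∘ liftCrossing A (bigon i e) B :=
    comp_lift_bigon_congr fun c h _ => Function.update_of_ne h _ _
  have hvs : v ∘ liftCrossing A (bigon i e) B = s ∘ liftCrossing A (bigon i e) B := by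
    rw [← hms]
    exact comp_lift_bigon_congr fun c _ h => Function.update_of_ne h _ _
  have hlv : e ≠ bits v A.length := by
    rw [bits_bigonLow, hv0]; cases e <;> decide
  have hhv : (!e) ≠ bits v (A.length + 1) := by
    rw [bits_bigonHigh, hv1]; cases e <;> decide
  have hlm : e ≠ bits m A.length := by
    rw [bits_bigonLow, hm0]; cases e <;> decide
  have hhm : (!e) = bits m (A.length + 1) := by rw [bits_bigonHigh, hm1]
  have S := hL.saddlePair (s := v) (s' := m) (c := bigonHigh A B i e)
    (getElem?_bigon_high A B i e) (fun c hc => (Function.update_of_ne hc _ _).symm)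
    (by rw [hm1, hv1]; cases e <;> decide) (a := bigonPoint hL 1 0) (b := bigonPoint hL 2 1) rfl rfl
  have hleft : ∀ {t : State (A ++ (bigon i e ++ B))}, e ≠ bits t A.length → ∀ x : Fin 2,
      SameLoop t (bigonPoint hL 0 x) (bigonPoint hL 1 x) := fun h x =>
    (hL.sameLoop_iff _ _ _).2 (bigon_vert_low h)
  have hright : ∀ x : Fin 2, SameLoop v (bigonPoint hL 1 x) (bigonPoint hL 2 x) := fun x =>
    (hL.sameLoop_iff _ _ _).2 (bigon_vert_high hhv)
  -- The corners of the upper crossing are slid to outer ends of the bigon, since the middle points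
  -- have no counterpart in the smaller diagram.
  have S' : SaddlePair (SameLoop v) (SameLoop m) Eq (bigonPoint hL 0 1) (bigonPoint hL 2 0)
      (bigonPoint hL 0 1) (bigonPoint hL 2 0) := by
    refine S.change (sameLoop_equivalence _) (sameLoop_equivalence _) (.inr ⟨hright 0, ?_⟩)
      (.inl ⟨?_, ?_⟩)
    · exact (sameLoop_equivalence _).symm ((hleft hlv 1).trans _ _ _ (hright 1))
    · refine (sameLoop_equivalence _).symm ?_
      refine (hleft hlm 1).trans _ _ _ ((sameLoop_equivalence _).symm ?_)
      exact (hL.sameLoop_iff _ _ _).2 (bigon_mid (.inr hhm))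
    · refine (sameLoop_equivalence _).symm ?_
      exact (hL.sameLoop_iff _ _ _).2 (bigon_top (.inr hhm))
  have S'' := SaddlePair.of_return (a := bigonPoint hL 0 0) (a' := bigonFoot hL 0)
    (same := SamePoint A.length 2 0) (R' := SameLoop (s ∘ liftCrossing A (bigon i e) B))
    (b' := bigonFoot hL 1)
    (sameLoop_equivalence m) (sameLoop_equivalence v) (sameLoop_equivalence _) S'
    ((hL.sameLoop_iff _ _ _).2 (bigon_bottom (.inr hhm)))
    ((hleft hlv 0).trans _ _ _ (hright 0)) (samePoint_bigonFoot hL 0) (samePoint_bigonFoot hL 1)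
    ((sameLoop_equivalence _).refl _) ?_ ?_
  · refine S''.congr_left (fun P => P.coord.1 ≤ A.length ∨ A.length + 2 ≤ P.coord.1)
      (fun P P' h => h.level) (.inl le_rfl) (.inr le_rfl) fun P Q hP hQ => ?_
    exact bigon_conn_iff hL hms.symm (.inl hs.1.symm) (.inr hm1.symm) hP hQ
  · intro P Q P' Q' hP hQ
    rw [← hvs]
    exact (bigon_vertical ⟨hv0, hv1⟩).sameLoop_iff hL hN hP hQ
  · intro P'
    obtain ⟨P, hP⟩ := exists_samePoint_of_removal (M := bigon i e) rfl P'
    exact .inr ⟨P, P', hP, .refl _⟩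

end BigonSaddle

/-! ## The second Reidemeister move -/

section RII

variable {A B : List Slice} {i : ℕ} {e : Bool}

/-- The first part of the map of the second Reidemeister move. -/
noncomputable def bigonKeep (A B : List Slice) (i : ℕ) (e : Bool) :
    Chain (A ++ (bigon i e ++ B)) →ₗ[ℚ] Chain (A ++ B) :=
  keepType (fun x => x.smoothing (bigonLow A B i e) = !e ∧ x.smoothing (bigonHigh A B i e) = e)
    (· ∘ liftCrossing A (bigon i e) B) (SamePoint A.length 2 0)

/-- The second part of the map of the second Reidemeister move. -/
noncomputable def bigonSaddle (hL : IsLinkDiagram (A ++ (bigon i e ++ B))) :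
    Chain (A ++ (bigon i e ++ B)) →ₗ[ℚ] Chain (A ++ B) :=
  saddleType (fun x => (x.smoothing (bigonLow A B i e) = e ∧
      x.smoothing (bigonHigh A B i e) = !e) ∧ x.mark (bigonPoint hL 1 0) = .minus)
    (· ∘ liftCrossing A (bigon i e) B) (SamePoint A.length 2 0) (bigonPoint hL 0 0)
    (bigonPoint hL 2 0) (bigonFoot hL 0) (bigonFoot hL 1)

/-- The sign of the map of the second Reidemeister move, as a function of the state. -/
def signAbove {L : List Slice} (k : ℕ) (s : State L) : ℚ :=
  (-1) ^ (Finset.univ.filter fun c : Crossing L => k + 1 < c.idx ∧ s c = true).card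

theorem rIIMap_gen (hL : IsLinkDiagram (A ++ (bigon i e ++ B)))
    (x : EState (A ++ (bigon i e ++ B))) :
    rIIMap (A ++ (bigon i e ++ B)) (A ++ B) A.length i e (gen x) =
      signAbove A.length x.smoothing • (bigonKeep A B i e - bigonSaddle hL) (gen x) := by
  classical
  unfold rIIMap bigonKeep bigonSaddle keepType saddleType
  rw [LinearMap.sub_apply, ofCoeff_gen, ofCoeff_gen, ofCoeff_gen]
  ext y
  rw [Pi.smul_apply, Pi.sub_apply, smul_eq_mul]
  have h1 : SameSmoothing A.length 2 0 x.smoothing y.smoothing ↔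
      y.smoothing = x.smoothing ∘ liftCrossing A (bigon i e) B :=
    sameSmoothing_removal_iff (M := bigon i e)
  have h2 : ∀ b : Bool, (∀ c : Crossing (A ++ (bigon i e ++ B)), c.idx = A.length →
      x.smoothing c = b) ↔ x.smoothing (bigonLow A B i e) = b := fun b =>
    ⟨fun h => h _ rfl, fun h c hc => by
      rw [← h]; congr 1; exact Crossing.ext_idx hc⟩
  have h3 : ∀ b : Bool, (∀ c : Crossing (A ++ (bigon i e ++ B)), c.idx = A.length + 1 →
      x.smoothing c = b) ↔ x.smoothing (bigonHigh A B i e) = b := fun b =>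
    ⟨fun h => h _ rfl, fun h c hc => by
      rw [← h]; congr 1; exact Crossing.ext_idx hc⟩
  have h4 : (∀ P : Point (A ++ (bigon i e ++ B)), P.coord = (A.length + 1, i) →
      x.mark P = .minus) ↔ x.mark (bigonPoint hL 1 0) = .minus :=
    ⟨fun h => h _ rfl, fun h P hP => by
      rw [← h]; congr 1; exact Point.coord_injective hP⟩
  have key : ∀ {p q p' q' : Prop} (a : Decidable p) (b : Decidable q) (a' : Decidable p')
      (b' : Decidable q'), (p ↔ p') → (q ↔ q') →
      ((if p then (1 : ℚ) else 0) - if q then 1 else 0) =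
        (if p' then 1 else 0) - if q' then 1 else 0 := by
    intro p q p' q' _ _ _ _ h h'
    rw [if_congr h rfl rfl, if_congr h' rfl rfl]
  refine congrArg (signAbove A.length x.smoothing * ·) (key _ _ _ _ ?_ ?_)
  · unfold RIIRelVert
    rw [h1, h2, h3]
    unfold SameMark
    tauto
  · unfold RIIRelHor
    rw [h1, h2, h3, h4]
    constructor
    · rintro ⟨k1, k2, k3, k4, a, b, a', b', ha, hb, ha', hb', h⟩
      obtain rfl : a = bigonPoint hL 0 0 := Point.coord_injective ha
      obtain rfl : b = bigonPoint hL 2 0 := Point.coord_injective hb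
      obtain rfl : a' = bigonFoot hL 0 := Point.coord_injective ha'
      obtain rfl : b' = bigonFoot hL 1 := Point.coord_injective hb'
      exact ⟨⟨⟨k2, k3⟩, k4⟩, k1, h⟩
    · rintro ⟨⟨⟨k2, k3⟩, k4⟩, k1, h⟩
      exact ⟨k1, k2, k3, k4, _, _, _, _, rfl, rfl, rfl, rfl, h⟩

theorem bigonKeep_intertwines (hL : IsLinkDiagram (A ++ (bigon i e ++ B)))
    (hN : IsLinkDiagram (A ++ B)) {P : Point (A ++ (bigon i e ++ B))} {P' : Point (A ++ B)}
    (hP : SamePoint A.length 2 0 P P') : Intertwines (bigonKeep A B i e) P P' :=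
  keepType_intertwines (fun _ hx _ _ _ _ hP hQ => (bigon_vertical hx).sameLoop_iff hL hN hP hQ) hP
    fun _ _ => Iff.rfl

theorem bigonSaddle_intertwines (hL : IsLinkDiagram (A ++ (bigon i e ++ B)))
    (hN : IsLinkDiagram (A ++ B)) {P : Point (A ++ (bigon i e ++ B))} {P' : Point (A ++ B)}
    (hP : SamePoint A.length 2 0 P P') : Intertwines (bigonSaddle hL) P P' := by
  refine saddleType_intertwines (fun x hx => bigon_saddlePair hL hN hx.1) hP fun x v => ?_
  refine and_congr_right fun hx => ?_
  rw [EState.set_mark_of_not]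
  intro h
  exact bigon_not_sameLoop hL hx hP.level ((sameLoop_equivalence _).symm h)

theorem bigonKeep_gen {x : EState (A ++ (bigon i e ++ B))}
    (hx : x.smoothing (bigonLow A B i e) = !e ∧ x.smoothing (bigonHigh A B i e) = e)
    {y : EState (A ++ B)} (hy : y.smoothing = x.smoothing ∘ liftCrossing A (bigon i e) B)
    (hm : SameMark A.length 2 0 x.mark y.mark) : bigonKeep A B i e (gen x) = gen y := by
  refine keepType_gen hx (fun P' => ?_) hy hm
  obtain ⟨P, hP⟩ := exists_samePoint_of_removal (M := bigon i e) rfl P'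
  exact ⟨P, P', hP, .refl _⟩

theorem bigonKeep_of_not {x : EState (A ++ (bigon i e ++ B))}
    (hx : ¬ (x.smoothing (bigonLow A B i e) = !e ∧ x.smoothing (bigonHigh A B i e) = e)) :
    bigonKeep A B i e (gen x) = 0 := keepType_of_not hx

theorem bigonSaddle_of_not (hL : IsLinkDiagram (A ++ (bigon i e ++ B)))
    {x : EState (A ++ (bigon i e ++ B))}
    (hx : ¬ (x.smoothing (bigonLow A B i e) = e ∧ x.smoothing (bigonHigh A B i e) = !e)) :
    bigonSaddle hL (gen x) = 0 := saddleType_of_not fun h => hx h.1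

theorem bigonSaddle_plus (hL : IsLinkDiagram (A ++ (bigon i e ++ B)))
    (s : State (A ++ (bigon i e ++ B))) : bigonSaddle hL (gen (EState.plus s)) = 0 :=
  saddleType_of_not fun h => Mark.noConfusion h.2

theorem bigonSaddle_xOp_plus (hL : IsLinkDiagram (A ++ (bigon i e ++ B)))
    (hN : IsLinkDiagram (A ++ B)) {s : State (A ++ (bigon i e ++ B))}
    (hs : s (bigonLow A B i e) = e ∧ s (bigonHigh A B i e) = !e) :
    bigonSaddle hL (xOp (bigonPoint hL 1 0) (gen (EState.plus s))) =
      splitFactor (SameLoop s (bigonPoint hL 0 0) (bigonPoint hL 2 0)) (bigonFoot hL 0)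
        (bigonFoot hL 1) (gen (EState.plus (s ∘ liftCrossing A (bigon i e) B))) := by
  rw [xOp_gen_of_plus rfl]
  have hO : ∀ P : Point (A ++ (bigon i e ++ B)), (P.coord.1 ≤ A.length ∨ A.length + 2 ≤ P.coord.1) →
      ((EState.plus s).set (bigonPoint hL 1 0) .minus).mark P = .plus := by
    intro P hP
    rw [EState.set_mark_of_not _ (by exact bigon_not_sameLoop hL hs hP)]
    rfl
  exact saddleType_plus (x := (EState.plus s).set (bigonPoint hL 1 0) .minus)
    ⟨hs, EState.set_mark_self _ _ _⟩ (bigon_saddlePair hL hN hs) (fun P P' hP => hO P hP.level)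
    (hO _ (.inl le_rfl)) (hO _ (.inr le_rfl))

end RII

/-! ### The second Reidemeister map as a chain map -/

section RIIChain

variable {A B : List Slice} {i : ℕ} {e : Bool}

theorem flip_lift_bigon (c' : Crossing (A ++ B)) (s : State (A ++ (bigon i e ++ B))) :
    flip (liftCrossing A (bigon i e) B c') s (bigonLow A B i e) = s (bigonLow A B i e) ∧
      flip (liftCrossing A (bigon i e) B c') s (bigonHigh A B i e) = s (bigonHigh A B i e) :=
  ⟨flip_of_ne (liftCrossing_ne_bigon c').1.symm s, flip_of_ne (liftCrossing_ne_bigon c').2.symm s⟩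

theorem exists_samePoint_bigon (P : Point (A ++ (bigon i e ++ B)))
    (h : P.coord.1 ≤ A.length ∨ A.length + 2 ≤ P.coord.1) :
    ∃ P' : Point (A ++ B), SamePoint A.length 2 0 P P' :=
  exists_samePoint_of_outer (M := bigon i e) rfl P h

theorem bigonKeep_comm (hL : IsLinkDiagram (A ++ (bigon i e ++ B))) (hN : IsLinkDiagram (A ++ B))
    (c' : Crossing (A ++ B)) (x : EState (A ++ (bigon i e ++ B))) :
    bigonKeep A B i e (edgeMap (liftCrossing A (bigon i e) B c') (gen x)) =
      edgeMap c' (bigonKeep A B i e (gen x)) := by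
  have hc := liftCrossing_spec (M := bigon i e) c'
  have hlow := hc.samePoint_lower (M' := []) hL hN
  have hupp := hc.samePoint_upper (M' := []) hL hN
  have hflip := flip_lift_bigon (i := i) (e := e) c'
  refine comm_edgeMap_outer hL hN (same := SamePoint A.length 2 0)
    (g := (· ∘ liftCrossing A (bigon i e) B)) (u := LinearMap.id)
    (fun s => s (bigonLow A B i e) = !e ∧ s (bigonHigh A B i e) = e)
    (fun P P' hP => bigonKeep_intertwines hL hN hP) supportedOn_keepType (fun s => rfl)
    (fun s => by rw [(hflip s).1, (hflip s).2]) (fun x hx => bigonKeep_of_not hx) hlow hupp ?_ ?_ x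
  · intro x hx hO
    refine .inl (congrArg gen (eq_plus (O := fun P => P.coord.1 ≤ A.length ∨
      A.length + 2 ≤ P.coord.1) ?_ ((bigon_vertical hx).cover hL)))
    intro P hP
    obtain ⟨P', hP'⟩ := exists_samePoint_bigon P hP
    exact hO P P' hP'
  · intro s hs hsc
    refine comm_edgeMap_of_keep hL hN (g := (· ∘ liftCrossing A (bigon i e) B))
      (same := SamePoint A.length 2 0) hsc hsc (flip_comp_liftCrossing c' s)
      (fun P P' hP => bigonKeep_intertwines hL hN hP) (fun P φ => rfl) (fun φ => rfl)
      (fun P Q P' Q' hP hQ => (bigon_vertical hs).sameLoop_iff hL hN hP hQ) ?_ hlow hupp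
    rintro t (rfl | rfl)
    · exact bigonKeep_gen hs rfl fun _ _ _ => rfl
    · exact bigonKeep_gen (x := EState.plus (flip (liftCrossing A (bigon i e) B c') s))
        ⟨(hflip s).1.trans hs.1, (hflip s).2.trans hs.2⟩ rfl fun _ _ _ => rfl

theorem bigonSaddle_comm (hL : IsLinkDiagram (A ++ (bigon i e ++ B)))
    (hN : IsLinkDiagram (A ++ B))
    (c' : Crossing (A ++ B)) (x : EState (A ++ (bigon i e ++ B))) :
    bigonSaddle hL (edgeMap (liftCrossing A (bigon i e) B c') (gen x)) =
      edgeMap c' (bigonSaddle hL (gen x)) := by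
  have hc := liftCrossing_spec (M := bigon i e) c'
  have hlow := hc.samePoint_lower (M' := []) hL hN
  have hupp := hc.samePoint_upper (M' := []) hL hN
  have hflip := flip_lift_bigon (i := i) (e := e) c'
  refine comm_edgeMap_outer hL hN (same := SamePoint A.length 2 0)
    (g := (· ∘ liftCrossing A (bigon i e) B)) (u := xOp (bigonPoint hL 1 0))
    (fun s => s (bigonLow A B i e) = e ∧ s (bigonHigh A B i e) = !e)
    (fun P P' hP => bigonSaddle_intertwines hL hN hP) supportedOn_saddleType (fun s => rfl)
    (fun s => by rw [(hflip s).1, (hflip s).2]) (fun x hx => bigonSaddle_of_not hL hx) hlow hupp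
    ?_ ?_ x
  · intro x hx hO
    have hO' : ∀ P : Point (A ++ (bigon i e ++ B)),
        (P.coord.1 ≤ A.length ∨ A.length + 2 ≤ P.coord.1) → x.mark P = .plus := by
      intro P hP
      obtain ⟨P', hP'⟩ := exists_samePoint_bigon P hP
      exact hO P P' hP'
    rcases gen_eq_plus_or hO' (bigon_cover hL (.inl hx.1.symm)) with h | h
    · exact .inl h
    · exact .inr ⟨h, fun t _ => bigonSaddle_plus hL t⟩
  · intro s hs hsc
    have hs' : ∀ t, t = s ∨ t = flip (liftCrossing A (bigon i e) B c') s →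
        t (bigonLow A B i e) = e ∧ t (bigonHigh A B i e) = !e := by
      rintro t (rfl | rfl)
      · exact hs
      · exact ⟨(hflip s).1.trans hs.1, (hflip s).2.trans hs.2⟩
    exact comm_edgeMap_of_saddle hL hN (g := (· ∘ liftCrossing A (bigon i e) B))
      (same := SamePoint A.length 2 0) hsc hsc (flip_comp_liftCrossing c' s)
      (fun P P' hP => bigonSaddle_intertwines hL hN hP) (fun P => xOp_intertwines _ P)
      (fun φ => hL.edgeMap_intertwines _ _ φ)
      (fun t ht => bigon_saddlePair hL hN (hs' t ht))
      (fun t ht => bigonSaddle_xOp_plus hL hN (hs' t ht)) hlow hupp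

theorem flip_bigon_comp_lift {c : Crossing (A ++ (bigon i e ++ B))}
    (hc : c = bigonLow A B i e ∨ c = bigonHigh A B i e) (s : State (A ++ (bigon i e ++ B))) :
    flip c s ∘ liftCrossing A (bigon i e) B = s ∘ liftCrossing A (bigon i e) B := by
  refine comp_lift_bigon_congr fun d h0 h1 => flip_of_ne ?_ s
  rcases hc with rfl | rfl <;> assumption

theorem splitFactor_plus_congr {L : List Slice} {s : State L} {p : Prop} {a b c d : Point L}
    (h : SameLoop s a c) (h' : SameLoop s b d) :
    splitFactor p a b (gen (EState.plus s)) = splitFactor p c d (gen (EState.plus s)) := by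
  unfold splitFactor
  rw [xOp_plus_congr h, xOp_plus_congr h']

/-- The two ways through the bigon cancel. -/
theorem bigon_cancel (hL : IsLinkDiagram (A ++ (bigon i e ++ B))) (hN : IsLinkDiagram (A ++ B))
    {x : EState (A ++ (bigon i e ++ B))} (h0 : x.smoothing (bigonLow A B i e) = false)
    (h1 : x.smoothing (bigonHigh A B i e) = false) {cv ch : Crossing (A ++ (bigon i e ++ B))}
    -- With both crossings `0`-smoothed, changing `cv` leads to the vertical state and changing `ch`
    -- to the horizontal one.
    (hcv : cv = if e then bigonHigh A B i e else bigonLow A B i e)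
    (hch : ch = if e then bigonLow A B i e else bigonHigh A B i e) :
    bigonKeep A B i e (edgeMap cv (gen x)) = bigonSaddle hL (edgeMap ch (gen x)) := by
  have hne := bigonLow_ne_high (A := A) (B := B) (i := i) (e := e)
  refine eq_of_intertwines (F := bigonKeep A B i e ∘ₗ edgeMap cv)
    (G := bigonSaddle hL ∘ₗ edgeMap ch)
    (fun P => P.coord.1 ≤ A.length ∨ A.length + 2 ≤ P.coord.1) ?_ x.smoothing ?_ x rfl
  · intro P hP
    obtain ⟨P', hP'⟩ := exists_samePoint_bigon P hP
    exact ⟨P', (bigonKeep_intertwines hL hN hP').comp (hL.edgeMap_intertwines cv P),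
      (bigonSaddle_intertwines hL hN hP').comp (hL.edgeMap_intertwines ch P)⟩
  intro y hy hO
  generalize x.smoothing = s at h0 h1 hy
  have hsome : e = s (bigonLow A B i e) ∨ (!e) = s (bigonHigh A B i e) := by
    rw [h0, h1]; cases e <;> decide
  have hmid : ∀ t : State (A ++ (bigon i e ++ B)),
      (e = t (bigonLow A B i e) ∨ (!e) = t (bigonHigh A B i e)) →
      SameLoop t (bigonPoint hL 1 0) (bigonPoint hL 1 1) := fun t ht =>
    (hL.sameLoop_iff _ _ _).2 (bigon_mid (by rwa [bits_bigonLow, bits_bigonHigh]))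
  have hleft : ∀ t : State (A ++ (bigon i e ++ B)), e ≠ t (bigonLow A B i e) →
      ∀ x : Fin 2, SameLoop t (bigonPoint hL 0 x) (bigonPoint hL 1 x) := fun t h x =>
    (hL.sameLoop_iff _ _ _).2 (bigon_vert_low (by rwa [bits_bigonLow]))
  have hright : ∀ t : State (A ++ (bigon i e ++ B)), (!e) ≠ t (bigonHigh A B i e) →
      ∀ x : Fin 2, SameLoop t (bigonPoint hL 1 x) (bigonPoint hL 2 x) := fun t h x =>
    (hL.sameLoop_iff _ _ _).2 (bigon_vert_high (by rwa [bits_bigonHigh]))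
  have htop : ∀ t : State (A ++ (bigon i e ++ B)),
      (e = t (bigonLow A B i e) ∨ (!e) = t (bigonHigh A B i e)) →
      SameLoop t (bigonPoint hL 2 0) (bigonPoint hL 2 1) := fun t ht =>
    (hL.sameLoop_iff _ _ _).2 (bigon_top (by rwa [bits_bigonLow, bits_bigonHigh]))
  -- One of the two crossings is vertical here, so no loop is enclosed in the bigon, and marks `v₊`
  -- outside force marks `v₊` everywhere.
  have hplus : y = EState.plus s := by
    rw [← hy]
    refine eq_plus hO fun P => ?_
    rcases bigon_cover hL (s := y.smoothing) (by rw [hy]; exact hsome) P with h | h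
    · by_cases he : e = true
      · exact ⟨bigonPoint hL 0 0, .inl le_rfl,
          (hleft _ (by rw [hy, h0, he]; decide) 0).trans _ _ _ h⟩
      · refine ⟨bigonPoint hL 2 0, .inr le_rfl,
          ((sameLoop_equivalence _).symm (hright _ ?_ 0)).trans _ _ _ h⟩
        rw [hy, h1]; simpa using he
    · exact h
  rw [hplus, LinearMap.comp_apply, LinearMap.comp_apply]
  have hlow0 : hL.lower (bigonLow A B i e) = bigonPoint hL 0 0 :=
    Point.coord_injective (hL.coord_lower (getElem?_bigon_low A B i e))
  have hlow1 : hL.upper (bigonLow A B i e) = bigonPoint hL 1 1 :=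
    Point.coord_injective (hL.coord_upper (getElem?_bigon_low A B i e))
  have hhigh0 : hL.lower (bigonHigh A B i e) = bigonPoint hL 1 0 :=
    Point.coord_injective (hL.coord_lower (getElem?_bigon_high A B i e))
  have hhigh1 : hL.upper (bigonHigh A B i e) = bigonPoint hL 2 1 :=
    Point.coord_injective (hL.coord_upper (getElem?_bigon_high A B i e))
  -- Through the vertical state: the result is the factor of the edge, carried to the two strands
  -- that replace the bigon.
  have hV : ∀ c : Crossing (A ++ (bigon i e ++ B)), (c = bigonLow A B i e ∨ c = bigonHigh A B i e) →
      s c = false →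
      (flip c s (bigonLow A B i e) = !e ∧ flip c s (bigonHigh A B i e) = e) →
      SameLoop (flip c s) (hL.lower c) (bigonPoint hL 0 0) →
      SameLoop (flip c s) (hL.upper c) (bigonPoint hL 0 1) →
      bigonKeep A B i e (edgeMap c (gen (EState.plus s))) =
        splitFactor (SameLoop s (hL.lower c) (hL.upper c)) (bigonFoot hL 0) (bigonFoot hL 1)
          (gen (EState.plus (s ∘ liftCrossing A (bigon i e) B))) := by
    intro c hc hs hf k0 k1
    have e1 := bigonKeep_gen (x := EState.plus (flip c s))
      (y := EState.plus (s ∘ liftCrossing A (bigon i e) B)) hf (flip_bigon_comp_lift hc s).symm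
      fun _ _ _ => rfl
    rw [hL.edgeMap_plus hs, splitFactor_plus_congr k0 k1,
      (bigonKeep_intertwines hL hN (samePoint_bigonFoot hL 0)).splitFactor
        (bigonKeep_intertwines hL hN (samePoint_bigonFoot hL 1)), e1]
  -- Through the horizontal state, where the edge cuts off the small loop: the term with `v₋` on it
  -- contributes the factor of the saddle, whose type can be read off in `s` because the outer
  -- connections agree.
  have hH : ∀ c : Crossing (A ++ (bigon i e ++ B)), (c = bigonLow A B i e ∨ c = bigonHigh A B i e) →
      (flip c s (bigonLow A B i e) = e ∧ flip c s (bigonHigh A B i e) = !e) →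
      bigonSaddle hL (xOp (bigonPoint hL 1 0) (gen (EState.plus (flip c s)))) =
        splitFactor (SameLoop s (bigonPoint hL 0 0) (bigonPoint hL 2 0)) (bigonFoot hL 0)
          (bigonFoot hL 1) (gen (EState.plus (s ∘ liftCrossing A (bigon i e) B))) := by
    intro c hc hf
    rw [bigonSaddle_xOp_plus hL hN hf, flip_bigon_comp_lift hc s]
    rw [propext (bigon_conn_iff hL (s := flip c s) (t := s) (flip_bigon_comp_lift hc s)
      (.inl hf.1.symm) hsome (P := bigonPoint hL 0 0) (Q := bigonPoint hL 2 0) (.inl le_rfl)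
      (.inr le_rfl))]
  -- The other term of that splitting has `v₊` on the small loop and is killed.
  have hO0 : ∀ (t : State (A ++ (bigon i e ++ B))) (P : Point (A ++ (bigon i e ++ B))),
      (P.coord.1 ≤ A.length ∨ A.length + 2 ≤ P.coord.1) →
      bigonSaddle hL (xOp P (gen (EState.plus t))) = 0 := by
    intro t P hP
    obtain ⟨P', hP'⟩ := exists_samePoint_bigon P hP
    rw [bigonSaddle_intertwines hL hN hP', bigonSaddle_plus, map_zero]
  have trans : ∀ (t : State (A ++ (bigon i e ++ B))) {P Q R : Point (A ++ (bigon i e ++ B))},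
      SameLoop t P Q → SameLoop t Q R → SameLoop t P R := fun t =>
    (sameLoop_equivalence t).trans
  have symm : ∀ (t : State (A ++ (bigon i e ++ B))) {P Q : Point (A ++ (bigon i e ++ B))},
      SameLoop t P Q → SameLoop t Q P := fun t => (sameLoop_equivalence t).symm
  by_cases he : e = true
  · have hlv : e ≠ s (bigonLow A B i e) := by rw [h0, he]; decide
    have hhv : (!e) = s (bigonHigh A B i e) := by rw [h1, he]; rfl
    rw [if_pos he] at hcv hch
    subst hcv hch
    have f0 : flip (bigonHigh A B i e) s (bigonLow A B i e) = !e := by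
      rw [flip_of_ne hne, h0, he]; rfl
    have f1 : flip (bigonHigh A B i e) s (bigonHigh A B i e) = e := by rw [flip_self, he]
    have g0 : flip (bigonLow A B i e) s (bigonLow A B i e) = e := by rw [flip_self, he]
    have g1 : flip (bigonLow A B i e) s (bigonHigh A B i e) = !e := by
      rw [flip_of_ne hne.symm, h1, he]; rfl
    have f0' : e ≠ flip (bigonHigh A B i e) s (bigonLow A B i e) := by
      rw [f0]; cases e <;> decide
    have f1' : (!e) ≠ flip (bigonHigh A B i e) s (bigonHigh A B i e) := by
      rw [f1]; cases e <;> decide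
    rw [hV _ (.inr rfl) h1 ⟨f0, f1⟩, hL.edgeMap_plus h0, hlow0, hlow1, hhigh0, hhigh1,
      splitFactor_pos (trans s (hleft s hlv 0) (hmid s hsome)), map_add,
      hO0 _ (bigonPoint hL 0 0) (.inl le_rfl),
      zero_add, ← xOp_plus_congr (hmid _ (.inl g0.symm)), hH _ (.inl rfl) ⟨g0, g1⟩]
    -- The edge at `cv` and the saddle join the same loops of `s`, so both merge or both split.
    · have : SameLoop s (bigonPoint hL 1 0) (bigonPoint hL 2 1) ↔
          SameLoop s (bigonPoint hL 0 0) (bigonPoint hL 2 0) :=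
        ⟨fun h => trans s (hleft s hlv 0) (trans s h (symm s (htop s hsome))),
          fun h => trans s (symm s (hleft s hlv 0)) (trans s h (htop s hsome))⟩
      rw [propext this]
    · rw [hhigh0]; exact symm _ (hleft _ f0' 0)
    · rw [hhigh1]; exact symm _ (trans _ (hleft _ f0' 1) (hright _ f1' 1))
  · have hef : e = false := by simpa using he
    have hlv : e = s (bigonLow A B i e) := by rw [h0, hef]
    have hhv : (!e) ≠ s (bigonHigh A B i e) := by rw [h1, hef]; decide
    rw [if_neg he] at hcv hch
    subst hcv hch
    have f0 : flip (bigonLow A B i e) s (bigonLow A B i e) = !e := by rw [flip_self, hef]; rfl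
    have f1 : flip (bigonLow A B i e) s (bigonHigh A B i e) = e := by
      rw [flip_of_ne hne.symm, h1, hef]
    have g0 : flip (bigonHigh A B i e) s (bigonLow A B i e) = e := by
      rw [flip_of_ne hne, h0, hef]
    have g1 : flip (bigonHigh A B i e) s (bigonHigh A B i e) = !e := by
      rw [flip_self, hef]; rfl
    have f0' : e ≠ flip (bigonLow A B i e) s (bigonLow A B i e) := by
      rw [f0]; cases e <;> decide
    rw [hV _ (.inl rfl) h0 ⟨f0, f1⟩, hL.edgeMap_plus h1, hlow0, hlow1, hhigh0, hhigh1,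
      splitFactor_pos (trans s (hmid s hsome) (hright s hhv 1)), map_add,
      hO0 _ (bigonPoint hL 2 1) (.inr le_rfl),
      add_zero, hH _ (.inr rfl) ⟨g0, g1⟩]
    · have e1 : SameLoop s (bigonPoint hL 1 1) (bigonPoint hL 2 0) :=
        trans s (hright s hhv 1) (symm s (htop s hsome))
      have : SameLoop s (bigonPoint hL 0 0) (bigonPoint hL 1 1) ↔
          SameLoop s (bigonPoint hL 0 0) (bigonPoint hL 2 0) :=
        ⟨fun h => trans s h e1, fun h => trans s h (symm s e1)⟩
      rw [propext this]
    · rw [hlow0]; exact (sameLoop_equivalence _).refl _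
    · rw [hlow1]; exact symm _ (hleft _ f0' 1)

theorem signAbove_flip {L : List Slice} {k : ℕ} {s : State L} {c : Crossing L}
    (hs : s c = false) :
    signAbove k (flip c s) = (if k + 1 < c.idx then -1 else 1) * signAbove k s := by
  classical
  unfold signAbove
  by_cases h : k + 1 < c.idx
  · rw [if_pos h]
    have : (Finset.univ.filter fun d : Crossing L => k + 1 < d.idx ∧ flip c s d = true) =
        insert c (Finset.univ.filter fun d : Crossing L => k + 1 < d.idx ∧ s d = true) := by
      ext d
      simp only [Finset.mem_filter, Finset.mem_univ, true_and, Finset.mem_insert]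
      by_cases hd : d = c
      · subst hd; simp [h]
      · rw [flip_of_ne hd]; simp [hd]
    rw [this, Finset.card_insert_of_notMem (by simp [hs]), pow_succ]
    ring
  · rw [if_neg h, one_mul]
    congr 2
    ext d
    simp only [Finset.mem_filter, Finset.mem_univ, true_and]
    refine and_congr_right fun h' => ?_
    rw [flip_of_ne]
    rintro rfl
    exact h h'

/-- The map vanishes unless exactly one crossing of the bigon is `1`-smoothed. Edges elsewhere
commute with both of its parts; the forgotten `1`-smoothing counts in the signs of the crossings
above, which `signAbove` compensates. Edges inside the bigon end in a state with two `1`-smoothings,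
which is killed, or start at two `0`-smoothings, where the two parts cancel. -/
theorem rIIMap_isChainMap (hL : IsLinkDiagram (A ++ (bigon i e ++ B)))
    (hN : IsLinkDiagram (A ++ B)) :
    IsChainMap (rIIMap (A ++ (bigon i e ++ B)) (A ++ B) A.length i e) := by
  classical
  set f := bigonKeep A B i e - bigonSaddle hL with hf
  have hne := bigonLow_ne_high (A := A) (B := B) (i := i) (e := e)
  have hfzero : ∀ x : EState (A ++ (bigon i e ++ B)),
      x.smoothing (bigonLow A B i e) = x.smoothing (bigonHigh A B i e) → f (gen x) = 0 := by
    intro x hx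
    rw [hf, LinearMap.sub_apply, bigonKeep_of_not, bigonSaddle_of_not, sub_zero]
    · rintro ⟨h0, h1⟩; rw [h0, h1] at hx; revert hx; cases e <;> decide
    · rintro ⟨h0, h1⟩; rw [h0, h1] at hx; revert hx; cases e <;> decide
  refine isChainMap_of_edges (f := f) (· ∘ liftCrossing A (bigon i e) B) (signAbove A.length)
    (liftCrossing A (bigon i e) B) liftCrossing_strictMono.injective (rIIMap_gen hL) ?_ ?_ ?_ ?_
  · intro x y hy
    rw [hf, LinearMap.sub_apply, Pi.sub_apply] at hy
    by_cases h : bigonKeep A B i e (gen x) y = 0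
    · rw [h, zero_sub, neg_ne_zero] at hy
      exact supportedOn_saddleType x y hy
    · exact supportedOn_keepType x y h
  · intro c' x
    rw [hf, LinearMap.sub_apply, LinearMap.sub_apply, bigonKeep_comm hL hN, bigonSaddle_comm hL hN,
      map_sub]
  · intro c' x hx hc
    rw [signAt_comp liftCrossing_strictMono, signAbove_flip hc]
    have hxor : x.smoothing (bigonLow A B i e) ≠ x.smoothing (bigonHigh A B i e) :=
      fun h => hx (hfzero x h)
    have hspec := liftCrossing_spec (M := bigon i e) c'
    have hlen : (bigon i e).length = 2 := rfl
    unfold SameCrossing at hspec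
    -- Exactly one crossing of the bigon is `1`-smoothed, and the whole bigon lies on one side of
    -- the crossing under consideration.
    have hcard : (Finset.univ.filter fun c : Crossing (A ++ (bigon i e ++ B)) =>
        c ∉ Set.range (liftCrossing A (bigon i e) B) ∧ c < liftCrossing A (bigon i e) B c' ∧
          x.smoothing c = true).card = if A.length + 1 < (liftCrossing A (bigon i e) B c').idx
            then 1 else 0 := by
      split_ifs with h
      · rw [Finset.card_eq_one]
        have hb : ∀ d : Crossing (A ++ (bigon i e ++ B)),
            (d = bigonLow A B i e ∨ d = bigonHigh A B i e) →
            d < liftCrossing A (bigon i e) B c' := by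
          rintro d (rfl | rfl)
          · rw [Crossing.lt_iff, bigonLow_idx]; omega
          · rw [Crossing.lt_iff, bigonHigh_idx]; omega
        by_cases h0 : x.smoothing (bigonLow A B i e) = true
        · have h1 : x.smoothing (bigonHigh A B i e) = false := by
            rw [h0] at hxor; simpa using hxor.symm
          refine ⟨bigonLow A B i e, ?_⟩
          ext d
          simp only [Finset.mem_filter, Finset.mem_univ, true_and, Finset.mem_singleton,
            not_mem_range_bigon]
          constructor
          · rintro ⟨rfl | rfl, -, hd⟩
            · rfl
            · rw [h1] at hd; exact absurd hd (by decide)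
          · rintro rfl
            exact ⟨.inl rfl, hb _ (.inl rfl), h0⟩
        · have h1 : x.smoothing (bigonHigh A B i e) = true := by
            have h0 : x.smoothing (bigonLow A B i e) = false := by simpa using h0
            rw [h0] at hxor; simpa using hxor.symm
          refine ⟨bigonHigh A B i e, ?_⟩
          ext d
          simp only [Finset.mem_filter, Finset.mem_univ, true_and, Finset.mem_singleton,
            not_mem_range_bigon]
          constructor
          · rintro ⟨rfl | rfl, -, hd⟩
            · exact absurd hd h0
            · rfl
          · rintro rfl
            exact ⟨.inr rfl, hb _ (.inr rfl), h1⟩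
      · rw [Finset.card_eq_zero, Finset.filter_eq_empty_iff]
        rintro d - ⟨hd, hlt, -⟩
        rw [not_mem_range_bigon] at hd
        rw [Crossing.lt_iff] at hlt
        rcases hd with rfl | rfl
        · rw [bigonLow_idx] at hlt; omega
        · rw [bigonHigh_idx] at hlt; omega
    rw [hcard]
    split_ifs <;> ring
  · intro x
    have hfilter : (Finset.univ.filter fun c : Crossing (A ++ (bigon i e ++ B)) =>
        c ∉ Set.range (liftCrossing A (bigon i e) B)) = {bigonLow A B i e, bigonHigh A B i e} := by
      ext c
      simp only [Finset.mem_filter, Finset.mem_univ, true_and, not_mem_range_bigon,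
        Finset.mem_insert, Finset.mem_singleton]
    rw [hfilter, Finset.sum_pair hne]
    have hzero : ∀ c : Crossing (A ++ (bigon i e ++ B)),
        flip c x.smoothing (bigonLow A B i e) = flip c x.smoothing (bigonHigh A B i e) →
        f (edgeMap c (gen x)) = 0 := by
      intro c hc
      have := (supportedOn_edgeMap c x).ext (F := f) (G := 0) fun y hy => by
        rw [hfzero y (by rw [hy, hc])]; rfl
      rw [this]; rfl
    by_cases h0 : x.smoothing (bigonLow A B i e) = true
    · rw [edgeMap_of_true h0, map_zero, smul_zero, zero_add,
        hzero _ (by rw [flip_self, flip_of_ne hne, h0]), smul_zero]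
    have h0 : x.smoothing (bigonLow A B i e) = false := by simpa using h0
    by_cases h1 : x.smoothing (bigonHigh A B i e) = true
    · rw [edgeMap_of_true h1, map_zero, smul_zero, add_zero,
        hzero _ (by rw [flip_self, flip_of_ne hne.symm, h1]), smul_zero]
    have h1 : x.smoothing (bigonHigh A B i e) = false := by simpa using h1
    -- The lower crossing is `0`-smoothed and no crossing lies between the two, so both edges carry
    -- the same sign.
    have hsign : signAt (bigonHigh A B i e) x.smoothing = signAt (bigonLow A B i e) x.smoothing := by
      unfold signAt
      congr 2
      ext d
      simp only [Finset.mem_filter, Finset.mem_univ, true_and]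
      refine and_congr_left fun hd => ?_
      rw [Crossing.lt_iff, Crossing.lt_iff, bigonHigh_idx, bigonLow_idx]
      have : d.idx ≠ A.length := by
        intro h
        have : d = bigonLow A B i e := Crossing.ext_idx h
        rw [this, h0] at hd
        exact absurd hd (by decide)
      omega
    rw [hsign, signAbove_flip h0, signAbove_flip h1, bigonLow_idx, bigonHigh_idx,
      if_neg (by omega), if_neg (by omega), ← smul_add]
    have hcancel := bigon_cancel hL hN h0 h1 rfl rfl
    have hkeep : ∀ c : Crossing (A ++ (bigon i e ++ B)),
        ¬ (flip c x.smoothing (bigonLow A B i e) = !e ∧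
          flip c x.smoothing (bigonHigh A B i e) = e) →
        bigonKeep A B i e (edgeMap c (gen x)) = 0 := by
      intro c hc
      have := (supportedOn_edgeMap c x).ext (F := bigonKeep A B i e) (G := 0) fun y hy => by
        rw [bigonKeep_of_not (by rwa [hy])]; rfl
      rw [this]; rfl
    have hsaddle : ∀ c : Crossing (A ++ (bigon i e ++ B)),
        ¬ (flip c x.smoothing (bigonLow A B i e) = e ∧
          flip c x.smoothing (bigonHigh A B i e) = !e) →
        bigonSaddle hL (edgeMap c (gen x)) = 0 := by
      intro c hc
      have := (supportedOn_edgeMap c x).ext (F := bigonSaddle hL) (G := 0) fun y hy => by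
        rw [bigonSaddle_of_not hL (by rwa [hy])]; rfl
      rw [this]; rfl
    have l0 : flip (bigonLow A B i e) x.smoothing (bigonHigh A B i e) = false := by
      rw [flip_of_ne hne.symm, h1]
    have l1 : flip (bigonHigh A B i e) x.smoothing (bigonLow A B i e) = false := by
      rw [flip_of_ne hne, h0]
    have hsum : f (edgeMap (bigonLow A B i e) (gen x)) +
        f (edgeMap (bigonHigh A B i e) (gen x)) = 0 := by
      rw [hf, LinearMap.sub_apply, LinearMap.sub_apply]
      by_cases he : e = true
      · rw [if_pos he, if_pos he] at hcancel
        rw [hkeep (bigonLow A B i e) (by rw [flip_self, l0, he]; decide),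
          hsaddle (bigonHigh A B i e) (by rw [flip_self, l1, he]; decide), hcancel]
        abel
      · rw [if_neg he, if_neg he] at hcancel
        have he : e = false := by simpa using he
        rw [hkeep (bigonHigh A B i e) (by rw [flip_self, l1, he]; decide),
          hsaddle (bigonLow A B i e) (by rw [flip_self, l0, he]; decide), hcancel]
        abel
    rw [hsum, smul_zero]

/-- At a vertical state only the part that keeps the marks is present; the sign left over is the one
that makes the move a chain map. -/
theorem rIIMap_gen_vertical (hL : IsLinkDiagram (A ++ (bigon i e ++ B)))
    {x : EState (A ++ (bigon i e ++ B))}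
    (hx : x.smoothing (bigonLow A B i e) = !e ∧ x.smoothing (bigonHigh A B i e) = e)
    {y : EState (A ++ B)} (hs : SameSmoothing A.length 2 0 x.smoothing y.smoothing)
    (hm : SameMark A.length 2 0 x.mark y.mark) :
    rIIMap (A ++ (bigon i e ++ B)) (A ++ B) A.length i e (gen x) = gen y ∨
      rIIMap (A ++ (bigon i e ++ B)) (A ++ B) A.length i e (gen x) = -gen y := by
  rw [rIIMap_gen hL, LinearMap.sub_apply,
    bigonKeep_gen hx (sameSmoothing_removal_iff (M := bigon i e).1 hs) hm, bigonSaddle_of_not,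
    sub_zero]
  · unfold signAbove
    rcases neg_one_pow_eq_or ℚ (Finset.univ.filter fun c : Crossing (A ++ (bigon i e ++ B)) =>
      A.length + 1 < c.idx ∧ x.smoothing c = true).card with h | h
    · rw [h, one_smul]; exact .inl rfl
    · rw [h, neg_smul, one_smul]; exact .inr rfl
  · rw [hx.1, hx.2]; cases e <;> decide

end RIIChain

theorem SamePoint.symm {L L' : List Slice} {k r t : ℕ} {P : Point L} {P' : Point L'}
    (h : SamePoint k r t P P') : SamePoint k t r P' P := Outer.symm h

/-! ## Collapsing crossings -/

section Collapse

variable {A M B : List Slice}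

/-- The level of the smaller diagram that belongs to a level of the larger diagram. -/
def collapseLevel (k r l : ℕ) : ℕ := if l ≤ k then l else if l ≤ k + r then k else l - r

theorem width_crossings (hM : ∀ σ ∈ M, σ.isCross = true) {m : ℕ} (hm : m ≤ M.length) :
    width (A ++ (M ++ B)) (A.length + m) = width A A.length := by
  rw [width_eq_outWidth, List.take_length_add_append, outWidth_append, width_eq_outWidth,
    List.take_length, List.take_append_of_le_length hm]
  exact outWidth_crossings (fun σ hσ => hM σ (List.mem_of_mem_take hσ)) _

theorem collapse_onDiagram (hM : ∀ σ ∈ M, σ.isCross = true) {p : ℕ × ℕ}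
    (hp : OnDiagram (A ++ (M ++ B)) p) :
    OnDiagram (A ++ B) (collapseLevel A.length M.length p.1, p.2) := by
  obtain ⟨l, x⟩ := p
  by_cases h1 : l ≤ A.length
  · have h' : Outer A.length M.length 0 (l, x) (collapseLevel A.length M.length l, x) :=
      ⟨rfl, .inl ⟨h1, if_pos h1⟩⟩
    exact onDiagram_of_outer (M := M) (M' := []) (outWidth_crossings hM _) h' hp
  · by_cases h2 : l ≤ A.length + M.length
    · obtain ⟨-, h⟩ := hp
      have e1 : collapseLevel A.length M.length l = A.length := by simp [collapseLevel, h1, h2]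
      obtain ⟨m, rfl⟩ : ∃ m, l = A.length + m := ⟨l - A.length, by omega⟩
      simp only at h ⊢
      rw [width_crossings hM (by omega)] at h
      rw [e1]
      refine ⟨by simp, ?_⟩
      simp only
      rw [width_append_of_le le_rfl]
      exact h
    · have h' : Outer A.length M.length 0 (l, x) (collapseLevel A.length M.length l, x) := by
        refine ⟨rfl, .inr ⟨by simp only; omega, ?_⟩⟩
        simp only [collapseLevel, h1, h2, if_false]
        omega
      exact onDiagram_of_outer (M := M) (M' := []) (outWidth_crossings hM _) h' hp

/-- The point of the smaller diagram, if the slices `M` consist of parallel strands. -/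
def collapse (hM : ∀ σ ∈ M, σ.isCross = true) (P : Point (A ++ (M ++ B))) : Point (A ++ B) :=
  (collapse_onDiagram hM P.onDiagram).point

theorem coord_collapse (hM : ∀ σ ∈ M, σ.isCross = true) (P : Point (A ++ (M ++ B))) :
    (collapse hM P).coord = (collapseLevel A.length M.length P.coord.1, P.coord.2) := rfl

theorem collapse_eq_of_samePoint (hM : ∀ σ ∈ M, σ.isCross = true) {P : Point (A ++ (M ++ B))}
    {P' : Point (A ++ B)} (h : SamePoint A.length M.length 0 P P') : collapse hM P = P' := by
  refine Point.coord_injective ?_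
  rw [coord_collapse]
  obtain ⟨h1, h2⟩ := h
  refine Prod.ext ?_ h1.symm
  simp only [collapseLevel]
  split_ifs <;> omega

theorem VerticalAt.collapse (hL : IsLinkDiagram (A ++ (M ++ B)))
    (hM : ∀ σ ∈ M, σ.isCross = true) {s : State (A ++ (M ++ B))}
    (hv : VerticalAt A.length M (bits s)) (P : Point (A ++ (M ++ B))) :
    ∃ Q : Point (A ++ (M ++ B)), SamePoint A.length M.length 0 Q (KhovanovQP.collapse hM P) ∧
      SameLoop s Q P := by
  by_cases h : P.coord.1 ≤ A.length ∨ A.length + M.length ≤ P.coord.1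
  · obtain ⟨P', hP'⟩ := exists_samePoint_of_outer (outWidth_crossings hM _) P h
    rw [collapse_eq_of_samePoint hM hP']
    exact ⟨P, hP', .refl _⟩
  · have hc := conn_vertical A M B (bits s) hv P.coord.2 (P.coord.1 - A.length) (by omega)
    have he : (A.length + (P.coord.1 - A.length), P.coord.2) = P.coord :=
      Prod.ext (by simp only; omega) rfl
    rw [he] at hc
    have hx := (hL.onDiagram_conn hc).2 P.onDiagram
    refine ⟨hx.point, ⟨rfl, .inl ⟨le_rfl, ?_⟩⟩, (hL.sameLoop_iff s _ _).2 hc⟩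
    rw [coord_collapse, OnDiagram.coord_point]
    simp only [collapseLevel]
    split_ifs <;> omega

/-- Each point slides along its vertical strand to an outer point with the same collapsed point,
which extends the comparison of loops from outer points to all points. -/
theorem VerticalAt.sameLoop_collapse_iff (hL : IsLinkDiagram (A ++ (M ++ B)))
    (hN : IsLinkDiagram (A ++ B)) (hM : ∀ σ ∈ M, σ.isCross = true) {s : State (A ++ (M ++ B))}
    (hv : VerticalAt A.length M (bits s)) (P Q : Point (A ++ (M ++ B))) :
    SameLoop s P Q ↔ SameLoop (s ∘ liftCrossing A M B) (KhovanovQP.collapse hM P)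
      (KhovanovQP.collapse hM Q) := by
  obtain ⟨P', hP, hP'⟩ := hv.collapse hL hM P
  obtain ⟨Q', hQ, hQ'⟩ := hv.collapse hL hM Q
  rw [← hv.sameLoop_iff hL hN hP hQ]
  exact ⟨fun h => hP'.trans _ _ _ (h.trans _ _ _ ((sameLoop_equivalence s).symm hQ')),
    fun h => ((sameLoop_equivalence s).symm hP').trans _ _ _ (h.trans _ _ _ hQ')⟩

/-- The marking of the larger diagram that comes from a marking of the smaller one. -/
def VerticalAt.pullback (hL : IsLinkDiagram (A ++ (M ++ B))) (hN : IsLinkDiagram (A ++ B))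
    (hM : ∀ σ ∈ M, σ.isCross = true) (s : State (A ++ (M ++ B)))
    (hv : VerticalAt A.length M (bits s)) (x : EState (A ++ B))
    (hx : x.smoothing = s ∘ liftCrossing A M B) : EState (A ++ (M ++ B)) where
  smoothing := s
  mark P := x.mark (KhovanovQP.collapse hM P)
  compat P Q h := by
    refine x.mark_eq ?_
    rw [hx]
    exact (hv.sameLoop_collapse_iff hL hN hM P Q).1 (.rel _ _ h)

end Collapse

/-! ## State cycles -/

theorem edgeMap_gen_eq_zero_iff {L : List Slice} (c : Crossing L) (x : EState L) :
    edgeMap c (gen x) = 0 ↔ ∀ y, ¬ EdgeRel c x y := by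
  classical
  unfold edgeMap
  rw [ofCoeff_gen]
  constructor
  · intro h y hy
    have := congrFun h y
    rw [if_pos hy] at this
    exact one_ne_zero this
  · intro h
    ext y
    rw [if_neg (h y)]
    rfl

/-- Edges at different crossings end in different states and their signs are nonzero, so nothing can
cancel in the differential of a generator. -/
theorem isStateCycle_iff {L : List Slice} (x : EState L) :
    IsStateCycle x ↔ ∀ c, edgeMap c (gen x) = 0 := by
  classical
  unfold IsStateCycle
  rw [differential_gen]
  constructor
  · intro h c
    by_contra hne
    obtain ⟨y, hy⟩ : ∃ y, edgeMap c (gen x) y ≠ 0 := by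
      by_contra! hall
      exact hne (funext hall)
    have hy1 := supportedOn_edgeMap c x y hy
    have hxc : x.smoothing c = false := by
      by_contra hxc
      rw [edgeMap_of_true (by simpa using hxc)] at hne
      exact hne rfl
    have h' := congrFun h y
    rw [Finset.sum_apply, Finset.sum_eq_single c] at h'
    · rw [Pi.smul_apply, smul_eq_mul] at h'
      rcases mul_eq_zero.1 h' with h' | h'
      · exact pow_ne_zero _ (by norm_num) h'
      · exact hy h'
    · intro d _ hd
      rw [Pi.smul_apply]
      by_contra h0
      have hd0 : edgeMap d (gen x) y ≠ 0 := fun h => h0 (by rw [h, smul_zero])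
      have := congrFun ((supportedOn_edgeMap d x y hd0).symm.trans hy1) c
      rw [flip_self, flip_of_ne hd.symm, hxc] at this
      exact Bool.noConfusion this
    · intro h; exact absurd (Finset.mem_univ c) h
  · intro h
    refine Finset.sum_eq_zero fun c _ => ?_
    rw [h c, smul_zero]

/-- A saddle that joins two loops marked by `v₋` is zero. -/
theorem IsLinkDiagram.edgeMap_eq_zero {L : List Slice} (hL : IsLinkDiagram L) {c : Crossing L}
    {x : EState L} (h : ¬ SameLoop x.smoothing (hL.lower c) (hL.upper c))
    (hl : x.mark (hL.lower c) = .minus) (hu : x.mark (hL.upper c) = .minus) :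
    edgeMap c (gen x) = 0 := by
  rw [edgeMap_gen_eq_zero_iff]
  intro y hy
  rw [hL.edgeRel_iff] at hy
  rcases hy.2.2.2 with ⟨h', -⟩ | ⟨-, h', -⟩
  · exact h h'
  · rw [hl, hu] at h'
    exact h'

section Transport

variable {A M B : List Slice}

/-- The edges outside of vertically smoothed crossings. -/
theorem edgeMap_eq_zero_of_collapse (hL : IsLinkDiagram (A ++ (M ++ B)))
    (hN : IsLinkDiagram (A ++ B)) (hM : ∀ σ ∈ M, σ.isCross = true) {x : EState (A ++ (M ++ B))}
    (hv : VerticalAt A.length M (bits x.smoothing)) {x' : EState (A ++ B)}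
    (hs : x'.smoothing = x.smoothing ∘ liftCrossing A M B)
    (hm : ∀ P, x.mark P = x'.mark (collapse hM P)) {c' : Crossing (A ++ B)}
    (h : edgeMap c' (gen x') = 0) : edgeMap (liftCrossing A M B c') (gen x) = 0 := by
  set c := liftCrossing A M B c' with hc
  rw [edgeMap_gen_eq_zero_iff] at h ⊢
  intro y hy
  rw [hL.edgeRel_iff] at hy
  obtain ⟨h1, h2, h3, h4⟩ := hy
  have hspec := liftCrossing_spec (M := M) c'
  have hlow := collapse_eq_of_samePoint hM (hspec.samePoint_lower (M' := []) hL hN)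
  have hupp := collapse_eq_of_samePoint hM (hspec.samePoint_upper (M' := []) hL hN)
  rw [← hc] at hlow hupp
  have hbits : ∀ m < M.length, bits y.smoothing (A.length + m) = bits x.smoothing (A.length + m) := by
    intro m hm
    refine bits_congr fun d hd => ?_
    rw [h2, flip_of_ne]
    intro hdc
    rw [hdc] at hd
    have := (mem_range_liftCrossing c).1 ⟨c', rfl⟩
    omega
  have hvy : VerticalAt A.length M (bits y.smoothing) := by
    intro m σ hσ
    rw [hbits m (List.getElem?_eq_some_iff.1 hσ).1]
    exact hv m σ hσ
  have hsame : ∀ P Q, SameLoop x.smoothing P Q ↔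
      SameLoop x'.smoothing (collapse hM P) (collapse hM Q) := by
    intro P Q
    rw [hs]
    exact hv.sameLoop_collapse_iff hL hN hM P Q
  have hlift : ∀ P : Point (A ++ B), ∃ Q, collapse hM Q = P := by
    intro P
    obtain ⟨Q, hQ⟩ := exists_samePoint_of_removal (M := M) (outWidth_crossings hM _) P
    exact ⟨Q, collapse_eq_of_samePoint hM hQ⟩
  -- A term `y` of the larger edge is pushed down to an enhanced state `y'` by choosing a point over
  -- each point. The choice does not matter, because the slices `M` stay vertical in `y`. Then `y'`
  -- would be a term of the smaller edge, which has none.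
  choose up hup using hlift
  have hycomp : ∀ P Q : Point (A ++ B), SameLoop (y.smoothing ∘ liftCrossing A M B) P Q →
      y.mark (up P) = y.mark (up Q) := by
    intro P Q hPQ
    refine y.mark_eq ((hvy.sameLoop_collapse_iff hL hN hM _ _).2 ?_)
    rwa [hup, hup]
  let y' : EState (A ++ B) :=
    { smoothing := y.smoothing ∘ liftCrossing A M B
      mark := fun P => y.mark (up P)
      compat := fun P Q hPQ => hycomp P Q (.rel _ _ hPQ) }
  have hy' : ∀ Q, y'.mark (collapse hM Q) = y.mark Q := by
    intro Q
    refine y.mark_eq ((hvy.sameLoop_collapse_iff hL hN hM _ _).2 ?_)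
    rw [hup]
    exact .refl _
  refine h y' ((hN.edgeRel_iff c' x' y').2 ⟨?_, ?_, ?_, ?_⟩)
  · rw [hs, Function.comp, ← hc, h1]
  · change y.smoothing ∘ liftCrossing A M B = _
    rw [h2, hs, hc, flip_comp_liftCrossing]
  · rintro P _ rfl hPa hPb
    rw [← hup P] at hPa hPb ⊢
    rw [← hlow, ← hsame] at hPa
    rw [← hupp, ← hsame] at hPb
    rw [hy', ← hm]
    exact h3 _ _ rfl hPa hPb
  · rw [← hlow, ← hupp, hy', hy', ← hm, ← hm, ← hsame]
    exact h4

end Transport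

/-! ## Braids -/

section Braid

variable {n : ℕ} {A B : List Slice} {j : ℕ} {w : List (Letter n)}

theorem isCross_braid (w : List (Letter n)) (j : ℕ) :
    ∀ σ ∈ w.map (Letter.slice j), σ.isCross = true := by
  intro σ hσ
  obtain ⟨l, -, rfl⟩ := List.mem_map.1 hσ
  rfl

theorem stacks_braid (w : List (Letter n)) {W : ℕ} (h : j + n ≤ W) :
    Stacks (w.map (Letter.slice j)) W := by
  induction w with
  | nil => trivial
  | cons l w ih =>
    refine ⟨?_, ih⟩
    have := l.g.2
    change j + (l.g : ℕ) + 2 ≤ W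
    omega

theorem IsLinkDiagram.insert {M : List Slice} (hN : IsLinkDiagram (A ++ B))
    (hM : Stacks M (width A A.length)) (hw : outWidth M (width A A.length) = width A A.length) :
    IsLinkDiagram (A ++ (M ++ B)) := by
  have e : width A A.length = outWidth A 0 := by rw [width_eq_outWidth, List.take_length]
  rw [e] at hM hw
  rw [isLinkDiagram_iff, stacks_append, outWidth_append] at hN ⊢
  rw [stacks_append, outWidth_append, hw]
  exact ⟨⟨hN.1.1, hM, hN.1.2⟩, hN.2⟩

theorem IsLinkDiagram.insert_braid (hN : IsLinkDiagram (A ++ B)) (h : j + n ≤ width A A.length)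
    (w : List (Letter n)) : IsLinkDiagram (A ++ (w.map (Letter.slice j) ++ B)) :=
  hN.insert (stacks_braid w h) (outWidth_crossings (isCross_braid w j) _)

theorem IsLinkDiagram.insert_kink {i : ℕ} (hN : IsLinkDiagram (A ++ B))
    (h : i + 2 ≤ width A A.length) : IsLinkDiagram (A ++ (kink i ++ B)) := by
  refine hN.insert ⟨?_, ?_, ?_, trivial⟩ (by simp [kink, Slice.out])
  · change i + 1 ≤ _
    omega
  · change i + 2 ≤ width A A.length + 2
    omega
  · change i + 1 + 2 ≤ width A A.length + 2
    omega

theorem getElem?_braid (t : Fin w.length) :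
    (A ++ (w.map (Letter.slice j) ++ B))[A.length + (t : ℕ)]? =
      some (.cross (j + (w[t]).g) (w[t]).pos) := by
  rw [getElem?_middle (by simp)]
  simp [Letter.slice]

theorem verticalAt_braid {s : State (A ++ (w.map (Letter.slice j) ++ B))}
    (h : ∀ (t : Fin w.length) (c : Crossing (A ++ (w.map (Letter.slice j) ++ B))),
      c.idx = A.length + t → s c = !(w[t]).pos) :
    VerticalAt A.length (w.map (Letter.slice j)) (bits s) := by
  intro m σ hσ
  have hm := (List.getElem?_eq_some_iff.1 hσ).1
  rw [List.length_map] at hm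
  have hc := getElem?_braid (A := A) (B := B) (j := j) (⟨m, hm⟩ : Fin w.length)
  rw [← getElem?_middle (A := A) (B := B) (by simpa using hm), hc, Option.some.injEq] at hσ
  refine ⟨_, _, hσ.symm, ?_⟩
  have := bits_crossing s (crossingAt hc)
  rw [crossingAt_idx] at this
  rw [this, h ⟨m, hm⟩ _ rfl]
  exact (Bool.not_ne_self _).symm

theorem IsLift.verticalAt {α : EState (A ++ B)}
    {α' : EState (A ++ (w.map (Letter.slice j) ++ B))} (h : IsLift A B j w α α') :
    VerticalAt A.length (w.map (Letter.slice j)) (bits α'.smoothing) :=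
  verticalAt_braid h.braid

theorem sameCrossing_braid (w : List (Letter n)) (c : Crossing (A ++ B)) :
    SameCrossing A.length 0 w.length c (liftCrossing A (w.map (Letter.slice j)) B c) := by
  have := liftCrossing_spec (M := w.map (Letter.slice j)) c
  rw [List.length_map] at this
  unfold SameCrossing at *
  omega

theorem IsLift.smoothing {α : EState (A ++ B)}
    {α' : EState (A ++ (w.map (Letter.slice j) ++ B))} (h : IsLift A B j w α α') :
    α.smoothing = α'.smoothing ∘ liftCrossing A (w.map (Letter.slice j)) B := by
  ext c
  exact (h.old _ _ (sameCrossing_braid w c)).symm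

/-- Every point in the braid lies on the loop of an outer point, so the marks inside are forced.
This gives the uniqueness of the lift. -/
theorem IsLift.mark_collapse (hN : IsLinkDiagram (A ++ B)) (hj : j + n ≤ width A A.length)
    {α : EState (A ++ B)}
    {α' : EState (A ++ (w.map (Letter.slice j) ++ B))} (h : IsLift A B j w α α')
    (P : Point (A ++ (w.map (Letter.slice j) ++ B))) :
    α'.mark P = α.mark (collapse (isCross_braid w j) P) := by
  obtain ⟨Q, hQ, hQP⟩ := h.verticalAt.collapse (hN.insert_braid hj w) (isCross_braid w j) P
  rw [← α'.mark_eq hQP]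
  rw [List.length_map] at hQ
  exact h.mark _ _ hQ.symm

open Classical in
/-- The state of the glued diagram that is vertical on the braid. -/
noncomputable def liftState (A B : List Slice) (j : ℕ) (w : List (Letter n)) (s : State (A ++ B)) :
    State (A ++ (w.map (Letter.slice j) ++ B)) := fun c =>
  if h : ∃ c', liftCrossing A (w.map (Letter.slice j)) B c' = c then s h.choose
  -- A crossing that is not lifted from `A ++ B` lies in the braid, so the final default is never
  -- used.
  else if h : c.idx - A.length < w.length then !(w[c.idx - A.length]).pos else false

theorem liftState_comp (s : State (A ++ B)) :
    liftState A B j w s ∘ liftCrossing A (w.map (Letter.slice j)) B = s := by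
  ext c
  have h : ∃ c', liftCrossing A (w.map (Letter.slice j)) B c' =
    liftCrossing A (w.map (Letter.slice j)) B c := ⟨c, rfl⟩
  rw [Function.comp, liftState, dif_pos h, liftCrossing_strictMono.injective h.choose_spec]

theorem liftState_braid (s : State (A ++ B)) (t : Fin w.length)
    (c : Crossing (A ++ (w.map (Letter.slice j) ++ B))) (hc : c.idx = A.length + t) :
    liftState A B j w s c = !(w[t]).pos := by
  have h : ¬ ∃ c', liftCrossing A (w.map (Letter.slice j)) B c' = c := by
    intro h
    have := (mem_range_liftCrossing (M := w.map (Letter.slice j)) c).1 h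
    rw [List.length_map] at this
    have := t.2
    omega
  have ht : c.idx - A.length = t := by omega
  rw [liftState, dif_neg h, dif_pos (by rw [ht]; exact t.2)]
  simp only [ht]
  rfl

theorem exists_isLift (hN : IsLinkDiagram (A ++ B)) (hj : j + n ≤ width A A.length)
    (w : List (Letter n)) (α : EState (A ++ B)) :
    ∃ α' : EState (A ++ (w.map (Letter.slice j) ++ B)), IsLift A B j w α α' := by
  refine ⟨(verticalAt_braid (liftState_braid α.smoothing)).pullback (hN.insert_braid hj w) hN
    (isCross_braid w j) _ α (liftState_comp _).symm, ⟨?_, ?_, ?_⟩⟩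
  · intro c (c' : Crossing (A ++ (w.map (Letter.slice j) ++ B))) hc
    have hc : (c.idx < A.length ∧ c'.idx = c.idx) ∨
      (A.length + 0 ≤ c.idx ∧ c'.idx + 0 = c.idx + w.length) := hc
    have e : c' = liftCrossing A (w.map (Letter.slice j)) B c := by
      refine eq_liftCrossing ?_
      rw [List.length_map]
      unfold SameCrossing at *
      omega
    rw [e]
    exact congrFun (liftState_comp (j := j) (w := w) α.smoothing) c
  · exact liftState_braid α.smoothing
  · intro P P' hP
    refine congrArg α.mark (collapse_eq_of_samePoint _ ?_)
    rw [List.length_map]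
    exact hP.symm

theorem IsLift.unique (hN : IsLinkDiagram (A ++ B)) (hj : j + n ≤ width A A.length)
    {α : EState (A ++ B)}
    {α' β : EState (A ++ (w.map (Letter.slice j) ++ B))} (h : IsLift A B j w α α')
    (h' : IsLift A B j w α β) : β = α' := by
  refine EState.ext (funext fun c => ?_) (funext fun P => ?_)
  · by_cases hc : c ∈ Set.range (liftCrossing A (w.map (Letter.slice j)) B)
    · obtain ⟨c, rfl⟩ := hc
      exact (congrFun h'.smoothing c).symm.trans (congrFun h.smoothing c)
    · rw [mem_range_liftCrossing, List.length_map] at hc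
      have e : c.idx = A.length + ((⟨c.idx - A.length, by omega⟩ : Fin w.length) : ℕ) := by
        simp only
        omega
      exact (h'.braid _ c e).trans (h.braid _ c e).symm
  · rw [h.mark_collapse hN hj, h'.mark_collapse hN hj]

/-- At an old crossing the edge is a copy of an edge of `α`, and each of these vanishes on its own.
At a crossing of the braid the corners lie on two different loops marked by `v₋`, and merging them
gives `v₋ · v₋ = 0`. -/
theorem IsLift.isStateCycle (hN : IsLinkDiagram (A ++ B)) (hj : j + n ≤ width A A.length)
    {dir : Point (A ++ B) → Bool} {α : EState (A ++ B)}
    (hpar : BraidParallel dir α A.length j n) (hα : IsStateCycle α)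
    {α' : EState (A ++ (w.map (Letter.slice j) ++ B))} (h : IsLift A B j w α α') :
    IsStateCycle α' := by
  have hL := hN.insert_braid hj w
  rw [isStateCycle_iff] at hα ⊢
  intro c
  by_cases hc : c ∈ Set.range (liftCrossing A (w.map (Letter.slice j)) B)
  · obtain ⟨c, rfl⟩ := hc
    exact edgeMap_eq_zero_of_collapse hL hN (isCross_braid w j) h.verticalAt h.smoothing
      (h.mark_collapse hN hj) (hα c)
  · rw [mem_range_liftCrossing, List.length_map] at hc
    obtain ⟨t, ht⟩ : ∃ t : Fin w.length, c.idx = A.length + t :=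
      ⟨⟨c.idx - A.length, by omega⟩, by simp only; omega⟩
    have hget := getElem?_braid (A := A) (B := B) (j := j) t
    rw [← ht] at hget
    have hg := (w[t]).g.2
    -- Both corners collapse to the transverse line, onto neighbouring arcs of the braid-parallel
    -- family.
    have hlow := coord_collapse (isCross_braid w j) (hL.lower c)
    have hupp := coord_collapse (isCross_braid w j) (hL.upper c)
    rw [hL.coord_lower hget] at hlow
    rw [hL.coord_upper hget] at hupp
    have el : ∀ m, A.length ≤ m → m ≤ A.length + w.length →
        collapseLevel A.length (w.map (Letter.slice j)).length m = A.length := by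
      intro m h1 h2
      rw [List.length_map]
      unfold collapseLevel
      split_ifs <;> omega
    have ht2 := t.2
    rw [el _ (by simp only; omega) (by simp only; omega)] at hlow hupp
    have l1 : (collapse (isCross_braid w j) (hL.lower c)).coord.1 = A.length := by rw [hlow]
    have l2 : (collapse (isCross_braid w j) (hL.lower c)).coord.2 = j + (w[t]).g := by rw [hlow]
    have u1 : (collapse (isCross_braid w j) (hL.upper c)).coord.1 = A.length := by rw [hupp]
    have u2 : (collapse (isCross_braid w j) (hL.upper c)).coord.2 = j + (w[t]).g + 1 := by rw [hupp]
    refine hL.edgeMap_eq_zero ?_ ?_ ?_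
    · intro hs
      rw [h.verticalAt.sameLoop_collapse_iff hL hN (isCross_braid w j), ← h.smoothing] at hs
      have e := hpar.separate _ _ l1 (by omega) (by omega) u1 (by omega) (by omega) hs
      rw [e] at l2
      omega
    · rw [h.mark_collapse hN hj]
      exact hpar.marked _ l1 (by omega) (by omega)
    · rw [h.mark_collapse hN hj]
      exact hpar.marked _ u1 (by omega) (by omega)

end Braid

/-! ## Orientations -/

theorem isOrientation_iff {L : List Slice} {dir : Point L → Bool} :
    IsOrientation L dir ↔ ∀ (k : ℕ) (σ : Slice) (P Q : Point L), L[k]? = some σ →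
      (σ.Pass k P.coord Q.coord → dir P = dir Q) ∧ (σ.Turn k P.coord Q.coord → dir P ≠ dir Q) := by
  constructor
  · intro h k σ P Q hσ
    obtain ⟨hlt, rfl⟩ := List.getElem?_eq_some_iff.1 hσ
    exact h ⟨k, hlt⟩ P Q
  · intro h k P Q
    exact h k _ P Q (List.getElem?_eq_getElem k.2)

theorem Slice.Pass.level {k : ℕ} {σ : Slice} {p q : ℕ × ℕ} (h : σ.Pass k p q) :
    p.1 = k ∧ q.1 = k + 1 := by
  cases h <;> exact ⟨rfl, rfl⟩

theorem Slice.Turn.level {k : ℕ} {σ : Slice} {p q : ℕ × ℕ} (h : σ.Turn k p q) :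
    (p.1 = k ∨ p.1 = k + 1) ∧ q.1 = p.1 := by
  cases h
  · exact ⟨.inr rfl, rfl⟩
  · exact ⟨.inl rfl, rfl⟩

theorem Slice.Pass.shift {k : ℕ} {σ : Slice} {p q : ℕ × ℕ} (h : σ.Pass k p q) (k' : ℕ) :
    σ.Pass k' (k', p.2) (k' + 1, q.2) := by
  cases h with
  | cup_left h => exact .cup_left h
  | cup_right h => exact .cup_right h
  | cap_left h => exact .cap_left h
  | cap_right h => exact .cap_right h
  | away h h' => exact .away h h'
  | rightwards => exact .rightwards
  | leftwards => exact .leftwards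

theorem Slice.Turn.shift {k : ℕ} {σ : Slice} {p q : ℕ × ℕ} (h : σ.Turn k p q) (k' : ℕ) :
    σ.Turn k' (p.1 - k + k', p.2) (q.1 - k + k', q.2) := by
  cases h
  · have e : k + 1 - k + k' = k' + 1 := by omega
    simp only [e]
    exact .cup
  · have e : k - k + k' = k' := by omega
    simp only [e]
    exact .cap

section Braid

variable {n : ℕ} {A B : List Slice} {j : ℕ} {w : List (Letter n)}

theorem exists_letter {k : ℕ} (h : A.length ≤ k) (h' : k < A.length + w.length) :
    ∃ t : Fin w.length, k = A.length + t :=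
  ⟨⟨k - A.length, by omega⟩, by simp only; omega⟩

theorem collapse_level_braid (P : Point (A ++ (w.map (Letter.slice j) ++ B)))
    (h : A.length ≤ P.coord.1) (h' : P.coord.1 ≤ A.length + w.length) :
    (collapse (isCross_braid w j) P).coord = (A.length, P.coord.2) := by
  rw [coord_collapse, List.length_map]
  refine Prod.ext ?_ rfl
  simp only [collapseLevel]
  split_ifs <;> omega

theorem collapse_level_low (P : Point (A ++ (w.map (Letter.slice j) ++ B)))
    (h : P.coord.1 ≤ A.length) : (collapse (isCross_braid w j) P).coord = P.coord := by
  rw [coord_collapse]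
  refine Prod.ext ?_ rfl
  exact if_pos h

theorem collapse_level_high (P : Point (A ++ (w.map (Letter.slice j) ++ B)))
    (h : A.length + w.length ≤ P.coord.1) :
    (collapse (isCross_braid w j) P).coord = (P.coord.1 - w.length, P.coord.2) := by
  rw [coord_collapse, List.length_map]
  refine Prod.ext ?_ rfl
  simp only [collapseLevel]
  split_ifs <;> omega

/-- Directions are pulled back along the vertical arcs. The strands of the link change places at a
crossing of the braid, which is harmless because all strands of the braid point in the same
direction. -/
theorem isOrientation_collapse {dir : Point (A ++ B) → Bool} (hdir : IsOrientation (A ++ B) dir)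
    {α : EState (A ++ B)} (hpar : BraidParallel dir α A.length j n) :
    IsOrientation (A ++ (w.map (Letter.slice j) ++ B))
      fun P => dir (collapse (isCross_braid w j) P) := by
  rw [isOrientation_iff] at hdir ⊢
  intro k σ P Q hσ
  by_cases h1 : k < A.length
  · rw [getElem?_left h1] at hσ
    have h := hdir k σ (collapse (isCross_braid w j) P) (collapse (isCross_braid w j) Q)
      (by rw [getElem?_left h1]; exact hσ)
    refine ⟨fun hp => h.1 ?_, fun ht => h.2 ?_⟩
    · obtain ⟨hP, hQ⟩ := hp.level
      rwa [collapse_level_low P (by omega), collapse_level_low Q (by omega)]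
    · obtain ⟨hP, hQ⟩ := ht.level
      rwa [collapse_level_low P (by omega), collapse_level_low Q (by omega)]
  · by_cases h2 : k < A.length + w.length
    · obtain ⟨t, rfl⟩ := exists_letter (by omega) h2
      have hg := (w[t]).g.2
      have ht := t.2
      rw [getElem?_braid, Option.some.injEq] at hσ
      refine ⟨fun hp => ?_, fun ht => by subst hσ; cases ht⟩
      obtain ⟨hP, hQ⟩ := hp.level
      have cP := collapse_level_braid P (by omega) (by omega)
      have cQ := collapse_level_braid Q (by omega) (by omega)
      by_cases hx : P.coord.2 = Q.coord.2
      · have e : collapse (isCross_braid w j) P = collapse (isCross_braid w j) Q :=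
          Point.coord_injective (by rw [cP, cQ, hx])
        rw [e]
      · have hr : (P.coord.2 = j + (w[t]).g ∨ P.coord.2 = j + (w[t]).g + 1) ∧
            (Q.coord.2 = j + (w[t]).g ∨ Q.coord.2 = j + (w[t]).g + 1) := by
          subst hσ
          generalize P.coord = p at *
          generalize Q.coord = q at *
          cases hp with
          | away h h' => exact absurd rfl hx
          | rightwards => exact ⟨.inl rfl, .inr rfl⟩
          | leftwards => exact ⟨.inr rfl, .inl rfl⟩
        have p1 : (collapse (isCross_braid w j) P).coord.1 = A.length := by rw [cP]
        have p2 : (collapse (isCross_braid w j) P).coord.2 = P.coord.2 := by rw [cP]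
        have q1 : (collapse (isCross_braid w j) Q).coord.1 = A.length := by rw [cQ]
        have q2 : (collapse (isCross_braid w j) Q).coord.2 = Q.coord.2 := by rw [cQ]
        exact hpar.parallel _ _ p1 (by omega) (by omega) q1 (by omega) (by omega)
    · obtain ⟨m, rfl⟩ : ∃ m, k = A.length + w.length + m :=
        ⟨k - (A.length + w.length), by omega⟩
      have hσ' : (A ++ B)[A.length + m]? = some σ := by
        have e := getElem?_right (A := A) (M := w.map (Letter.slice j)) (B := B) m
        rw [List.length_map] at e
        rw [List.getElem?_append_right (by omega), ← hσ, e]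
        congr 1
        omega
      have h := hdir _ σ (collapse (isCross_braid w j) P) (collapse (isCross_braid w j) Q) hσ'
      refine ⟨fun hp => h.1 ?_, fun ht => h.2 ?_⟩
      · obtain ⟨hP, hQ⟩ := hp.level
        rw [collapse_level_high P (by omega), collapse_level_high Q (by omega), hP, hQ]
        have := hp.shift (A.length + m)
        convert this using 2 <;> omega
      · obtain ⟨hP, hQ⟩ := ht.level
        rw [collapse_level_high P (by omega), collapse_level_high Q (by omega)]
        have := ht.shift (A.length + m)
        convert this using 2 <;> omega

/-- The two strands point in the same direction, up or down, and in either case the sign of the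
crossing is its type. -/
theorem isPositive_braid (hL : IsLinkDiagram (A ++ (w.map (Letter.slice j) ++ B)))
    {dir : Point (A ++ B) → Bool}
    {α : EState (A ++ B)} (hpar : BraidParallel dir α A.length j n) (t : Fin w.length)
    {c : Crossing (A ++ (w.map (Letter.slice j) ++ B))} (hc : c.idx = A.length + t) :
    IsPositive (fun P => dir (collapse (isCross_braid w j) P)) c ↔ (w[t]).pos = true := by
  have hget := getElem?_braid (A := A) (B := B) (j := j) t
  have hg := (w[t]).g.2
  have ht := t.2
  rw [← hc] at hget
  have hw := hL.fits hget
  change j + (w[t]).g + 2 ≤ _ at hw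
  have hdir : ∀ P Q : Point (A ++ (w.map (Letter.slice j) ++ B)),
      P.coord = (c.idx, j + (w[t]).g) → Q.coord = (c.idx, j + (w[t]).g + 1) →
      dir (collapse (isCross_braid w j) P) = dir (collapse (isCross_braid w j) Q) := by
    intro P Q hP hQ
    have P1 : P.coord.1 = A.length + t := by rw [hP, hc]
    have Q1 : Q.coord.1 = A.length + t := by rw [hQ, hc]
    have cP := collapse_level_braid P (by omega) (by omega)
    have cQ := collapse_level_braid Q (by omega) (by omega)
    have p1 : (collapse (isCross_braid w j) P).coord.1 = A.length := by rw [cP]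
    have p2 : (collapse (isCross_braid w j) P).coord.2 = j + (w[t]).g := by rw [cP, hP]
    have q1 : (collapse (isCross_braid w j) Q).coord.1 = A.length := by rw [cQ]
    have q2 : (collapse (isCross_braid w j) Q).coord.2 = j + (w[t]).g + 1 := by rw [cQ, hQ]
    exact hpar.parallel _ _ p1 (by omega) (by omega) q1 (by omega) (by omega)
  unfold IsPositive
  rw [pos_of_crossing hget]
  constructor
  · rintro ⟨P, Q, hP, hQ, h⟩
    exact h.1 (hdir P Q hP hQ)
  · intro h
    have hP : OnDiagram (A ++ (w.map (Letter.slice j) ++ B)) (c.idx, j + (w[t]).g) :=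
      ⟨c.1.2.le, by simp only; omega⟩
    have hQ : OnDiagram (A ++ (w.map (Letter.slice j) ++ B)) (c.idx, j + (w[t]).g + 1) :=
      ⟨c.1.2.le, by simp only; omega⟩
    exact ⟨hP.point, hQ.point, rfl, rfl, iff_of_true (hdir _ _ rfl rfl) h⟩

end Braid

/-! ## Movies -/

theorem IsChainMap.comp {L L' L'' : List Slice} {F : Chain L' →ₗ[ℚ] Chain L''}
    {G : Chain L →ₗ[ℚ] Chain L'} (hF : IsChainMap F) (hG : IsChainMap G) :
    IsChainMap (F ∘ₗ G) := fun z => by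
  rw [LinearMap.comp_apply, LinearMap.comp_apply, hG z, hF]

/-- The diagrams enter through equations, because those of a movie take the local form only after
regrouping: the letters below the changed crossing are counted to `A` and those above it to `B`. -/
theorem resolve_spec {L K N A B : List Slice} {k i : ℕ} (eL : L = A ++ ([.cross i true] ++ B))
    (eK : K = A ++ (kink i ++ B)) (eN : N = A ++ B) (ek : k = A.length) (hL : IsLinkDiagram L)
    (hK : IsLinkDiagram K) (hN : IsLinkDiagram N) :
    IsChainMap (rIMap K N k i ∘ₗ saddleMap L K k i) ∧
      ∀ (x : EState L) (y : EState N), (∀ c : Crossing L, c.idx = k → x.smoothing c = false) →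
        SameSmoothing k 1 0 x.smoothing y.smoothing → SameMark k 1 0 x.mark y.mark →
        rIMap K N k i (saddleMap L K k i (gen x)) = gen y := by
  subst eL eK eN ek
  exact ⟨(rIMap_isChainMap hK hN).comp (saddleMap_isChainMap hL hK hN),
    fun x y hx hs hm => rIMap_saddleMap_gen hL hK hN (hx _ rfl) hs hm⟩

theorem cancel_spec {L N A B : List Slice} {k i : ℕ} {e : Bool} (eL : L = A ++ (bigon i e ++ B))
    (eN : N = A ++ B) (ek : k = A.length) (hL : IsLinkDiagram L) (hN : IsLinkDiagram N) :
    IsChainMap (rIIMap L N k i e) ∧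
      ∀ (x : EState L) (y : EState N), (∀ c : Crossing L, c.idx = k → x.smoothing c = !e) →
        (∀ c : Crossing L, c.idx = k + 1 → x.smoothing c = e) →
        SameSmoothing k 2 0 x.smoothing y.smoothing → SameMark k 2 0 x.mark y.mark →
        rIIMap L N k i e (gen x) = gen y ∨ rIIMap L N k i e (gen x) = -gen y := by
  subst eL eN ek
  exact ⟨rIIMap_isChainMap hL hN,
    fun x y hx hx' hs hm => rIIMap_gen_vertical hL ⟨hx _ rfl, hx' _ rfl⟩ hs hm⟩

section Braid

variable {n : ℕ} {A B : List Slice} {j : ℕ} {w u m v : List (Letter n)}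

theorem IsLift.smoothing_letter {α : EState (A ++ B)}
    {α' : EState (A ++ (w.map (Letter.slice j) ++ B))} (h : IsLift A B j w α α') {t : ℕ}
    {l : Letter n} (ht : w[t]? = some l)
    {c : Crossing (A ++ (w.map (Letter.slice j) ++ B))} (hc : c.idx = A.length + t) :
    α'.smoothing c = !l.pos := by
  obtain ⟨hlt, rfl⟩ := List.getElem?_eq_some_iff.1 ht
  exact h.braid ⟨t, hlt⟩ c hc

/-- Lifts of the same `α` for a word and for a shortened word differ only at the removed letters
`m`; this is what the rules of the elementary maps ask for. -/
theorem sameSmoothing_of_isLift {α : EState (A ++ B)}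
    {α' : EState (A ++ ((u ++ (m ++ v)).map (Letter.slice j) ++ B))}
    {β : EState (A ++ ((u ++ v).map (Letter.slice j) ++ B))}
    (h : IsLift A B j (u ++ (m ++ v)) α α') (h' : IsLift A B j (u ++ v) α β) :
    SameSmoothing (A.length + u.length) m.length 0 α'.smoothing β.smoothing := by
  intro c c' hc
  have l1 : ((u ++ (m ++ v)).map (Letter.slice j)).length = u.length + m.length + v.length := by
    simp; omega
  have l2 : ((u ++ v).map (Letter.slice j)).length = u.length + v.length := by simp
  unfold SameCrossing at hc
  by_cases hr : c.idx < A.length ∨ A.length + (u.length + m.length + v.length) ≤ c.idx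
  · obtain ⟨d, rfl⟩ := (mem_range_liftCrossing c).2 (by rw [l1]; exact hr)
    have e : c' = liftCrossing A ((u ++ v).map (Letter.slice j)) B d := by
      refine eq_liftCrossing ?_
      have hd := liftCrossing_spec (M := (u ++ (m ++ v)).map (Letter.slice j)) d
      unfold SameCrossing at *
      rw [l1] at hd
      rw [l2]
      omega
    rw [e]
    exact (congrFun h'.smoothing d).symm.trans (congrFun h.smoothing d)
  · obtain ⟨t, ht⟩ : ∃ t, c.idx = A.length + t := ⟨c.idx - A.length, by omega⟩
    obtain ⟨t', ht'⟩ : ∃ t, c'.idx = A.length + t := ⟨c'.idx - A.length, by omega⟩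
    have e : (u ++ v)[t']? = (u ++ (m ++ v))[t]? := by
      rcases hc with ⟨h1, h2⟩ | ⟨h1, h2⟩
      · obtain rfl : t' = t := by omega
        rw [List.getElem?_append_left (by omega), List.getElem?_append_left (by omega)]
      · rw [List.getElem?_append_right (by omega), List.getElem?_append_right (by omega),
          List.getElem?_append_right (by omega)]
        congr 1
        omega
    have hlt : t < (u ++ (m ++ v)).length := by
      simp only [List.length_append]
      omega
    have hl := List.getElem?_eq_getElem hlt
    rw [h.smoothing_letter hl ht, h'.smoothing_letter (e.trans hl) ht']

theorem sameMark_of_isLift (hN : IsLinkDiagram (A ++ B)) (hj : j + n ≤ width A A.length)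
    {α : EState (A ++ B)}
    {α' : EState (A ++ ((u ++ (m ++ v)).map (Letter.slice j) ++ B))}
    {β : EState (A ++ ((u ++ v).map (Letter.slice j) ++ B))}
    (h : IsLift A B j (u ++ (m ++ v)) α α') (h' : IsLift A B j (u ++ v) α β) :
    SameMark (A.length + u.length) m.length 0 α'.mark β.mark := by
  intro P P' hP
  rw [h.mark_collapse hN hj, h'.mark_collapse hN hj]
  congr 1
  refine Point.coord_injective ?_
  obtain ⟨h1, h2⟩ := hP
  rw [coord_collapse, coord_collapse, h1]
  have l1 : ((u ++ (m ++ v)).map (Letter.slice j)).length = u.length + m.length + v.length := by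
    simp; omega
  have l2 : ((u ++ v).map (Letter.slice j)).length = u.length + v.length := by simp
  rw [l1, l2]
  refine Prod.ext ?_ rfl
  simp only [collapseLevel]
  split_ifs <;> omega

theorem width_insert_braid (u : List (Letter n)) :
    width (A ++ u.map (Letter.slice j)) (A ++ u.map (Letter.slice j)).length =
      width A A.length := by
  have := width_crossings (A := A) (B := []) (isCross_braid u j) le_rfl
  rw [List.append_nil] at this
  rw [List.length_append, this]

/-- By induction along the movie, each step turns the lift of `α` into plus or minus the lift for
the shorter word, and for the empty word uniqueness shows that the lift is `α`. -/
theorem JacobssonMovie.spec (hN : IsLinkDiagram (A ++ B)) (hj : j + n ≤ width A A.length)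
    {Ψ : Chain (glue A j w B) →ₗ[ℚ] Chain (A ++ B)} (h : JacobssonMovie A B j w Ψ) :
    IsChainMap Ψ ∧ ∀ (α : EState (A ++ B)) (α' : EState (glue A j w B)), IsLift A B j w α α' →
      (Ψ (gen α') = gen α ∨ Ψ (gen α') = -gen α) := by
  induction h with
  | done =>
    refine ⟨fun z => rfl, fun α α' h => .inl ?_⟩
    have hα : IsLift A B j ([] : List (Letter n)) α α := by
      refine ⟨fun c (c' : Crossing (A ++ B)) hc => ?_, fun t => t.elim0,
        fun P (P' : Point (A ++ B)) hP => ?_⟩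
      · have hc : (c.idx < A.length ∧ c'.idx = c.idx) ∨ (A.length + 0 ≤ c.idx ∧
          c'.idx + 0 = c.idx + 0) := hc
        rw [show c' = c from Crossing.ext_idx (by omega)]
      · have hP : P'.coord.2 = P.coord.2 ∧ ((P.coord.1 ≤ A.length ∧ P'.coord.1 = P.coord.1) ∨
          (A.length + 0 ≤ P.coord.1 ∧ P'.coord.1 + 0 = P.coord.1 + 0)) := hP
        rw [show P' = P from Point.coord_injective (Prod.ext (by omega) hP.1)]
    rw [IsLift.unique hN hj hα h]
    rfl
  | resolve u v g Ψ _ ih =>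
    have hg := g.2
    have hw := width_insert_braid (A := A) (j := j) u
    have hL := hN.insert_braid hj (u ++ ⟨g, true, true⟩ :: v)
    have hN' := hN.insert_braid hj (u ++ v)
    have eN : A ++ ((u ++ v).map (Letter.slice j) ++ B) =
        (A ++ u.map (Letter.slice j)) ++ (v.map (Letter.slice j) ++ B) := by simp
    have hK : IsLinkDiagram ((A ++ u.map (Letter.slice j)) ++
        (kink (j + g) ++ (v.map (Letter.slice j) ++ B))) :=
      IsLinkDiagram.insert_kink (eN ▸ hN') (by rw [hw]; omega)
    have eK : A ++ (u.map (Letter.slice j) ++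
        (.cup (j + g + 1) :: .cross (j + g) true :: .cap (j + g + 1) ::
          (v.map (Letter.slice j) ++ B))) = (A ++ u.map (Letter.slice j)) ++
        (kink (j + g) ++ (v.map (Letter.slice j) ++ B)) := by simp [kink]
    obtain ⟨hc, hgen⟩ := resolve_spec (L := glue A j (u ++ ⟨g, true, true⟩ :: v) B)
      (N := glue A j (u ++ v) B) (i := j + g)
      (k := A.length + u.length) (A := A ++ u.map (Letter.slice j))
      (B := v.map (Letter.slice j) ++ B) (by simp [glue, Letter.slice]) eK eN (by simp)
      hL (eK ▸ hK) hN'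
    refine ⟨ih.1.comp hc, fun α α' h => ?_⟩
    obtain ⟨β, hβ⟩ := exists_isLift hN hj (u ++ v) α
    -- A central letter is positive, hence `0`-smoothed in the lift, so the saddle splits off a
    -- loop.
    have hx : ∀ c : Crossing (glue A j (u ++ ⟨g, true, true⟩ :: v) B),
        c.idx = A.length + u.length → α'.smoothing c = false := fun c hc =>
      IsLift.smoothing_letter h (t := u.length) (l := ⟨g, true, true⟩) (by simp) hc
    have := hgen α' β hx (sameSmoothing_of_isLift (m := [⟨g, true, true⟩]) h hβ)
      (sameMark_of_isLift hN hj (m := [⟨g, true, true⟩]) h hβ)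
    rw [LinearMap.comp_apply, LinearMap.comp_apply, this]
    exact ih.2 α β hβ
  | cancel u v g e Ψ _ ih =>
    have hL := hN.insert_braid hj (u ++ ⟨g, e, false⟩ :: ⟨g, !e, false⟩ :: v)
    have hN' := hN.insert_braid hj (u ++ v)
    obtain ⟨hc, hgen⟩ := cancel_spec
      (L := glue A j (u ++ ⟨g, e, false⟩ :: ⟨g, !e, false⟩ :: v) B)
      (N := glue A j (u ++ v) B) (i := j + g) (e := e)
      (k := A.length + u.length) (A := A ++ u.map (Letter.slice j))
      (B := v.map (Letter.slice j) ++ B) (by simp [glue, Letter.slice, bigon]) (by simp [glue])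
      (by simp) hL hN'
    refine ⟨ih.1.comp hc, fun α α' h => ?_⟩
    obtain ⟨β, hβ⟩ := exists_isLift hN hj (u ++ v) α
    -- Inverse letters are smoothed oppositely in the lift, which is the vertical case of the second
    -- Reidemeister map.
    have hx : ∀ c : Crossing (glue A j (u ++ ⟨g, e, false⟩ :: ⟨g, !e, false⟩ :: v) B),
        c.idx = A.length + u.length → α'.smoothing c = !e := fun c hc =>
      IsLift.smoothing_letter h (t := u.length) (l := ⟨g, e, false⟩) (by simp) hc
    have hx' : ∀ c : Crossing (glue A j (u ++ ⟨g, e, false⟩ :: ⟨g, !e, false⟩ :: v) B),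
        c.idx = A.length + u.length + 1 → α'.smoothing c = e := fun c hc =>
      (IsLift.smoothing_letter h (t := u.length + 1) (l := ⟨g, !e, false⟩) (by simp) hc).trans
        (Bool.not_not e)
    have hs := hgen α' β hx hx'
      (sameSmoothing_of_isLift (m := [⟨g, e, false⟩, ⟨g, !e, false⟩]) h hβ)
      (sameMark_of_isLift hN hj (m := [⟨g, e, false⟩, ⟨g, !e, false⟩]) h hβ)
    rw [LinearMap.comp_apply]
    rcases hs with hs | hs
    · rw [hs]
      exact ih.2 α β hβ
    -- A sign from this step exchanges the two alternatives of the induction hypothesis.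
    · rw [hs, map_neg, neg_inj, neg_eq_iff_eq_neg]
      exact (ih.2 α β hβ).symm

/-- The word can be reduced to the empty word by a movie. -/
def Reducible (A B : List Slice) (j : ℕ) (w : List (Letter n)) : Prop :=
  ∃ Ψ, JacobssonMovie A B j w Ψ

/-- In the movie the innermost pair of `ω ω⁻¹` cancels first. Since movies are built from their end,
the induction over `ω` starts with the outermost letter and moves it, with its inverse, into the
context `u, v`. -/
theorem Reducible.conj (ω : List (Fin (n - 1) × Bool)) {u v : List (Letter n)}
    (h : Reducible A B j (u ++ v)) :
    Reducible A B j (u ++ (ω.map (fun l => ⟨l.1, l.2, false⟩) ++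
      (ω.reverse.map (fun l => ⟨l.1, !l.2, false⟩) ++ v))) := by
  induction ω generalizing u v with
  | nil => exact h
  | cons l ω ih =>
    have h1 : Reducible A B j ((u ++ [⟨l.1, l.2, false⟩]) ++ (⟨l.1, !l.2, false⟩ :: v)) := by
      obtain ⟨Ψ, hΨ⟩ := h
      rw [List.append_assoc]
      exact ⟨_, .cancel u v l.1 l.2 Ψ hΨ⟩
    have h2 := ih h1
    simpa using h2

/-- The movie begins by resolving the central letter, after which `ω` meets its inverse. -/
theorem Reducible.factor (f : QPFactor n) {v : List (Letter n)} (h : Reducible A B j v) :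
    Reducible A B j (f.word ++ v) := by
  have h1 : Reducible A B j (f.ω.map (fun l => (⟨l.1, l.2, false⟩ : Letter n)) ++
      (f.ω.reverse.map (fun l => (⟨l.1, !l.2, false⟩ : Letter n)) ++ v)) :=
    Reducible.conj f.ω (u := []) h
  obtain ⟨Ψ, hΨ⟩ := h1
  have h2 : f.word ++ v = f.ω.map (fun l => (⟨l.1, l.2, false⟩ : Letter n)) ++ ⟨f.g, true, true⟩ ::
      (f.ω.reverse.map (fun l => (⟨l.1, !l.2, false⟩ : Letter n)) ++ v) := by
    simp [QPFactor.word]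
  rw [h2]
  exact ⟨_, .resolve _ _ f.g Ψ hΨ⟩

theorem reducible_qpWord (F : List (QPFactor n)) : Reducible A B j (qpWord F) := by
  induction F with
  | nil => exact ⟨_, .done⟩
  | cons f F ih => exact ih.factor f

end Braid

/-! ## Homology -/

theorem Kh.map_cls {L L' : List Slice} {f : Chain L →ₗ[ℚ] Chain L'} (hf : IsChainMap f)
    {z : Chain L} (hz : differential L z = 0) :
    ∃ h : differential L' (f z) = 0, Kh.map f hf (Kh.cls z hz) = Kh.cls (f z) h :=
  ⟨by rw [← hf z, hz, map_zero], rfl⟩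

theorem Kh.cls_congr {L : List Slice} {z z' : Chain L} (h : z = z') (hz : differential L z = 0)
    (hz' : differential L z' = 0) : Kh.cls z hz = Kh.cls z' hz' := by
  subst h
  rfl

theorem Kh.cls_neg {L : List Slice} {z z' : Chain L} (h : z = -z') (hz : differential L z = 0)
    (hz' : differential L z' = 0) : Kh.cls z hz = -Kh.cls z' hz' := by
  subst h
  rfl

end KhovanovQP

theorem mainTheorem2 (A B : List Slice) (hD : IsLinkDiagram (A ++ B))
    (dir : Point (A ++ B) → Bool) (hdir : IsOrientation (A ++ B) dir)
    (α : EState (A ++ B)) (hα : IsNontrivialStateCycle α)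
    (j n : ℕ) (hpar : BraidParallel dir α A.length j n)
    (F : List (QPFactor n)) (w : List (Letter n))
    (hw : w = qpWord F) :
    IsLinkDiagram (glue A j w B) ∧
    (∃ dir' : Point (glue A j w B) → Bool,
      IsOrientation (glue A j w B) dir' ∧
      (∀ P P', SamePoint A.length 0 w.length P P' → dir' P' = dir P) ∧
      ∀ (t : Fin w.length) (c : Crossing (glue A j w B)),
        c.idx = A.length + t → (IsPositive dir' c ↔ (w[t]).pos = true)) ∧
    ∃ α' : EState (glue A j w B),
      IsLift A B j w α α' ∧
      (∀ β, IsLift A B j w α β → β = α') ∧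
      (∀ P Q P' Q', SamePoint A.length 0 w.length P P' →
        SamePoint A.length 0 w.length Q Q' →
        (SameLoop α'.smoothing P' Q' ↔ SameLoop α.smoothing P Q)) ∧
      (∀ Q' : Point (glue A j w B),
        ∃ (P : Point (A ++ B)) (P' : Point (glue A j w B)),
          SamePoint A.length 0 w.length P P' ∧
          SameLoop α'.smoothing P' Q') ∧
      IsNontrivialStateCycle α' ∧
      (∃ Ψ, JacobssonMovie A B j w Ψ) ∧
      ∀ Ψ, JacobssonMovie A B j w Ψ →
        (Ψ (gen α') = gen α ∨ Ψ (gen α') = -gen α) ∧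
        ∃ (hΨ : IsChainMap Ψ) (h' : IsStateCycle α')
          (h : IsStateCycle α),
          Kh.map Ψ hΨ (Kh.cls (gen α') h') =
              Kh.cls (gen α) h ∨
            Kh.map Ψ hΨ (Kh.cls (gen α') h') =
              -Kh.cls (gen α) h := by
  subst hw
  have hj : j + n ≤ width A A.length := by
    have := hpar.inRange
    rwa [width_append_of_le le_rfl] at this
  have hL := hD.insert_braid hj (qpWord F)
  obtain ⟨α', hα'⟩ := exists_isLift hD hj (qpWord F) α
  have hv := hα'.verticalAt
  have hcr := isCross_braid (qpWord F) j
  have hlen : ((qpWord F).map (Letter.slice j)).length = (qpWord F).length := List.length_map _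
  obtain ⟨h0, hne⟩ := hα
  have hcyc : IsStateCycle α' := hα'.isStateCycle hD hj hpar h0
  have hΨ : ∀ Ψ, JacobssonMovie A B j (qpWord F) Ψ →
      (Ψ (gen α') = gen α ∨ Ψ (gen α') = -gen α) ∧
        ∃ (hΨ : IsChainMap Ψ) (h' : IsStateCycle α') (h : IsStateCycle α),
          Kh.map Ψ hΨ (Kh.cls (gen α') h') = Kh.cls (gen α) h ∨
            Kh.map Ψ hΨ (Kh.cls (gen α') h') = -Kh.cls (gen α) h := by
    intro Ψ hmovie
    obtain ⟨hchain, hgen⟩ := hmovie.spec hD hj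
    have hg := hgen α α' hα'
    refine ⟨hg, hchain, hcyc, h0, ?_⟩
    obtain ⟨hz, he⟩ := Kh.map_cls hchain hcyc
    exact hg.imp (fun h => he.trans (Kh.cls_congr h hz h0))
      (fun h => he.trans (Kh.cls_neg h hz h0))
  have hmovie : ∃ Ψ, JacobssonMovie A B j (qpWord F) Ψ := reducible_qpWord F
  refine ⟨hL, ⟨fun P => dir (collapse hcr P), isOrientation_collapse hdir hpar, ?_, ?_⟩,
    α', hα', fun β hβ => hα'.unique hD hj hβ, ?_, ?_, ⟨hcyc, ?_⟩, hmovie, hΨ⟩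
  · intro P P' hP
    exact congrArg dir (collapse_eq_of_samePoint hcr (by rw [hlen]; exact hP.symm))
  · exact fun t c hc => isPositive_braid hL hpar t hc
  · intro P Q P' Q' hP hQ
    rw [hα'.smoothing]
    exact hv.sameLoop_iff hL hD (by rw [hlen]; exact hP.symm) (by rw [hlen]; exact hQ.symm)
  · intro Q'
    obtain ⟨P', hP, hQ⟩ := hv.collapse hL hcr Q'
    rw [hlen] at hP
    exact ⟨collapse hcr Q', P', hP.symm, hQ⟩
  -- A single movie suffices: if the class of `α'` were zero, so would be its image, which is plus
  -- or minus the class of `α`.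
  · obtain ⟨Ψ, hm⟩ := hmovie
    obtain ⟨-, hchain, h', h, hcls⟩ := hΨ Ψ hm
    intro hzero
    rw [hzero, map_zero] at hcls
    rcases hcls with e | e
    · exact hne e.symm
    · exact hne (neg_eq_zero.1 e.symm)
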